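/- **Notation.** Let a group $G$ act by isometries on a metric space $(X,d)$ with base point $o$, let $M=X/G$ carry the quotient metric $d_M(P(x),P(y))=\inf_{g\in G} d(x,g.y)$, with $P:X\to M$ the quotient map and $y_0=P(o)$, and let $x\mapsto\mu_x$ be a family of finite measures on a boundary of $X$ with $\mu=\mu_o$ a probability measure supported on $\Lambda$. For $v\ge 0$ put $$A_n(\xi)=\max_{g\in G,\ d(o,g.o)\le n}\frac{d\mu_{g.o}}{d\mu_o}(\xi),\qquad C_n=e^{-vn}\int_\Lambda A_n\,d\mu .$$ The action of $G$ on $(\Lambda,\mu)$ has *non-vanishing extremal cocycle growth* (in dimension $v$) if $\liminf_{n\to\infty}C_n>0$. Let $\Sigma_r(o)$ be the sphere of radius $r$ about $o$. For $X$ proper CAT(0), $\partial X$ is the horofunction boundary, $\beta_\xi(p,q)=\lim_{z\to\xi}(d(p,z)-d(q,z))$, and a $G$-invariant *conformal density* of dimension $v$ on $\Lambda\subset\partial X$ is a family of finite measures $\mu_x$ supported on $\Lambda$ with $\mu_{g.x}=g_*\mu_x$ and $\frac{d\mu_x}{d\mu_o}(\xi)=e^{v\beta_\xi(o,x)}$.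 A family of probability measures $\mu_r$ on $\Sigma_r(o)$ $(r>0)$ is *averaging* with respect to $\mu$ if $(\pi_{rt})_*\mu_r=\mu_t$ for $0<t<r$, where $\pi_{rt}(x)=[o,x]\cap\Sigma_t(o)$, and if there is $C\ge1$ such that every weak limit $\mu_\infty$ (in $X\cup\partial X$) of a sequence $\mu_{r_k}$, $r_k\to\infty$, is supported on $\Lambda$ and satisfies $C^{-1}\mu\le\mu_\infty\le C\mu$. **Proposition.** Let $(G,X,\Lambda)$, $o$, $\mu$, $v$ and $\{\mu_r\}$ be as in one of the following cases. 1. $X$ is a proper CAT(-1) space, $G$ acts freely and properly discontinuously by isometries with infinite limit set $\Lambda$; $\{\mu_x\}$ is a $G$-invariant conformal density of dimension $v$ on $\Lambda$ with $\mu=\mu_o$ a probability measure; $\{\mu_r\}$ is averaging with respect to $\mu$. 2. $X=\mathrm{Teich}(S)$, with the Teichmüller metric, for a closed oriented surface $S$ of genus $g\ge2$, $G=MCG(S)$, $\Lambda=\mathcal{PMF}(S)$, $v=6g-6$; $\mu_x(U)=a\,\nu\{\xi\in\mathcal{MF}(S):[\xi]\in U,\ \mathrm{Ext}_\xi(x)\le1\}$,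 where $\nu$ is the Thurston measure and $a$ is chosen so that $\mu=\mu_o$ is a probability measure. Points of $\Sigma_r(o)$ correspond to unit norm holomorphic quadratic differentials $q$ at $o$ by the Teichmüller geodesic flow for time $r$, and $q$ determines the point of $\mathcal{PMF}(S)$ given by its vertical foliation, whose leaves are contracted along the ray. $\{\mu_r\}$ is averaging with respect to $\mu$: there are a probability measure $\kappa$ on the unit norm quadratic differentials at $o$ and $C\ge 1$ such that $\mu_r$ is the image of $\kappa$ under the geodesic flow for time $r$, for every $r>0$, and the image $\mu_\infty$ of $\kappa$ in $\mathcal{PMF}(S)$ satisfies $C^{-1}\mu\le\mu_\infty\le C\mu$. 3. $X$ is a symmetric space of noncompact type and rank at least $2$, $G$ acts properly discontinuously by isometries with finite covolume (as a lattice does), $\Lambda\subset\partial X$ is the Furstenberg boundary, embedded as the orbit, under the stabilizer of $o$ in the isometry group, of a regular point $z\in\partial X$ (for instance the barycenter of a Weyl chamber at infinity); $\{\mu_x\}$ is a $G$-invariant conformal density of dimension $v$ on $\Lambda$ with $\mu=\mu_o$ a probability measure; $\{\mu_r\}$ is averaging with respect to $\mu$. Suppose that there are $c,R_0>0$ and $0<\alpha\le1$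 such that for all $r\ge R_0$ $$\mu_r(\{x\in\Sigma_r(o): d_M(P(x),y_0)\le c\})\ge\alpha .$$ Then the action of $G$ on $(\Lambda,\mu)$ has non-vanishing extremal cocycle growth. -/

import Mathlib

open Real Set Filter Topology MeasureTheory UpperHalfPlane
open scoped NNReal ENNReal ContDiff Manifold Bundle MatrixGroups ComplexConjugate

noncomputable section

/-! ## Extremal cocycle growth

A group `G` acts on a space `X` with distance `d` and base point `o`; `orb : ι → X` enumerates the
orbit `G.o` (for a group acting on a type, `ι = G` and `orb g = g • o`), and `x ↦ μ x` is a family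
of measures on a boundary `B`. -/

/-- The pointwise partial maximum
`A_n(ξ) = max { d μ_{g.o} / d μ_o (ξ) : g ∈ G, d(o, g.o) ≤ n }`. -/
def extremalValue {ι X B : Type*} [MeasurableSpace B] (d : X → X → ℝ) (orb : ι → X)
    (μ : X → Measure B) (o : X) (n : ℝ) (ξ : B) : ℝ≥0∞ :=
  ⨆ (g : ι) (_ : d o (orb g) ≤ n), (μ (orb g)).rnDeriv (μ o) ξ

/-- The normalized extremal cocycle `C_n = e^{-vn} ∫ A_n dμ_o`. -/
def normalizedExtremalCocycle {ι X B : Type*} [MeasurableSpace B] (d : X → X → ℝ) (orb : ι → X)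
    (μ : X → Measure B) (o : X) (v n : ℝ) : ℝ≥0∞ :=
  (∫⁻ ξ, extremalValue d orb μ o n ξ ∂(μ o)) / ENNReal.ofReal (Real.exp (v * n))

/-- Non-vanishing extremal cocycle growth: `liminf C_n > 0`. -/
def NonVanishingECG {ι X B : Type*} [MeasurableSpace B] (d : X → X → ℝ) (orb : ι → X)
    (μ : X → Measure B) (o : X) (v : ℝ) : Prop :=
  0 < liminf (fun n : ℕ => normalizedExtremalCocycle d orb μ o v n) atTop

/-- The distance `d_M(P(x), P(o))` in the quotient `M = X/G`, namely the distance from `x` to the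
orbit of `o`. -/
def quotientDist {ι X : Type*} (d : X → X → ℝ) (orb : ι → X) (x : X) : ℝ :=
  ⨅ g : ι, d x (orb g)

/-- For all large `r`, a definite proportion of the sphere of radius `r` (with respect to the
measure `m r` carried by it) projects to within distance `c` of the base point of `M = X/G`. -/
def SpheresReturn {ι X : Type*} [MeasurableSpace X] (d : X → X → ℝ) (orb : ι → X)
    (m : ℝ → Measure X) : Prop :=
  ∃ c R₀ α : ℝ, 0 < c ∧ 0 < R₀ ∧ 0 < α ∧ α ≤ 1 ∧
    ∀ r : ℝ, R₀ ≤ r → ENNReal.ofReal α ≤ m r {x | quotientDist d orb x ≤ c}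

/-! ## Metric geometry -/

/-- Any two points are joined by a geodesic segment. -/
def IsGeodesicSpace (X : Type*) [MetricSpace X] : Prop :=
  ∀ x y : X, ∃ γ : ℝ → X, γ 0 = x ∧ γ (dist x y) = y ∧
    ∀ s ∈ Icc 0 (dist x y), ∀ t ∈ Icc 0 (dist x y), dist (γ s) (γ t) = |s - t|

/-- Geodesic triangles in `X` are at least as thin as their comparison triangles in the model
plane `M`: `x` lies on a side `[p,q]`, `y` on a side `[p,r]`, and `x', y'` are the comparison
points. -/
def TrianglesThinnerThan (M X : Type*) [MetricSpace M] [MetricSpace X] : Prop :=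
  ∀ (p q r x y : X) (p' q' r' x' y' : M),
    dist p' q' = dist p q → dist q' r' = dist q r → dist p' r' = dist p r →
    dist p x + dist x q = dist p q → dist p y + dist y r = dist p r →
    dist p' x' = dist p x → dist x' q' = dist x q →
    dist p' y' = dist p y → dist y' r' = dist y r →
    dist x y ≤ dist x' y'

/-- CAT(-1) spaces; the upper half plane carries the hyperbolic metric of curvature `-1`. -/
def IsCATNegOne (X : Type*) [MetricSpace X] : Prop :=
  IsGeodesicSpace X ∧ TrianglesThinnerThan ℍ X

/-- CAT(0) spaces. -/
def IsCATZero (X : Type*) [MetricSpace X] : Prop :=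
  IsGeodesicSpace X ∧ TrianglesThinnerThan (EuclideanSpace ℝ (Fin 2)) X

section Horofunctions

variable {X : Type*} [MetricSpace X]

/-- The distance function of `x`, normalized to vanish at `o`. -/
def normalizedDist (o x : X) : X → ℝ := fun y => dist x y - dist x o

/-- The horofunction compactification of `X`: the closure of the normalized distance functions.
Functions modulo constants are represented by the functions vanishing at `o`; for 1-Lipschitz
functions pointwise convergence is the same as uniform convergence on compact sets. -/
def HoroCompactification (o : X) : Type _ := {h : X → ℝ // h ∈ closure (range (normalizedDist o))}

instance (o : X) : TopologicalSpace (HoroCompactification o) :=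
  inferInstanceAs (TopologicalSpace {h : X → ℝ // h ∈ closure (range (normalizedDist o))})

instance (o : X) : MeasurableSpace (HoroCompactification o) := borel _

instance (o : X) : BorelSpace (HoroCompactification o) := ⟨rfl⟩

/-- The embedding of `X` in its horofunction compactification. -/
def toHoro (o x : X) : HoroCompactification o :=
  ⟨normalizedDist o x, subset_closure (mem_range_self x)⟩

/-- The horofunction boundary `∂X`. -/
def horoBoundary (o : X) : Set (HoroCompactification o) := (range (toHoro o))ᶜ

/-- The Busemann cocycle `β_ξ(p,q) = lim_{z → ξ} (d(p,z) - d(q,z))`. -/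
def busemann {o : X} (ξ : HoroCompactification o) (p q : X) : ℝ := ξ.1 p - ξ.1 q

/-- Action of an isometry on functions vanishing at `o`. -/
def horoPush (o : X) (e : X ≃ᵢ X) (h : X → ℝ) : X → ℝ := fun y => h (e.symm y) - h (e.symm o)

theorem horoPush_mem (o : X) (e : X ≃ᵢ X) {h : X → ℝ}
    (hh : h ∈ closure (range (normalizedDist o))) :
    horoPush o e h ∈ closure (range (normalizedDist o)) := by
  have hc : Continuous (horoPush o e) := by
    unfold horoPush
    fun_prop
  refine map_mem_closure hc hh ?_
  rintro _ ⟨x, rfl⟩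
  refine ⟨e x, ?_⟩
  funext y
  have h1 : ∀ w, dist x (e.symm w) = dist (e x) w := fun w => by
    rw [← e.dist_eq x (e.symm w), e.apply_symm_apply]
  simp only [horoPush, normalizedDist, h1]
  ring

/-- Action of an isometry on the horofunction compactification. -/
def horoMap (o : X) (e : X ≃ᵢ X) (ξ : HoroCompactification o) : HoroCompactification o :=
  ⟨horoPush o e ξ.1, horoPush_mem o e ξ.2⟩

/-- The limit set: the accumulation points of the orbit of `o` in the boundary. -/
def limitSet (G : Type*) [Group G] [MulAction G X] (o : X) : Set (HoroCompactification o) :=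
  horoBoundary o ∩ closure (range fun g : G => toHoro o (g • o))

/-- `x ↦ μ x` is a `G`-invariant conformal density of dimension `v` supported on `Λ`. -/
structure IsConformalDensity (G : Type*) [Group G] [MulAction G X] [IsIsometricSMul G X]
    (o : X) (v : ℝ) (Λ : Set (HoroCompactification o))
    (μ : X → Measure (HoroCompactification o)) : Prop where
  finite : ∀ x, IsFiniteMeasure (μ x)
  support : ∀ x, μ x Λᶜ = 0
  equivariant : ∀ (g : G) (x : X),
    μ (g • x) = (μ x).map (horoMap o (IsometryEquiv.constSMul g))
  conformal : ∀ x, μ x = (μ o).withDensity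
    fun ξ => ENNReal.ofReal (Real.exp (v * busemann ξ o x))

open Classical in
/-- The radial projection `x ↦ [o,x] ∩ Σ_t(o)` to the sphere of radius `t`. In a CAT(0) space the
point is unique. -/
def radialProj (o : X) (t : ℝ) (x : X) : X :=
  if h : ∃ y, dist o y = t ∧ dist y x = dist o x - t then h.choose else x

/-- `m r` (`r > 0`) is a family of averaging measures on the spheres about `o` with respect to the
measure `μ₀` supported on `Λ`: the family is compatible with radial projections, and every weak
limit in the compactification is supported on `Λ` and uniformly comparable to `μ₀`. -/
structure IsAveraging [MeasurableSpace X] (o : X) (Λ : Set (HoroCompactification o))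
    (μ₀ : Measure (HoroCompactification o)) (m : ℝ → Measure X) : Prop where
  prob : ∀ r, 0 < r → IsProbabilityMeasure (m r)
  sphere : ∀ r, 0 < r → m r (Metric.sphere o r)ᶜ = 0
  proj : ∀ t r, 0 < t → t < r → (m r).map (radialProj o t) = m t
  limits : ∃ C : ℝ≥0, 1 ≤ C ∧
    ∀ (s : ℕ → ℝ) (m' : Measure (HoroCompactification o)), Tendsto s atTop atTop →
      IsProbabilityMeasure m' →
      (∀ f : C(HoroCompactification o, ℝ),
        Tendsto (fun k => ∫ x, f (toHoro o x) ∂(m (s k))) atTop (𝓝 (∫ ξ, f ξ ∂m'))) →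
      m' Λᶜ = 0 ∧ m' ≤ C • μ₀ ∧ μ₀ ≤ C • m'

end Horofunctions

/-! ## Symmetric spaces of noncompact type

The ambient object is a complete Riemannian manifold (given by Mathlib's type classes). -/

section Symmetric

variable (X : Type*) [MetricSpace X]

/-- The metric part of the definition of a symmetric space of noncompact type, for a complete
connected Riemannian manifold `X`: it is simply connected of nonpositive curvature (that is,
CAT(0)), it has a geodesic symmetry at each point, and it has no Euclidean de Rham factor (that is,
no nontrivial Clifford translation). -/
structure IsSymmetricNoncompactType : Prop where
  cat : IsCATZero X
  symm : ∀ p : X, ∃ s : X ≃ᵢ X, s p = p ∧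
    ∀ γ : ℝ → X, Isometry γ → γ 0 = p → ∀ t, s (γ t) = γ (-t)
  no_clifford : ∀ (e : X ≃ᵢ X) (c : ℝ), (∀ x, dist x (e x) = c) → c = 0

variable {X}

/-- A `k`-dimensional flat. -/
def IsFlat (k : ℕ) (F : Set X) : Prop :=
  ∃ i : EuclideanSpace ℝ (Fin k) → X, Isometry i ∧ range i = F

variable (X) in
/-- The rank: the maximal dimension of a flat. -/
def HasRank (k : ℕ) : Prop :=
  (∃ F : Set X, IsFlat k F) ∧ ∀ (j : ℕ) (F : Set X), IsFlat j F → j ≤ k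

/-- `z` is a regular point at infinity (the interior of a Weyl chamber at infinity) of a symmetric
space of rank `k`: the geodesic ray from `o` to `z` lies in exactly one maximal flat. -/
def IsRegularAtInfinity (k : ℕ) (o : X) (z : HoroCompactification o) : Prop :=
  ∃ γ : ℝ → X, γ 0 = o ∧ (∀ s t, 0 ≤ s → 0 ≤ t → dist (γ s) (γ t) = |s - t|) ∧
    (∀ y, Tendsto (fun t => dist (γ t) y - t) atTop (𝓝 (z.1 y))) ∧
    ∃! F : Set X, IsFlat k F ∧ ∀ t, 0 ≤ t → γ t ∈ F

/-- The Furstenberg boundary, embedded in `∂X` as the orbit of a point `z` at infinity under the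
stabilizer of `o` in the isometry group. -/
def furstenbergOrbit (o : X) (z : HoroCompactification o) : Set (HoroCompactification o) :=
  {ξ | ∃ e : X ≃ᵢ X, e o = o ∧ ξ = horoMap o e z}

end Symmetric

/-! ## Closed Riemann surfaces and Teichmüller space

A closed surface of genus at least two is written `S = ℍ/Γ`; objects on `S` are `Γ`-invariant
objects on `ℍ`. -/

/-- A closed Riemann surface `ℍ/Γ` of genus at least two: `Γ` acts on `ℍ` freely (up to `±1`),
properly discontinuously and cocompactly. A Borel fundamental domain `D` is chosen to integrate
invariant densities over the surface; nothing depends on the choice. -/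
structure ClosedSurface where
  Γ : Subgroup SL(2, ℝ)
  free : ∀ γ ∈ Γ, ∀ z : ℍ, γ • z = z → ∀ w : ℍ, γ • w = w
  properlyDisc : ∀ K : Set ℍ, IsCompact K →
    {γ : SL(2, ℝ) | γ ∈ Γ ∧ ((γ • · : ℍ → ℍ) '' K ∩ K).Nonempty}.Finite
  cocompact : ∃ K : Set ℍ, IsCompact K ∧ ∀ z : ℍ, ∃ γ ∈ Γ, γ • z ∈ K
  D : Set ℍ
  D_meas : MeasurableSet D
  D_cover : ∀ z : ℍ, ∃ γ ∈ Γ, γ • z ∈ D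
  D_unique : ∀ γ ∈ Γ, ∀ z ∈ D, γ • z ∈ D → γ • z = z

/-- The automorphy factor `cz + d`; the derivative of `z ↦ γ • z` is `(cz + d)⁻²`. -/
def autFactor (γ : SL(2, ℝ)) (z : ℍ) : ℂ := ((γ 1 0 : ℝ) : ℂ) * (z : ℂ) + ((γ 1 1 : ℝ) : ℂ)

/-- Lebesgue measure `dx dy` on the upper half plane. -/
def lebH : Measure ℍ := (volume : Measure ℂ).comap UpperHalfPlane.coe

/-- Sets with no accumulation point in `ℍ`. -/
def IsLocFinite (E : Set ℍ) : Prop := ∀ K : Set ℍ, IsCompact K → (E ∩ K).Finite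

namespace ClosedSurface

variable (S : ClosedSurface)

/-- The genus, half of the first Betti number. -/
def genus : ℕ := Module.finrank ℤ (Additive (Abelianization S.Γ)) / 2

/-- A complex structure on `S` compatible with the orientation and smooth off finitely many points
of `S`, given by its Beltrami coefficient `b`: the conformal metrics are `ρ |dz + b dz̄|`. -/
structure CplxStr where
  b : ℍ → ℂ
  bound : ∃ k : ℝ, k < 1 ∧ ∀ z, ‖b z‖ ≤ k
  equiv : ∀ γ ∈ S.Γ, ∀ z : ℍ, b (γ • z) * autFactor γ z ^ 2 = b z * conj (autFactor γ z) ^ 2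
  smooth : ∃ E : Set ℍ, IsLocFinite E ∧
    ∀ z ∉ E, ContDiffAt ℝ ∞ (fun w : ℂ => b (ofComplex w)) (z : ℂ)

/-- An orientation preserving homeomorphism of `ℍ` that is a smooth diffeomorphism off a locally
finite set. -/
def IsPiecewiseDiffeo (h : ℍ ≃ₜ ℍ) : Prop :=
  ∃ E : Set ℍ, IsLocFinite E ∧ ∀ z ∉ E,
    ContDiffAt ℝ ∞ (fun w : ℂ => (h (ofComplex w) : ℂ)) (z : ℂ) ∧
    0 < (fderiv ℝ (fun w : ℂ => (h (ofComplex w) : ℂ)) (z : ℂ)).det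

/-- `h` is `K`-quasiconformal from the complex structure `b₁` to `b₂`: off a locally finite set the
ratio of the largest to the smallest stretch of its differential, measured in metrics conformal
for `b₁` and `b₂`, is at most `K`. -/
def IsQC (b₁ b₂ : S.CplxStr) (K : ℝ) (h : ℍ ≃ₜ ℍ) : Prop :=
  ∃ E : Set ℍ, IsLocFinite E ∧ ∀ z ∉ E, ∀ w w' : ℂ,
    let D := fderiv ℝ (fun u : ℂ => (h (ofComplex u) : ℂ)) (z : ℂ)
    ‖D w + b₂.b (h z) * conj (D w)‖ * ‖w' + b₁.b z * conj w'‖ ≤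
      K * (‖D w' + b₂.b (h z) * conj (D w')‖ * ‖w + b₁.b z * conj w‖)

/-- `h` is the lift of a homeomorphism of `S` homotopic to the identity. -/
def IsLiftOfTrivial (h : ℍ ≃ₜ ℍ) : Prop :=
  IsPiecewiseDiffeo h ∧ ∀ γ ∈ S.Γ, ∀ z : ℍ, h (γ • z) = γ • h z

/-- `h` is the lift of an arbitrary orientation preserving homeomorphism of `S`, representing a
mapping class. -/
def IsLiftOfMap (h : ℍ ≃ₜ ℍ) : Prop :=
  IsPiecewiseDiffeo h ∧ (∀ γ ∈ S.Γ, ∃ γ' ∈ S.Γ, ∀ z : ℍ, h (γ • z) = γ' • h z) ∧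
    ∀ γ ∈ S.Γ, ∃ γ' ∈ S.Γ, ∀ z : ℍ, h.symm (γ • z) = γ' • h.symm z

/-- Two complex structures are Teichmüller equivalent if some conformal map between them is
homotopic to the identity. -/
def TeichRel (b₁ b₂ : S.CplxStr) : Prop := ∃ h : ℍ ≃ₜ ℍ, S.IsLiftOfTrivial h ∧ S.IsQC b₁ b₂ 1 h

/-- Teichmüller space. -/
def Teich : Type := Quot S.TeichRel

/-- The point of Teichmüller space represented by a complex structure. -/
def mkTeich (b : S.CplxStr) : S.Teich := Quot.mk _ b

/-- The Teichmüller distance `½ log inf K`, over quasiconformal maps homotopic to the identity. -/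
def teichDist (x y : S.Teich) : ℝ :=
  1 / 2 * Real.log (sInf {K : ℝ | 1 ≤ K ∧ ∃ b₁ b₂ : S.CplxStr, S.mkTeich b₁ = x ∧
    S.mkTeich b₂ = y ∧ ∃ h : ℍ ≃ₜ ℍ, S.IsLiftOfTrivial h ∧ S.IsQC b₁ b₂ K h})

instance : TopologicalSpace S.Teich :=
  TopologicalSpace.generateFrom {B | ∃ (x : S.Teich) (ε : ℝ), B = {y | S.teichDist x y < ε}}

instance : MeasurableSpace S.Teich := borel _

instance : BorelSpace S.Teich := ⟨rfl⟩

/-- The base point: the given Riemann surface `ℍ/Γ` itself. -/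
def baseStr : S.CplxStr where
  b := fun _ => 0
  bound := ⟨0, by norm_num, by simp⟩
  equiv := by simp
  smooth := ⟨∅, by intro K _; simp, fun z _ => contDiffAt_const⟩

/-- The base point of Teichmüller space. -/
def base : S.Teich := S.mkTeich S.baseStr

/-- The orbit of the base point under the mapping class group: a mapping class carries the base
point to `y` if some homeomorphism of `S` representing it is conformal from the base structure to a
structure representing `y`. -/
def mcgOrbit : Set S.Teich :=
  {y | ∃ b : S.CplxStr, S.mkTeich b = y ∧ ∃ h : ℍ ≃ₜ ℍ, S.IsLiftOfMap h ∧ S.IsQC S.baseStr b 1 h}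

/-! ### Simple closed curves -/

/-- `c : [0,1] → ℍ` is a lift of a closed curve on `S` in the free homotopy class of `a`. -/
def IsLoopLift (a : S.Γ) (c : ℝ → ℍ) : Prop :=
  ContinuousOn c (Icc 0 1) ∧ c 1 = (a : SL(2, ℝ)) • c 0

/-- `a` is represented by an essential simple closed curve on `S`. -/
def IsSimpleClass (a : S.Γ) : Prop :=
  (∃ z : ℍ, (a : SL(2, ℝ)) • z ≠ z) ∧ ∃ c : ℝ → ℍ, S.IsLoopLift a c ∧
    ∀ s ∈ Ico (0 : ℝ) 1, ∀ t ∈ Ico (0 : ℝ) 1, ∀ γ ∈ S.Γ, γ • c s = c t → s = t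

/-- Essential simple closed curves (conjugate elements give the same free homotopy class, and
all functions of curves below are conjugation invariant). -/
def Curve : Type := {a : S.Γ // S.IsSimpleClass a}

/-- The geometric intersection number: the least number of intersections of representatives. -/
def interNum (α β : S.Curve) : ℕ :=
  (⨅ (c : ℝ → ℍ) (c' : ℝ → ℍ) (_ : S.IsLoopLift α.1 c) (_ : S.IsLoopLift β.1 c'),
    {p : ℝ × ℝ | p.1 ∈ Ico (0 : ℝ) 1 ∧ p.2 ∈ Ico (0 : ℝ) 1 ∧
      ∃ γ ∈ S.Γ, γ • c p.1 = c' p.2}.encard).toNat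

/-! ### Measured foliations

A measured foliation is encoded by the quadratic differential `Q dz²` (in general not holomorphic)
whose vertical foliation it is: the transverse measure is `|Re (√Q dz)|`. -/

/-- The transverse measure `|Re (√Q w)|` of a tangent vector `w`. -/
def transverse (Q w : ℂ) : ℝ := |(Q ^ (1 / 2 : ℂ) * w).re|

/-- `Q` defines a measured foliation of `S`: it is invariant, and near each point `p` it is the
pull-back, by a chart centered at `p` that is smooth off `p`, of the standard `(n+2)`-prong model
`|Re (ζ^{n/2} dζ)|`, `n ≥ 0`. -/
def IsMeasuredFoliation (Q : ℍ → ℂ) : Prop :=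
  (∀ γ ∈ S.Γ, ∀ z : ℍ, Q (γ • z) = autFactor γ z ^ 4 * Q z) ∧
  ∀ p : ℍ, ∃ (ψ : OpenPartialHomeomorph ℂ ℂ) (n : ℕ),
    (p : ℂ) ∈ ψ.source ∧ ψ.source ⊆ {z | 0 < z.im} ∧ ψ p = 0 ∧
    ∀ z : ℍ, (z : ℂ) ∈ ψ.source → z ≠ p →
      ContDiffAt ℝ ∞ ψ (z : ℂ) ∧ (fderiv ℝ ψ (z : ℂ)).det ≠ 0 ∧
      ∀ w : ℂ, transverse (Q z) w = transverse (ψ z ^ n) (fderiv ℝ ψ (z : ℂ) w)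

/-- The intersection number `i(F, α)` of the measured foliation of `Q` with a curve: the infimum of
the transverse measures of the curves in the class (continuous, and continuously
differentiable away from a locally finite set of points of the surface, which is not counted). -/
def height (Q : ℍ → ℂ) (α : S.Curve) : ℝ :=
  (⨅ (c : ℝ → ℍ) (E : Set ℍ) (_ : S.IsLoopLift α.1 c) (_ : IsLocFinite E)
    (_ : ∀ t ∈ Ioo (0 : ℝ) 1, c t ∉ E → ContDiffAt ℝ 1 (fun s => (c s : ℂ)) t),
    ∫⁻ t in {t | t ∈ Ioo (0 : ℝ) 1 ∧ c t ∉ E},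
      ENNReal.ofReal (transverse (Q (c t)) (deriv (fun s => (c s : ℂ)) t))).toReal

/-- The space `MF(S)`: measured foliations, two of them being identified if they have the same
intersection numbers with all simple closed curves. The topology is that of `ℝ^{Curve}`. -/
def MF : Set (S.Curve → ℝ) := {ξ | ∃ Q : ℍ → ℂ, S.IsMeasuredFoliation Q ∧ S.height Q = ξ}

/-- Integral points of `MF(S)`: the multicurves `∑ mⱼ αⱼ` with the `αⱼ` disjoint. -/
def integralMF : Set (S.Curve → ℝ) :=
  {ξ | ∃ m : S.Curve →₀ ℕ, m ≠ 0 ∧ (∀ α ∈ m.support, ∀ β ∈ m.support, S.interNum α β = 0) ∧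
    ∀ β, ξ β = ∑ α ∈ m.support, (m α : ℝ) * (S.interNum α β : ℝ)}

/-- The dimension `6g - 6` of Teichmüller space. -/
def dimT : ℝ := 6 * (S.genus : ℝ) - 6

/-- The Thurston measure on `MF(S)`: the homogeneous Borel measure, finite on bounded sets,
which is the limit of the counting measures of integral points rescaled by `L → ∞`. -/
structure IsThurstonMeasure (ν : Measure (S.Curve → ℝ)) : Prop where
  support : ν S.MFᶜ = 0
  finite_bdd : ∀ B : S.Curve → ℝ, ν {ξ | ξ ∈ S.MF ∧ ξ ≤ B} < ⊤
  homogeneous : ∀ t : ℝ, 0 < t → ∀ A : Set (S.Curve → ℝ),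
    ν ((fun ξ => t • ξ) '' A) = ENNReal.ofReal (t ^ S.dimT) * ν A
  limit : ∀ f : (S.Curve → ℝ) → ℝ, Continuous f → (∃ M, ∀ ξ, |f ξ| ≤ M) →
    (∃ B : S.Curve → ℝ, ∀ ξ ∈ S.MF, f ξ ≠ 0 → ξ ≤ B) →
    Tendsto (fun L : ℝ => L ^ (-S.dimT) * ∑' γ : S.integralMF, f (L⁻¹ • γ.1)) atTop
      (𝓝 (∫ ξ, f ξ ∂ν))

/-- Projective classes of functions of curves; `PMF(S)` is the image of `MF(S)`, and the measures
below are supported there. A set of classes is measurable if the cone over it is. -/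
def Proj : Type := Quot fun ξ η : S.Curve → ℝ => ∃ t : ℝ, 0 < t ∧ η = t • ξ

instance : MeasurableSpace S.Proj :=
  inferInstanceAs (MeasurableSpace (Quot fun ξ η : S.Curve → ℝ => ∃ t : ℝ, 0 < t ∧ η = t • ξ))

/-- The projective class `[ξ]`. -/
def mkProj (ξ : S.Curve → ℝ) : S.Proj := Quot.mk _ ξ

/-! ### Extremal length and the Thurston conformal density -/

/-- `∫∫ ρ × F`: the area integral of the product of the length along the leaves, for the
conformal metric `ρ |dz + b dz̄|`, and of the transverse measure `|Re (√Q dz)|`. (A leaf has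
direction `i · conj √Q`.) -/
def foliationLength (b : S.CplxStr) (ρ : ℍ → ℝ≥0) (Q : ℍ → ℂ) : ℝ≥0∞ :=
  ∫⁻ z in S.D, ENNReal.ofReal (ρ z *
    ‖conj (Q z ^ (1 / 2 : ℂ)) - b.b z * Q z ^ (1 / 2 : ℂ)‖) ∂lebH

/-- The area of the conformal metric `ρ |dz + b dz̄|`. -/
def metricArea (b : S.CplxStr) (ρ : ℍ → ℝ≥0) : ℝ≥0∞ :=
  ∫⁻ z in S.D, ENNReal.ofReal ((ρ z : ℝ) ^ 2 * (1 - ‖b.b z‖ ^ 2)) ∂lebH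

/-- The extremal length of the class `ξ` for a complex structure: the supremum over conformal
metrics `ρ` of `ℓ_ρ(ξ)² / Area(ρ)`, where `ℓ_ρ(ξ)` is the infimum of `∫∫ ρ × F` over the measured
foliations `F` in the class. -/
def extStr (b : S.CplxStr) (ξ : S.Curve → ℝ) : ℝ≥0∞ :=
  ⨆ (ρ : ℍ → ℝ≥0) (_ : Measurable ρ)
    (_ : ∀ γ ∈ S.Γ, ∀ z : ℍ, (ρ (γ • z) : ℝ) = ρ z * ‖autFactor γ z‖ ^ 2)
    (_ : 0 < S.metricArea b ρ) (_ : S.metricArea b ρ < ⊤),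
    (⨅ (Q : ℍ → ℂ) (_ : S.IsMeasuredFoliation Q) (_ : S.height Q = ξ),
      S.foliationLength b ρ Q) ^ 2 / S.metricArea b ρ

/-- Extremal length as a function on Teichmüller space. -/
def extLength (x : S.Teich) (ξ : S.Curve → ℝ) : ℝ≥0∞ :=
  ⨅ (b : S.CplxStr) (_ : S.mkTeich b = x), S.extStr b ξ

/-- The measures `U ↦ ν {ξ : [ξ] ∈ U, Ext_ξ(x) ≤ 1}` on `PMF(S)`. -/
def thurstonDensity₀ (ν : Measure (S.Curve → ℝ)) (x : S.Teich) : Measure S.Proj :=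
  (ν.restrict {ξ | S.extLength x ξ ≤ 1}).map S.mkProj

/-- The Thurston conformal density, normalized to be a probability measure at the base point. -/
def thurstonDensity (ν : Measure (S.Curve → ℝ)) (x : S.Teich) : Measure S.Proj :=
  (S.thurstonDensity₀ ν S.base univ)⁻¹ • S.thurstonDensity₀ ν x

/-! ### Quadratic differentials and the Teichmüller geodesic flow -/

/-- Unit norm holomorphic quadratic differentials at the base point. -/
def UnitQD : Type :=
  {q : ℍ → ℂ // DifferentiableOn ℂ (fun w : ℂ => q (ofComplex w)) {w | 0 < w.im} ∧
    (∀ γ ∈ S.Γ, ∀ z : ℍ, q (γ • z) = autFactor γ z ^ 4 * q z) ∧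
    ∫⁻ z in S.D, ‖q z‖ₑ ∂lebH = 1}

/-- The smallest sigma-algebra for which the values `q z` are measurable. -/
instance : MeasurableSpace S.UnitQD :=
  inferInstanceAs (MeasurableSpace {q : ℍ → ℂ //
    DifferentiableOn ℂ (fun w : ℂ => q (ofComplex w)) {w | 0 < w.im} ∧
    (∀ γ ∈ S.Γ, ∀ z : ℍ, q (γ • z) = autFactor γ z ^ 4 * q z) ∧
    ∫⁻ z in S.D, ‖q z‖ₑ ∂lebH = 1})

/-- The identification of unit quadratic differentials with `PMF(S)`: the vertical foliation. It is
the endpoint at infinity of the geodesic ray of `q`, along which its leaves are contracted. -/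
def vertical (q : S.UnitQD) : S.Proj := S.mkProj (S.height q.1)

theorem UnitQD.exists_ne_zero (q : S.UnitQD) : ∃ z, q.1 z ≠ 0 := by
  by_contra h
  push Not at h
  have := q.2.2.2
  simp [h] at this

theorem UnitQD.analyticAt (q : S.UnitQD) (z : ℍ) :
    AnalyticAt ℂ (fun w : ℂ => q.1 (ofComplex w)) (z : ℂ) :=
  q.2.1.analyticAt ((isOpen_lt continuous_const Complex.continuous_im).mem_nhds z.im_pos)

theorem UnitQD.isLocFinite_zeros (q : S.UnitQD) : IsLocFinite {z | q.1 z = 0} := by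
  obtain ⟨z₀, hz₀⟩ := UnitQD.exists_ne_zero S q
  have hconn : IsConnected {w : ℂ | 0 < w.im} :=
    ⟨⟨Complex.I, by simp⟩, (convex_halfSpace_im_gt 0).isPreconnected⟩
  have han : AnalyticOnNhd ℂ (fun w : ℂ => q.1 (ofComplex w)) {w : ℂ | 0 < w.im} :=
    q.2.1.analyticOnNhd (isOpen_lt continuous_const Complex.continuous_im)
  have hcod := han.preimage_zero_mem_codiscreteWithin (x := (z₀ : ℂ))
    (by simpa using hz₀) z₀.im_pos hconn
  rw [mem_codiscreteWithin_iff_forall_mem_nhdsNE] at hcod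
  intro K hK
  have hloc : ∀ z : ℍ, ∀ᶠ y in 𝓝[≠] z, q.1 y ≠ 0 := by
    intro z
    have h1 := hcod (z : ℂ) z.im_pos
    have ht : Tendsto (UpperHalfPlane.coe) (𝓝[≠] z) (𝓝[≠] (z : ℂ)) :=
      tendsto_nhdsWithin_of_tendsto_nhds_of_eventually_within _
        (UpperHalfPlane.continuous_coe.continuousAt.tendsto.mono_left nhdsWithin_le_nhds)
        (by
          filter_upwards [self_mem_nhdsWithin] with y hy h
          exact hy (UpperHalfPlane.ext h))
    filter_upwards [ht h1] with y hy
    rcases hy with hy | hy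
    · simpa using hy
    · exact absurd y.im_pos hy
  by_contra hinf
  obtain ⟨z, -, hz⟩ := Set.Infinite.exists_accPt_of_subset_isCompact hinf hK inter_subset_right
  rw [accPt_iff_frequently_nhdsNE] at hz
  exact hz ((hloc z).mono fun y hy h => hy h.1)

/-- The Beltrami coefficient `tanh r · conj q / |q|` of the Teichmüller deformation of `q`: in a
natural coordinate `x + iy` of `q` the new structure has coordinate `e^r x + i e^{-r} y`. -/
def rayStr (r : ℝ) (q : S.UnitQD) : S.CplxStr where
  b := fun z => (Real.tanh r : ℂ) * (conj (q.1 z) / (‖q.1 z‖ : ℂ))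
  bound := by
    refine ⟨|Real.tanh r|, Real.abs_tanh_lt_one r, fun z => ?_⟩
    rw [norm_mul, norm_div, Complex.norm_real, Complex.norm_real, RCLike.norm_conj, norm_norm,
      Real.norm_eq_abs]
    exact mul_le_of_le_one_right (abs_nonneg _) (div_self_le_one _)
  equiv := by
    intro γ hγ z
    rw [q.2.2.1 γ hγ z]
    by_cases h0 : q.1 z = 0
    · simp [h0]
    by_cases hj : autFactor γ z = 0
    · simp [hj]
    have hq : (‖q.1 z‖ : ℂ) ≠ 0 := by simpa using h0
    have hj' : (‖autFactor γ z‖ : ℂ) ≠ 0 := by simpa using hj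
    have hjj : autFactor γ z * conj (autFactor γ z) = (‖autFactor γ z‖ : ℂ) ^ 2 :=
      Complex.mul_conj' _
    rw [norm_mul, norm_pow, map_mul, map_pow]
    push_cast
    field_simp
    have : (‖autFactor γ z‖ : ℂ) ^ 4 = (autFactor γ z * conj (autFactor γ z)) ^ 2 := by
      rw [hjj]; ring
    rw [this]
    ring
  smooth := by
    refine ⟨{z | q.1 z = 0}, UnitQD.isLocFinite_zeros S q, fun z hz => ?_⟩
    have hq : ContDiffAt ℝ ∞ (fun w : ℂ => q.1 (ofComplex w)) (z : ℂ) :=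
      ((UnitQD.analyticAt S q z).contDiffAt (n := ∞)).restrict_scalars ℝ
    have hne : q.1 (ofComplex (z : ℂ)) ≠ 0 := by simpa using hz
    have hn : ContDiffAt ℝ ∞ (fun w : ℂ => (‖q.1 (ofComplex w)‖ : ℂ)) (z : ℂ) :=
      Complex.ofRealCLM.contDiff.contDiffAt.comp (z : ℂ) (hq.norm ℝ hne)
    have hc : ContDiffAt ℝ ∞ (fun w : ℂ => conj (q.1 (ofComplex w))) (z : ℂ) :=
      Complex.conjCLE.contDiff.contDiffAt.comp (z : ℂ) hq
    have hi := hn.inv (by simpa using hne)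
    simp only [div_eq_mul_inv]
    exact contDiffAt_const.mul (hc.mul hi)

/-- The point at distance `r` on the Teichmüller geodesic ray from the base point with initial
direction `q`. -/
def ray (r : ℝ) (q : S.UnitQD) : S.Teich := S.mkTeich (S.rayStr r q)

/-- `m r` (`r > 0`) is a family of averaging measures on the spheres about the base point of
Teichmüller space with respect to the measure `μ₀` on `PMF(S)`. Every point at distance `r` from
the base point is `ray r q` for a unique unit quadratic differential `q`, so that compatibility
of the family with the radial projections means that all `m r` come from one measure `κ` on the
unit quadratic differentials; the projection of `m r` to `PMF(S)`, and its limit, is then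
the image of `κ`, which has to be uniformly comparable to `μ₀`. -/
def IsTeichAveraging (μ₀ : Measure S.Proj) (m : ℝ → Measure S.Teich) : Prop :=
  ∃ κ : Measure S.UnitQD, IsProbabilityMeasure κ ∧ (∀ r, 0 < r → m r = κ.map (S.ray r)) ∧
    ∃ C : ℝ≥0, 1 ≤ C ∧ κ.map S.vertical ≤ C • μ₀ ∧ μ₀ ≤ C • κ.map S.vertical

end ClosedSurface

end

noncomputable section

/-! ## Horofunction compactifications -/

section Horo

variable {X : Type*} [MetricSpace X]

/-! The mechanism is the same in all cases. Suppose that the ray from `o` towards `ξ` passes, at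
time `t`, within `c + 1` of an orbit point `g.o`. Then `d(o, g.o) ≤ t + c + 1 =: n`, and moving the
base point to `g.o` has gained almost the full length `t` in the direction of `ξ`, so that the
density of `μ_{g.o}` at `ξ` is at least a constant times `e^{vn}`. Hence `A_n(ξ)` is at least a
constant times `e^{vn}`. By hypothesis a proportion `α` of the directions has this property at time
`t`, and the averaging condition transfers the proportion to `(Λ, μ)` at the cost of the factor `C`.
Integration bounds `C_n` below independently of `n`.

For conformal densities (`IsAveraging.nonVanishingECG`) directions are horofunctions and the gain is
read off from the Busemann cocycle. The good directions at time `t` form a closed set `K t`.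
Compatibility with radial projections gives it mass at least `α` for every sphere of radius larger
than `t`, and closedness preserves this bound in a weak limit, which exists because the
compactification is compact and metrizable.

For Teichmüller space (`IsTeichAveraging.nonVanishingECG`), with `d = 6g - 6`, the density of `μ_y`
at `[ξ]` is formally `(Ext_o(ξ) / Ext_y(ξ))^{d/2}`. The extremal length of the vertical foliation is
at most `e^{-2r}` at time `r` of its ray (`extStr_rayStr_le`, by the Cauchy-Schwarz inequality), and
a `K`-quasiconformal change of structure multiplies extremal length by at most `K`
(`QCRel.extStr_le`); so `Ext_y` is at most about `e^{-2r}` at an orbit point `y` near the ray.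

To turn this into a bound for the Radon-Nikodym derivative, the homogeneous Thurston measure is
disintegrated along rays without choosing a section. Extremal length is not assumed measurable, so
unit balls are replaced by measurable hulls (`IsHomogeneousMeasure.exists_radial_hull`), and the
derivative bound is obtained off a null set (`measure_rnDeriv_lt_eq_zero`). The denominator, the
radial mass of the hull of the unit ball at `o`, is finite almost everywhere, hence bounded off a
set of small mass; no uniform bound is needed. The orbit is countable, so the exceptional null sets
can be united. Finally, the vertical foliation depends measurably on the differential because
intersection numbers can be computed with countably many polygons. -/

theorem HoroCompactification.abs_sub_le {o : X} (ξ : HoroCompactification o) (p q : X) :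
    |ξ.1 p - ξ.1 q| ≤ dist p q := by
  have hcl : IsClosed {h : X → ℝ | |h p - h q| ≤ dist p q} :=
    isClosed_le (by fun_prop) continuous_const
  refine closure_minimal ?_ hcl ξ.2
  rintro _ ⟨x, rfl⟩
  simp only [normalizedDist, mem_ofPred_eq, sub_sub_sub_cancel_right]
  rw [dist_comm x p, dist_comm x q]
  exact abs_dist_sub_le p q x

theorem HoroCompactification.apply_base {o : X} (ξ : HoroCompactification o) : ξ.1 o = 0 := by
  have hcl : IsClosed {h : X → ℝ | h o = 0} := isClosed_eq (by fun_prop) continuous_const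
  refine closure_minimal ?_ hcl ξ.2
  rintro _ ⟨x, rfl⟩
  simp [normalizedDist]

theorem HoroCompactification.continuous_eval (o p : X) :
    Continuous fun ξ : HoroCompactification o => ξ.1 p :=
  (continuous_apply p).comp continuous_subtype_val

/-- Horofunctions are 1-Lipschitz and vanish at `o`, so they form a closed subset of a product of
compact intervals. -/
instance HoroCompactification.compactSpace (o : X) : CompactSpace (HoroCompactification o) := by
  refine isCompact_iff_compactSpace.mp ?_
  have hK : IsCompact (Set.pi univ fun p : X => Icc (-dist p o) (dist p o)) :=
    isCompact_univ_pi fun p => isCompact_Icc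
  refine hK.of_isClosed_subset isClosed_closure ?_
  intro h hh p _
  have h1 := HoroCompactification.abs_sub_le (o := o) ⟨h, hh⟩ p o
  have h0 : h o = 0 := HoroCompactification.apply_base ⟨h, hh⟩
  simp only [h0, sub_zero] at h1
  exact abs_le.mp h1

instance HoroCompactification.t2Space (o : X) : T2Space (HoroCompactification o) :=
  inferInstanceAs (T2Space {h : X → ℝ // h ∈ closure (range (normalizedDist o))})

/-- A Lipschitz function is determined by its values on a countable dense set, which embeds the
compact space into `ℕ → ℝ`. Metrizability serves to extract weakly convergent sequences of
probability measures. -/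
instance HoroCompactification.metrizableSpace [TopologicalSpace.SeparableSpace X] (o : X) :
    TopologicalSpace.MetrizableSpace (HoroCompactification o) := by
  have : Nonempty X := ⟨o⟩
  let e : HoroCompactification o → ℕ → ℝ := fun ξ n => ξ.1 (TopologicalSpace.denseSeq X n)
  have hc : Continuous e :=
    continuous_pi fun n => HoroCompactification.continuous_eval o _
  have hL : ∀ ξ : HoroCompactification o, Continuous ξ.1 := fun ξ =>
    (LipschitzWith.of_dist_le_mul (K := 1) fun p q => by
      simpa [Real.dist_eq] using ξ.abs_sub_le p q).continuous
  have hi : Function.Injective e := by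
    intro ξ η h
    refine Subtype.ext ?_
    refine (TopologicalSpace.denseRange_denseSeq X).equalizer (hL ξ) (hL η) ?_
    exact h
  exact (hc.isClosedEmbedding hi).isEmbedding.metrizableSpace

theorem continuous_toHoro (o : X) : Continuous (toHoro o) := by
  refine Continuous.subtype_mk ?_ _
  refine continuous_pi fun p => ?_
  unfold normalizedDist
  fun_prop

end Horo

/-! ### Conformal densities and averaging measures on proper spaces -/

/-- The density of a conformal density of dimension `v`. -/
theorem IsConformalDensity.rnDeriv_eq {X : Type*} [MetricSpace X] {G : Type*} [Group G]
    [MulAction G X] [IsIsometricSMul G X] {o : X} {v : ℝ} {Λ : Set (HoroCompactification o)}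
    {μ : X → Measure (HoroCompactification o)} (h : IsConformalDensity G o v Λ μ) (x : X) :
    (μ x).rnDeriv (μ o) =ᵐ[μ o] fun ξ => ENNReal.ofReal (Real.exp (v * busemann ξ o x)) := by
  have := h.finite o
  rw [h.conformal x]
  refine Measure.rnDeriv_withDensity _ ?_
  have h1 := (HoroCompactification.continuous_eval o o).measurable
  have h2 := (HoroCompactification.continuous_eval o x).measurable
  exact (((h1.sub h2).const_mul v).exp).ennreal_ofReal

/-- A lower bound for the normalized extremal cocycles that does not depend on `n`. -/
theorem nonVanishingECG_of_le {ι X B : Type*} [MeasurableSpace B] {d : X → X → ℝ} {orb : ι → X}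
    {μ : X → Measure B} {o : X} {v : ℝ} (ε : ℝ≥0∞) (hε : 0 < ε)
    (h : ∀ᶠ n : ℕ in atTop, ε * ENNReal.ofReal (Real.exp (v * n)) ≤
      ∫⁻ ξ, extremalValue d orb μ o n ξ ∂(μ o)) :
    NonVanishingECG d orb μ o v := by
  refine hε.trans_le (le_liminf_of_le (by isBoundedDefault) ?_)
  filter_upwards [h] with n hn
  rw [normalizedExtremalCocycle, ENNReal.le_div_iff_mul_le]
  · exact hn
  · left
    exact (ENNReal.ofReal_pos.mpr (Real.exp_pos _)).ne'
  · left
    exact ENNReal.ofReal_ne_top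

theorem continuous_quotientDist {ι X : Type*} [Nonempty ι] [MetricSpace X] (orb : ι → X) :
    Continuous (quotientDist dist orb) := by
  have hb : ∀ x : X, BddBelow (range fun g => dist x (orb g)) := fun x =>
    ⟨0, by rintro _ ⟨g, rfl⟩; exact dist_nonneg⟩
  refine (LipschitzWith.of_le_add fun x y => ?_).continuous
  unfold quotientDist
  refine le_ciInf_add fun g => ?_
  refine (ciInf_le (hb x) g).trans ?_
  linarith [dist_triangle x y (orb g)]

/-- Groups acting on proper spaces with a conformal density and averaging measures on spheres:
recurrence of the spheres implies non-vanishing extremal cocycle growth. -/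
theorem IsAveraging.nonVanishingECG {X : Type*} [MetricSpace X] [ProperSpace X]
    [MeasurableSpace X] [BorelSpace X] {G : Type*} [Group G] [MulAction G X] [IsIsometricSMul G X]
    [ProperlyDiscontinuousSMul G X] {o : X} {v : ℝ} {Λ : Set (HoroCompactification o)}
    {μ : X → Measure (HoroCompactification o)} {m : ℝ → Measure X} (hv : 0 ≤ v)
    (hμ : IsConformalDensity G o v Λ μ) (hm : IsAveraging o Λ (μ o) m)
    (hs : SpheresReturn dist (fun g : G => g • o) m) :
    NonVanishingECG dist (fun g : G => g • o) μ o v := by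
  obtain ⟨c, R₀, α, hc, hR, hα, -, hret⟩ := hs
  obtain ⟨C, hC1, hlim⟩ := hm.limits
  -- a weak limit of the measures on the spheres
  have hprob : ∀ k : ℕ, IsProbabilityMeasure ((m (k + 1)).map (toHoro o)) := fun k => by
    have := hm.prob (k + 1) (by positivity)
    exact Measure.isProbabilityMeasure_map (continuous_toHoro o).measurable.aemeasurable
  let P : ℕ → ProbabilityMeasure (HoroCompactification o) := fun k =>
    ⟨(m (k + 1)).map (toHoro o), hprob k⟩
  obtain ⟨P', -, φ, hφ, hP⟩ := isCompact_univ.tendsto_subseq fun k => mem_univ (P k)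
  have hφ' : Tendsto (fun k => ((φ k : ℕ) : ℝ) + 1) atTop atTop :=
    tendsto_atTop_add_const_right _ _ (tendsto_natCast_atTop_atTop.comp hφ.tendsto_atTop)
  obtain ⟨-, hle, -⟩ := hlim (fun k => (φ k : ℕ) + 1) P' hφ' inferInstance (by
    intro f
    have h1 := (ProbabilityMeasure.tendsto_iff_forall_integral_tendsto.mp hP)
      (BoundedContinuousFunction.mkOfCompact f)
    refine h1.congr fun k => ?_
    simp only [P,     BoundedContinuousFunction.mkOfCompact_apply]
    exact integral_map (continuous_toHoro o).measurable.aemeasurable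
      f.continuous.measurable.aestronglyMeasurable)
  have hC0 : (C : ℝ≥0∞) ≠ 0 := by
    have : C ≠ 0 := (lt_of_lt_of_le one_pos hC1).ne'
    exact_mod_cast this
  -- The directions that pass near the orbit at time `t`. The slack `c + 1` replaces `c` because the
  -- infimum in `quotientDist` need not be attained. The inequalities are not strict so that `K t`
  -- is closed.
  let K : ℝ → Set (HoroCompactification o) := fun t =>
    ⋃ g ∈ {g : G | dist o (g • o) ≤ t + c + 1}, {ξ | ξ.1 (g • o) ≤ c + 1 - t}
  -- Balls are compact and the action is properly discontinuous. Finiteness makes the union `K t`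
  -- closed.
  have hfin : ∀ t : ℝ, {g : G | dist o (g • o) ≤ t}.Finite := fun t => by
    refine (finite_disjoint_inter_image (Γ := G) (isCompact_singleton (x := o))
      (isCompact_closedBall o t)).subset fun g hg => ?_
    have h1 : g • o ∈ Metric.closedBall o t := by
      rw [Metric.mem_closedBall, dist_comm]
      exact hg
    have h2 : g • o ∈ (g • ·) '' {o} ∩ Metric.closedBall o t :=
      Set.mem_inter (Set.mem_image_of_mem _ rfl) h1
    exact Set.nonempty_of_mem h2
  have hKcl : ∀ t, IsClosed (K t) := fun t =>
    (hfin _).isClosed_biUnion fun g _ =>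
      isClosed_le (HoroCompactification.continuous_eval o _) continuous_const
  -- A point `x` of the sphere of radius `r` is at distance `r - t` from its projection. If the
  -- latter is within `c + 1` of `g.o`, then `d(x, g.o) - d(x, o) ≤ (r - t) + (c + 1) - r`.
  have hmass : ∀ t r, R₀ ≤ t → t < r → ENNReal.ofReal α ≤ (m r).map (toHoro o) (K t) := by
    intro t r ht htr
    have ht0 : 0 < t := hR.trans_le ht
    have h1 := hret t ht
    rw [← hm.proj t r ht0 htr] at h1
    have hcl : MeasurableSet {x : X | quotientDist dist (fun g : G => g • o) x ≤ c} :=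
      (isClosed_le (continuous_quotientDist _) continuous_const).measurableSet
    -- The radial projection is a choice function. It is almost everywhere measurable because
    -- otherwise its push-forward would be the default value `0`, and not the probability measure `m
    -- t`.
    have hae : AEMeasurable (radialProj o t) (m r) := by
      by_contra hne
      have h2 := hm.proj t r ht0 htr
      rw [Measure.map_of_not_aemeasurable hne] at h2
      have := hm.prob t ht0
      exact IsProbabilityMeasure.ne_zero (m t) h2.symm
    rw [Measure.map_apply_of_aemeasurable hae hcl] at h1
    rw [Measure.map_apply (continuous_toHoro o).measurable (hKcl t).measurableSet]
    refine h1.trans ?_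
    have hsp := hm.proj t r ht0 htr
    -- points off the sphere of radius `r` do not count
    have hr0 := hm.sphere r (ht0.trans htr)
    have hst : (m r) ((radialProj o t) ⁻¹' (Metric.sphere o t)ᶜ) = 0 := by
      rw [← Measure.map_apply_of_aemeasurable hae Metric.isClosed_sphere.measurableSet.compl, hsp]
      exact hm.sphere t ht0
    refine measure_mono_ae ?_
    have ha1 : ∀ᵐ x ∂(m r), dist x o = r := hr0
    have ha2 : ∀ᵐ x ∂(m r), dist (radialProj o t x) o = t := hst
    filter_upwards [ha1, ha2] with x hx1 hx2 hx
    change toHoro o x ∈ K t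
    -- In the default branch the projection is `x` itself, which lies at distance `r > t` from `o`;
    -- this contradicts `hx2`.
    have hy : dist (radialProj o t x) x = r - t := by
      unfold radialProj at hx2 ⊢
      split_ifs at hx2 ⊢ with h
      · rw [h.choose_spec.2, dist_comm, hx1]
      · linarith
    obtain ⟨g, hg⟩ := exists_lt_of_ciInf_lt (lt_of_le_of_lt hx (lt_add_one c))
    simp only [K, mem_iUnion, mem_ofPred_eq, exists_prop]
    refine ⟨g, ?_, ?_⟩
    · have h3 := dist_triangle o (radialProj o t x) (g • o)
      rw [dist_comm o (radialProj o t x)] at h3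
      change dist (radialProj o t x) (g • o) < c + 1 at hg
      linarith
    · change dist x (g • o) - dist x o ≤ c + 1 - t
      have h3 := dist_triangle x (radialProj o t x) (g • o)
      rw [dist_comm x (radialProj o t x)] at h3
      change dist (radialProj o t x) (g • o) < c + 1 at hg
      linarith
  -- Weak limits do not lose mass on closed sets, and the limit measure is at most `C` times `μ o`.
  have hμK : ∀ t, R₀ ≤ t → ENNReal.ofReal α / C ≤ μ o (K t) := by
    intro t ht
    have h1 : ENNReal.ofReal α ≤ (P' : Measure _) (K t) := by
      refine le_trans ?_ (ProbabilityMeasure.limsup_measure_closed_le_of_tendsto hP (hKcl t))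
      refine le_limsup_of_frequently_le ?_ (by isBoundedDefault)
      refine Eventually.frequently ?_
      filter_upwards [hφ'.eventually_gt_atTop t] with k hk
      exact hmass t _ ht hk
    rw [ENNReal.div_le_iff_le_mul (Or.inl hC0) (Or.inl ENNReal.coe_ne_top), mul_comm]
    refine h1.trans ((hle _).trans ?_)
    rw [Measure.smul_apply, ENNReal.smul_def, smul_eq_mul]
  -- With `n = t + c + 1`, the bound `e^{v(t-c-1)}` for the density on `K t` is `e^{vn}` times
  -- `e^{-2v(c+1)}`.
  refine nonVanishingECG_of_le
    (ENNReal.ofReal (Real.exp (-(v * (2 * (c + 1))))) * (ENNReal.ofReal α / C)) ?_ ?_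
  · refine ENNReal.mul_pos (ENNReal.ofReal_pos.mpr (Real.exp_pos _)).ne' ?_
    exact (ENNReal.div_pos (ENNReal.ofReal_pos.mpr hα).ne' ENNReal.coe_ne_top).ne'
  filter_upwards [eventually_ge_atTop ⌈R₀ + c + 1⌉₊] with n hn
  have hn' : R₀ + c + 1 ≤ n := (Nat.le_ceil _).trans (by exact_mod_cast hn)
  set t : ℝ := n - c - 1 with ht
  have h2 := hμK t (by linarith)
  calc ENNReal.ofReal (Real.exp (-(v * (2 * (c + 1))))) * (ENNReal.ofReal α / C) *
        ENNReal.ofReal (Real.exp (v * n))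
      = ENNReal.ofReal (Real.exp (v * (t - c - 1))) * (ENNReal.ofReal α / C) := by
        rw [mul_right_comm, ← ENNReal.ofReal_mul (Real.exp_pos _).le, ← Real.exp_add]
        congr 4
        rw [ht]; ring
    _ ≤ ENNReal.ofReal (Real.exp (v * (t - c - 1))) * μ o (K t) := by gcongr
    _ = ∫⁻ ξ in K t, ENNReal.ofReal (Real.exp (v * (t - c - 1))) ∂(μ o) := by simp
    _ ≤ ∫⁻ ξ in K t, extremalValue dist (fun g : G => g • o) μ o n ξ ∂(μ o) := by
        refine lintegral_mono_ae ?_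
        -- Only finitely many orbit points are involved, so one null set serves for all of them.
        have hae : ∀ᵐ ξ ∂(μ o), ∀ g ∈ {g : G | dist o (g • o) ≤ t + c + 1},
            (μ (g • o)).rnDeriv (μ o) ξ =
              ENNReal.ofReal (Real.exp (v * busemann ξ o (g • o))) :=
          (ae_ball_iff (hfin _).countable).mpr fun g _ => hμ.rnDeriv_eq (g • o)
        filter_upwards [ae_restrict_of_ae hae, ae_restrict_mem (hKcl t).measurableSet] with ξ h3 hξ
        simp only [K, mem_iUnion, mem_ofPred_eq, exists_prop] at hξ
        obtain ⟨g, hg1, hg2⟩ := hξ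
        refine le_trans ?_ (le_iSup₂_of_le g (show dist o (g • o) ≤ n by linarith) le_rfl)
        rw [h3 g hg1]
        refine ENNReal.ofReal_le_ofReal (Real.exp_le_exp.mpr
          (mul_le_mul_of_nonneg_left ?_ hv))
        rw [busemann, HoroCompactification.apply_base]
        linarith
    _ ≤ _ := setLIntegral_le_lintegral _ _

/-! ## Homogeneous measures on a space of functions -/

section Homogeneous

variable {I : Type*}

/-- The measure `t^{d-1} dt` of the part of `H` on the ray through `ξ`, with `t = e^u`. -/
def radialMass (d : ℝ) (H : Set (I → ℝ)) (ξ : I → ℝ) : ℝ≥0∞ :=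
  ∫⁻ u : ℝ, H.indicator 1 (Real.exp u • ξ) * ENNReal.ofReal (Real.exp (d * u))

/-- Measures which are homogeneous of degree `d` (on all sets). -/
def IsHomogeneousMeasure (d : ℝ) (ν : Measure (I → ℝ)) : Prop :=
  ∀ (u : ℝ) (A : Set (I → ℝ)),
    ν ((fun ξ => Real.exp u • ξ) ⁻¹' A) = ENNReal.ofReal (Real.exp (-(d * u))) * ν A

theorem measurable_exp_smul : Measurable fun p : ℝ × (I → ℝ) => Real.exp p.1 • p.2 := by
  refine measurable_pi_lambda _ fun i => ?_
  simp only [Pi.smul_apply, smul_eq_mul]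
  fun_prop

theorem measurable_exp_smul_left (u : ℝ) : Measurable fun ξ : I → ℝ => Real.exp u • ξ :=
  measurable_exp_smul.comp (measurable_const.prodMk measurable_id)

theorem measurable_radialIntegrand (d : ℝ) {H : Set (I → ℝ)} (hH : MeasurableSet H) :
    Measurable fun p : (I → ℝ) × ℝ =>
      H.indicator (1 : (I → ℝ) → ℝ≥0∞) (Real.exp p.2 • p.1) *
        ENNReal.ofReal (Real.exp (d * p.2)) := by
  refine Measurable.mul ?_ (by fun_prop)
  exact (measurable_one.indicator hH).comp (measurable_exp_smul.comp measurable_swap)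

theorem measurable_radialMass (d : ℝ) {H : Set (I → ℝ)} (hH : MeasurableSet H) :
    Measurable (radialMass d H) :=
  (measurable_radialIntegrand d hH).lintegral_prod_right'

/-- A dilation of `ξ` translates the logarithmic parameter. Consequently the quotient of two radial
masses is constant on rays, that is, a function of the projective class. -/
theorem radialMass_exp_smul (d : ℝ) (H : Set (I → ℝ)) (s : ℝ) (ξ : I → ℝ) :
    radialMass d H (Real.exp s • ξ) = ENNReal.ofReal (Real.exp (-(d * s))) * radialMass d H ξ := by
  unfold radialMass
  rw [← lintegral_add_right_eq_self
    (fun u : ℝ => H.indicator 1 (Real.exp u • ξ) * ENNReal.ofReal (Real.exp (d * u))) s,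
    ← lintegral_const_mul' _ _ ENNReal.ofReal_ne_top]
  refine lintegral_congr fun u => ?_
  rw [smul_smul, ← Real.exp_add, mul_left_comm, ← ENNReal.ofReal_mul (Real.exp_pos _).le,
    ← Real.exp_add]
  congr 3
  ring

/-- A ray that lies in `H` up to the parameter `e^s` contributes at least `e^{d(s-1)}`. -/
theorem le_radialMass {d : ℝ} (hd : 0 ≤ d) {H : Set (I → ℝ)} {ξ : I → ℝ} {s : ℝ}
    (h : ∀ u ≤ s, Real.exp u • ξ ∈ H) :
    ENNReal.ofReal (Real.exp (d * (s - 1))) ≤ radialMass d H ξ := by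
  -- The last unit of the parameter suffices and avoids dividing by `d`.
  calc ENNReal.ofReal (Real.exp (d * (s - 1)))
      = ∫⁻ _ in Icc (s - 1) s, ENNReal.ofReal (Real.exp (d * (s - 1))) := by simp
    _ ≤ ∫⁻ u in Icc (s - 1) s,
          H.indicator 1 (Real.exp u • ξ) * ENNReal.ofReal (Real.exp (d * u)) := by
        refine setLIntegral_mono' measurableSet_Icc fun u hu => ?_
        rw [indicator_of_mem (h u hu.2), Pi.one_apply, one_mul]
        exact ENNReal.ofReal_le_ofReal
          (Real.exp_le_exp.mpr (mul_le_mul_of_nonneg_left hu.1 hd))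
    _ ≤ _ := setLIntegral_le_lintegral _ _

theorem IsHomogeneousMeasure.lintegral_exp_smul {d : ℝ} {ν : Measure (I → ℝ)}
    (h : IsHomogeneousMeasure d ν) {f : (I → ℝ) → ℝ≥0∞} (hf : Measurable f) (u : ℝ) :
    ∫⁻ ξ, f (Real.exp u • ξ) ∂ν = ENNReal.ofReal (Real.exp (-(d * u))) * ∫⁻ ξ, f ξ ∂ν := by
  have h1 : ν.map (fun ξ => Real.exp u • ξ) = ENNReal.ofReal (Real.exp (-(d * u))) • ν := by
    ext E hE
    rw [Measure.map_apply (measurable_exp_smul_left u) hE, h u E]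
    rfl
  rw [← lintegral_map hf (measurable_exp_smul_left u), h1, lintegral_smul_measure, smul_eq_mul]

/-- Integration in polar coordinates, without choosing a section of the rays. -/
theorem IsHomogeneousMeasure.lintegral_mul_radialMass {d : ℝ} {ν : Measure (I → ℝ)} [SFinite ν]
    (h : IsHomogeneousMeasure d ν) {φ : (I → ℝ) → ℝ≥0∞} (hφ : Measurable φ) {H : Set (I → ℝ)}
    (hH : MeasurableSet H) :
    ∫⁻ ξ, φ ξ * radialMass d H ξ ∂ν = ∫⁻ ξ in H, (∫⁻ u : ℝ, φ (Real.exp u • ξ)) ∂ν := by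
  have hind : Measurable (H.indicator (1 : (I → ℝ) → ℝ≥0∞)) := measurable_one.indicator hH
  calc ∫⁻ ξ, φ ξ * radialMass d H ξ ∂ν
      = ∫⁻ ξ, (∫⁻ u : ℝ, φ ξ * (H.indicator 1 (Real.exp u • ξ) *
          ENNReal.ofReal (Real.exp (d * u)))) ∂ν := by
        refine lintegral_congr fun ξ => ?_
        rw [radialMass, lintegral_const_mul]
        exact (measurable_radialIntegrand d hH).comp measurable_prodMk_left
    _ = ∫⁻ u : ℝ, ∫⁻ ξ, φ ξ * (H.indicator 1 (Real.exp u • ξ) *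
          ENNReal.ofReal (Real.exp (d * u))) ∂ν := by
        refine lintegral_lintegral_swap (Measurable.aemeasurable ?_)
        exact (hφ.comp measurable_fst).mul (measurable_radialIntegrand d hH)
    -- The substitution `ξ ↦ e^{-u} ξ` produces by homogeneity exactly the factor that cancels the
    -- weight `e^{du}`.
    _ = ∫⁻ u : ℝ, ∫⁻ ξ, φ (Real.exp (-u) • ξ) * H.indicator 1 ξ ∂ν := by
        refine lintegral_congr fun u => ?_
        have hm : Measurable fun η : I → ℝ => φ (Real.exp (-u) • η) * H.indicator 1 η :=
          (hφ.comp (measurable_exp_smul_left (-u))).mul hind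
        have h2 := h.lintegral_exp_smul hm u
        rw [← ENNReal.mul_right_inj (a := ENNReal.ofReal (Real.exp (-(d * u))))
          (by simpa using Real.exp_pos _) ENNReal.ofReal_ne_top, ← h2,
          ← lintegral_const_mul' _ _ ENNReal.ofReal_ne_top]
        refine lintegral_congr fun ξ => ?_
        rw [smul_smul, ← Real.exp_add, neg_add_cancel, Real.exp_zero, one_smul,
          mul_left_comm, mul_left_comm (ENNReal.ofReal _), ← ENNReal.ofReal_mul (Real.exp_pos _).le,
          ← Real.exp_add]
        simp
    _ = ∫⁻ u : ℝ, ∫⁻ ξ, φ (Real.exp u • ξ) * H.indicator 1 ξ ∂ν := by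
        exact lintegral_neg_eq_self
          (fun u : ℝ => ∫⁻ ξ, φ (Real.exp u • ξ) * H.indicator 1 ξ ∂ν)
    _ = ∫⁻ ξ, (∫⁻ u : ℝ, φ (Real.exp u • ξ) * H.indicator 1 ξ) ∂ν := by
        refine lintegral_lintegral_swap (Measurable.aemeasurable ?_)
        exact (hφ.comp measurable_exp_smul).mul (hind.comp measurable_snd)
    _ = ∫⁻ ξ in H, (∫⁻ u : ℝ, φ (Real.exp u • ξ)) ∂ν := by
        rw [← lintegral_indicator hH]
        refine lintegral_congr fun ξ => ?_
        by_cases hξ : ξ ∈ H <;> simp [hξ]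

/-- In the polar formula take for `φ` the inverse of `radialMass d B` on `B`. Its integral along a
ray is the radial mass of `B` times its own inverse, which is `1`, or `0` when the radial mass is
`0` or `∞`. -/
theorem IsHomogeneousMeasure.lintegral_radialMass_div_le {d : ℝ} {ν : Measure (I → ℝ)} [SFinite ν]
    (h : IsHomogeneousMeasure d ν) {B H : Set (I → ℝ)} (hB : MeasurableSet B)
    (hH : MeasurableSet H) :
    ∫⁻ ξ in B, radialMass d H ξ / radialMass d B ξ ∂ν ≤ ν H := by
  have hmB := measurable_radialMass d hB
  have hφ : Measurable (B.indicator fun ξ => (radialMass d B ξ)⁻¹) := hmB.inv.indicator hB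
  have h1 := h.lintegral_mul_radialMass hφ hH
  rw [← lintegral_indicator hB]
  calc ∫⁻ ξ, B.indicator (fun ξ => radialMass d H ξ / radialMass d B ξ) ξ ∂ν
      = ∫⁻ ξ, B.indicator (fun ξ => (radialMass d B ξ)⁻¹) ξ * radialMass d H ξ ∂ν := by
        refine lintegral_congr fun ξ => ?_
        by_cases hξ : ξ ∈ B <;> simp [hξ, div_eq_mul_inv, mul_comm]
    _ ≤ ∫⁻ _ in H, 1 ∂ν := by
        rw [h1]
        refine lintegral_mono fun ξ => ?_
        calc ∫⁻ u : ℝ, B.indicator (fun ξ => (radialMass d B ξ)⁻¹) (Real.exp u • ξ)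
            = ∫⁻ u : ℝ, (B.indicator 1 (Real.exp u • ξ) * ENNReal.ofReal (Real.exp (d * u))) *
                (radialMass d B ξ)⁻¹ := by
              refine lintegral_congr fun u => ?_
              by_cases hξ : Real.exp u • ξ ∈ B
              · rw [indicator_of_mem hξ, indicator_of_mem hξ, radialMass_exp_smul,
                  ENNReal.mul_inv (Or.inl (by simpa using Real.exp_pos _))
                    (Or.inl ENNReal.ofReal_ne_top),
                  ← ENNReal.ofReal_inv_of_pos (Real.exp_pos _), ← Real.exp_neg, neg_neg]
                simp
              · simp [hξ]
          _ = radialMass d B ξ * (radialMass d B ξ)⁻¹ := by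
              rw [radialMass, lintegral_mul_const]
              exact (measurable_radialIntegrand d hB).comp measurable_prodMk_left
          _ ≤ 1 := ENNReal.mul_inv_le_one _
    _ = ν H := by simp

/-- The origin is fixed by dilations, which multiply masses by factors different from `1`. -/
theorem IsHomogeneousMeasure.singleton_zero {d : ℝ} (hd : 0 < d) {ν : Measure (I → ℝ)}
    (h : IsHomogeneousMeasure d ν) (hfin : ν {0} < ⊤) : ν {0} = 0 := by
  have h1 := h 1 {0}
  have h2 : (fun ξ : I → ℝ => Real.exp 1 • ξ) ⁻¹' {0} = {0} := by
    ext ξ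
    simp [(Real.exp_pos 1).ne']
  rw [h2] at h1
  by_contra h0
  have h3 : ENNReal.ofReal (Real.exp (-(d * 1))) < 1 := by
    rw [← ENNReal.ofReal_one, ENNReal.ofReal_lt_ofReal_iff one_pos]
    exact Real.exp_lt_one_iff.mpr (by linarith)
  have h4 := ENNReal.mul_lt_mul_left h0 hfin.ne h3
  rw [one_mul, ← h1] at h4
  exact lt_irrefl _ h4

/-- The radial mass of a set of finite measure is finite almost everywhere. -/
theorem IsHomogeneousMeasure.radialMass_lt_top [Countable I] {d : ℝ} (hd : 0 < d)
    {ν : Measure (I → ℝ)} [SFinite ν] (h : IsHomogeneousMeasure d ν) {B : Set (I → ℝ)}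
    (hB : MeasurableSet B) (hfin : ν B < ⊤) : ∀ᵐ ξ ∂ν, radialMass d B ξ < ⊤ := by
  have hm := measurable_radialMass d hB
  -- the shell where the coordinate `i` is of size about `1`
  let S : I → Set (I → ℝ) := fun i => {ξ | |ξ i| ∈ Ioc 1 (Real.exp 1)}
  have hS : ∀ i, MeasurableSet (S i) := fun i =>
    measurableSet_Ioc.preimage ((measurable_pi_apply i).abs)
  have hshell : ∀ i : I, ∀ᵐ ξ ∂ν, ξ ∈ S i → radialMass d B ξ < ⊤ := by
    intro i
    have h2 : ∫⁻ ξ in S i, radialMass d B ξ ∂ν ≤ ν B := by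
      have h1 := h.lintegral_mul_radialMass (measurable_one.indicator (hS i)) hB
      calc ∫⁻ ξ in S i, radialMass d B ξ ∂ν
          = ∫⁻ ξ, (S i).indicator 1 ξ * radialMass d B ξ ∂ν := by
            rw [← lintegral_indicator (hS i)]
            refine lintegral_congr fun ξ => ?_
            by_cases hξ : ξ ∈ S i <;> simp [hξ]
        _ = ∫⁻ ξ in B, (∫⁻ u : ℝ, (S i).indicator 1 (Real.exp u • ξ)) ∂ν := h1
        _ ≤ ∫⁻ _ in B, 1 ∂ν := by
            refine lintegral_mono fun ξ => ?_
            calc ∫⁻ u : ℝ, (S i).indicator 1 (Real.exp u • ξ)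
                ≤ ∫⁻ u : ℝ, (Ioc (-Real.log |ξ i|) (-Real.log |ξ i| + 1)).indicator 1 u := by
                  refine lintegral_mono fun u => ?_
                  by_cases hu : Real.exp u • ξ ∈ S i
                  · have h3 : |Real.exp u * ξ i| ∈ Ioc 1 (Real.exp 1) := hu
                    have h0 : ξ i ≠ 0 := by
                      rintro h0
                      rw [h0] at h3
                      simp at h3
                      linarith [h3.1]
                    rw [abs_mul, abs_of_pos (Real.exp_pos u)] at h3
                    have h5 := Real.log_lt_log one_pos h3.1
                    have h6 := Real.log_le_log (by linarith [h3.1]) h3.2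
                    rw [Real.log_mul (Real.exp_pos u).ne' (abs_pos.mpr h0).ne', Real.log_exp]
                      at h5 h6
                    rw [Real.log_one] at h5
                    rw [Real.log_exp] at h6
                    rw [indicator_of_mem hu, indicator_of_mem]
                    · simp
                    · exact ⟨by linarith, by linarith⟩
                  · simp [hu]
              _ = 1 := by
                  rw [lintegral_indicator_one measurableSet_Ioc]
                  simp
        _ = ν B := by simp
    rw [← ae_restrict_iff' (hS i)]
    exact ae_lt_top hm (h2.trans_lt hfin).ne
  -- Dilations preserve null sets and the finiteness of the radial mass. Countably many dilated
  -- shells cover everything except the origin, which `hzero` treats.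
  have hscale : ∀ᵐ ξ ∂ν, ∀ (i : I) (k : ℤ), Real.exp (k : ℝ) • ξ ∈ S i →
      radialMass d B ξ < ⊤ := by
    rw [ae_all_iff]
    intro i
    rw [ae_all_iff]
    intro k
    have h1 := h k {ξ | ¬(ξ ∈ S i → radialMass d B ξ < ⊤)}
    rw [show ν {ξ | ¬(ξ ∈ S i → radialMass d B ξ < ⊤)} = 0 from hshell i, mul_zero] at h1
    have h2 : ∀ᵐ ξ ∂ν, Real.exp (k : ℝ) • ξ ∈ S i →
      radialMass d B (Real.exp (k : ℝ) • ξ) < ⊤ := h1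
    filter_upwards [h2] with ξ hξ hm
    have h3 := hξ hm
    rw [radialMass_exp_smul] at h3
    by_contra h4
    rw [not_lt, top_le_iff] at h4
    rw [h4, ENNReal.mul_top (ENNReal.ofReal_pos.mpr (Real.exp_pos _)).ne'] at h3
    exact lt_irrefl _ h3
  have hzero : ∀ᵐ ξ ∂ν, ξ = 0 → radialMass d B ξ < ⊤ := by
    by_cases h0 : (0 : I → ℝ) ∈ B
    · have h1 := h.singleton_zero hd
        (lt_of_le_of_lt (measure_mono (singleton_subset_iff.mpr h0)) hfin)
      have h2 : ∀ᵐ ξ ∂ν, ξ ∉ ({0} : Set (I → ℝ)) := measure_eq_zero_iff_ae_notMem.mp h1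
      filter_upwards [h2] with ξ hξ h3
      exact absurd h3 hξ
    · refine Eventually.of_forall fun ξ hξ => ?_
      simp [hξ, radialMass, h0]
  filter_upwards [hscale, hzero] with ξ h1 h2
  by_cases h0 : ξ = 0
  · exact h2 h0
  obtain ⟨i, hi⟩ := Function.ne_iff.mp h0
  have hi' : 0 < |ξ i| := abs_pos.mpr hi
  -- This integer `k` is the one with `0 < k + log |ξ i| ≤ 1`.
  refine h1 i (⌊-Real.log |ξ i|⌋ + 1) ?_
  change |Real.exp _ * ξ i| ∈ Ioc 1 (Real.exp 1)
  rw [abs_mul, abs_of_pos (Real.exp_pos _), ← Real.exp_log hi', ← Real.exp_add, Real.exp_log hi']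
  have h3 := Int.floor_le (-Real.log |ξ i|)
  have h4 := Int.lt_floor_add_one (-Real.log |ξ i|)
  push_cast
  exact ⟨Real.one_lt_exp_iff.mpr (by linarith), Real.exp_le_exp.mpr (by linarith)⟩

/-- A star-shaped set of finite measure has a measurable hull for which integration in polar
coordinates is available. -/
theorem IsHomogeneousMeasure.exists_radial_hull [Countable I] {d : ℝ} (hd : 0 < d)
    {ν : Measure (I → ℝ)} (h : IsHomogeneousMeasure d ν) {A : Set (I → ℝ)} (hfin : ν A < ⊤)
    (hstar : ∀ ξ ∈ A, ∀ u ≤ 0, Real.exp u • ξ ∈ A) :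
    ∃ B, MeasurableSet B ∧ A ⊆ B ∧ (∀ᵐ ξ ∂(ν.restrict A), radialMass d B ξ < ⊤) ∧
      ∀ H, MeasurableSet H → ∫⁻ ξ in A, radialMass d H ξ / radialMass d B ξ ∂ν ≤ ν H := by
  let B := toMeasurable ν A
  have hB : MeasurableSet B := measurableSet_toMeasurable ν A
  have hAB : A ⊆ B := subset_toMeasurable ν A
  have hνB : ν B = ν A := measure_toMeasurable A
  -- the union of the rational multiples of `B`
  let X : Set (I → ℝ) := ⋃ k : ℚ, (fun ξ => Real.exp (k : ℝ) • ξ) ⁻¹' B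
  have hX : MeasurableSet X :=
    MeasurableSet.iUnion fun k => measurable_exp_smul_left _ hB
  -- The set `A` is star-shaped: for a rational `k < -u`, the total dilation `e^{k+u}` is a
  -- contraction and keeps points of `A` inside `A`.
  have hAX : ∀ (u : ℝ), A ⊆ (fun ξ => Real.exp u • ξ) ⁻¹' X := by
    intro u ξ hξ
    obtain ⟨k, hk⟩ := exists_rat_lt (-u)
    refine mem_iUnion.mpr ⟨k, ?_⟩
    change Real.exp (k : ℝ) • Real.exp u • ξ ∈ B
    rw [smul_smul, ← Real.exp_add]
    exact hAB (hstar ξ hξ _ (by linarith))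
  -- The dilate of `X` contains `A` and is measurable, and `B` has the same finite measure as `A`;
  -- so it contains almost all of `B`.
  have hBX : ∀ u : ℝ, ν (B \ (fun ξ => Real.exp u • ξ) ⁻¹' X) = 0 := by
    intro u
    have h1 : ν (B ∩ (fun ξ => Real.exp u • ξ) ⁻¹' X) = ν B := by
      refine le_antisymm (measure_mono inter_subset_left) ?_
      rw [hνB]
      exact measure_mono (subset_inter hAB (hAX u))
    have h2 := measure_inter_add_sdiff (μ := ν) B (measurable_exp_smul_left u hX)
    rw [h1] at h2
    have h3 : ν B ≠ ⊤ := by rw [hνB]; exact hfin.ne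
    exact (ENNReal.add_right_inj h3).mp (h2.trans (add_zero _).symm)
  have hnull : ∀ (u : ℝ) {N : Set (I → ℝ)}, ν N = 0 →
      ν ((fun ξ => Real.exp u • ξ) ⁻¹' N) = 0 := fun u N hN => by rw [h u N, hN, mul_zero]
  have hXX : ∀ u : ℝ, ν (X \ (fun ξ => Real.exp u • ξ) ⁻¹' X) = 0 := by
    intro u
    rw [show X \ (fun ξ => Real.exp u • ξ) ⁻¹' X = ⋃ k : ℚ,
      (fun ξ => Real.exp (k : ℝ) • ξ) ⁻¹' B \ (fun ξ => Real.exp u • ξ) ⁻¹' X from iUnion_sdiff _ _,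
      measure_iUnion_null_iff]
    intro k
    have h1 := hnull k (hBX (u - k))
    convert h1 using 2
    ext ξ
    simp only [Set.mem_sdiff, mem_preimage, smul_smul, ← Real.exp_add, sub_add_cancel]
  have hXX' : ∀ u : ℝ, ν ((fun ξ => Real.exp u • ξ) ⁻¹' X \ X) = 0 := by
    intro u
    have h1 := hnull u (hXX (-u))
    convert h1 using 2
    ext ξ
    simp only [Set.mem_sdiff, mem_preimage, smul_smul, ← Real.exp_add, neg_add_cancel, Real.exp_zero,
      one_smul]
  have hXae : ∀ u : ℝ, ((fun ξ => Real.exp u • ξ) ⁻¹' X : Set (I → ℝ)) =ᵐ[ν] X := fun u =>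
    ae_eq_set.mpr ⟨hXX' u, hXX u⟩
  -- Nothing says that `ν` is σ-finite. Its restriction to `X` is, being carried by countably many
  -- dilates of `B`, and it remains homogeneous because `X` is invariant up to null sets.
  let ν' := ν.restrict X
  have hhom : IsHomogeneousMeasure d ν' := by
    intro u E
    rw [Measure.restrict_apply' hX, Measure.restrict_apply' hX, ← h u]
    refine measure_congr ?_
    rw [preimage_inter]
    exact (ae_eq_refl _).inter (hXae u).symm
  have hσ : SigmaFinite ν' := by
    obtain ⟨e, he⟩ := exists_surjective_nat ℚ
    refine ⟨⟨⟨fun n => (fun ξ => Real.exp (e n : ℝ) • ξ) ⁻¹' B ∪ Xᶜ, fun _ => trivial,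
      fun n => ?_, ?_⟩⟩⟩
    · rw [Measure.restrict_apply' hX, union_inter_distrib_right, compl_inter_self, union_empty]
      refine lt_of_le_of_lt (measure_mono inter_subset_left) ?_
      rw [h, hνB]
      exact ENNReal.mul_lt_top ENNReal.ofReal_lt_top hfin
    · refine eq_univ_of_forall fun ξ => ?_
      by_cases hξ : ξ ∈ X
      · obtain ⟨k, hk⟩ := mem_iUnion.mp hξ
        obtain ⟨n, rfl⟩ := he k
        exact mem_iUnion.mpr ⟨n, Or.inl hk⟩
      · exact mem_iUnion.mpr ⟨0, Or.inr hξ⟩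
  have hle : ν.restrict A ≤ ν'.restrict B := by
    have h1 : A ⊆ B ∩ X := subset_inter hAB (by simpa using hAX 0)
    rw [Measure.restrict_restrict hB]
    exact Measure.restrict_mono h1 le_rfl
  refine ⟨B, hB, hAB, ?_, fun H hH => ?_⟩
  · have h1 := hhom.radialMass_lt_top hd hB
      ((Measure.restrict_apply_le X B).trans_lt (by rw [hνB]; exact hfin))
    exact (Measure.absolutelyContinuous_of_le (hle.trans Measure.restrict_le_self)).ae_le h1
  · calc ∫⁻ ξ in A, radialMass d H ξ / radialMass d B ξ ∂ν
        ≤ ∫⁻ ξ in B, radialMass d H ξ / radialMass d B ξ ∂ν' := lintegral_mono' hle le_rfl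
      _ ≤ ν' H := hhom.lintegral_radialMass_div_le hB hH
      _ ≤ ν H := Measure.restrict_apply_le X H

end Homogeneous

/-! ## Homeomorphisms of the upper half plane -/

theorem IsLocFinite.union {E F : Set ℍ} (hE : IsLocFinite E) (hF : IsLocFinite F) :
    IsLocFinite (E ∪ F) := fun K hK => by
  rw [union_inter_distrib_right]
  exact (hE K hK).union (hF K hK)

theorem IsLocFinite.preimage {E : Set ℍ} (hE : IsLocFinite E) (h : ℍ ≃ₜ ℍ) :
    IsLocFinite (h ⁻¹' E) := fun K hK => by
  refine Set.Finite.of_finite_image ((hE (h '' K) (hK.image h.continuous)).subset ?_)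
    h.injective.injOn
  rintro _ ⟨z, ⟨hz1, hz2⟩, rfl⟩
  exact ⟨hz1, mem_image_of_mem h hz2⟩

theorem isLocFinite_empty : IsLocFinite ∅ := fun _ _ => by simp

theorem isLocFinite_singleton (z : ℍ) : IsLocFinite {z} := fun _ _ =>
  (finite_singleton z).subset inter_subset_left

theorem IsLocFinite.countable {E : Set ℍ} (hE : IsLocFinite E) : E.Countable := by
  have h1 : E = ⋃ n : ℕ, E ∩ compactCovering ℍ n := by
    rw [← inter_iUnion, iUnion_compactCovering, inter_univ]
  rw [h1]
  exact countable_iUnion fun n => (hE _ (isCompact_compactCovering ℍ n)).countable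

/-- Near any point, a locally finite set contains at most that point. -/
theorem IsLocFinite.eventually_notMem {E : Set ℍ} (hE : IsLocFinite E) (p : ℍ) :
    ∀ᶠ z in 𝓝 p, z ≠ p → z ∉ E := by
  obtain ⟨K, hK, hKp⟩ := exists_compact_mem_nhds p
  have h1 : ((E ∩ K) \ {p})ᶜ ∈ 𝓝 p :=
    ((hE K hK).subset sdiff_subset).isClosed.isOpen_compl.mem_nhds (by simp)
  filter_upwards [hKp, h1] with z hz1 hz2 hzp hzE
  exact hz2 ⟨⟨hzE, hz1⟩, hzp⟩

theorem IsLocFinite.isClosed {E : Set ℍ} (hE : IsLocFinite E) : IsClosed E := by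
  rw [← isOpen_compl_iff, isOpen_iff_mem_nhds]
  intro p hp
  filter_upwards [hE.eventually_notMem p] with z hz
  by_cases h : z = p
  · rwa [h]
  · exact hz h

/-- A self map of `ℍ` in the complex coordinate. -/
def inCoord (h : ℍ → ℍ) (w : ℂ) : ℂ := (h (ofComplex w) : ℂ)

@[simp]
theorem inCoord_coe (h : ℍ → ℍ) (z : ℍ) : inCoord h (z : ℂ) = (h z : ℂ) := by
  simp [inCoord]

theorem upperHalf_mem_nhds (z : ℍ) : {w : ℂ | 0 < w.im} ∈ 𝓝 (z : ℂ) :=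
  (isOpen_lt continuous_const Complex.continuous_im).mem_nhds z.im_pos

theorem inCoord_comp (g h : ℍ → ℍ) : inCoord g ∘ inCoord h = inCoord (g ∘ h) := by
  funext w
  simp [inCoord]

theorem inCoord_id_eventuallyEq (z : ℍ) : inCoord (fun z => z) =ᶠ[𝓝 (z : ℂ)] fun w => w := by
  filter_upwards [upperHalf_mem_nhds z] with w hw
  simp [inCoord, ofComplex_apply_of_im_pos hw]

/-- The differential of a self map of `ℍ`. -/
def hDeriv (h : ℍ → ℍ) (z : ℍ) : ℂ →L[ℝ] ℂ := fderiv ℝ (inCoord h) (z : ℂ)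

theorem autFactor_eq_denom (γ : SL(2, ℝ)) (z : ℍ) :
    autFactor γ z = denom (γ : GL (Fin 2) ℝ) z := by
  simp [autFactor, denom]

theorem autFactor_ne_zero (γ : SL(2, ℝ)) (z : ℍ) : autFactor γ z ≠ 0 := by
  rw [autFactor_eq_denom]
  exact denom_ne_zero _ z

theorem hasDerivAt_smul (γ : SL(2, ℝ)) (z : ℍ) :
    HasStrictDerivAt (inCoord (γ • ·)) ((autFactor γ z ^ 2)⁻¹) (z : ℂ) := by
  have h := UpperHalfPlane.hasStrictDerivAt_smul (g := (γ : GL (Fin 2) ℝ)) (by simp) z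
  rw [autFactor_eq_denom]
  simp only [Matrix.SpecialLinearGroup.det_coe, Matrix.SpecialLinearGroup.coe_GL_coe_matrix,
    Complex.ofReal_one, one_div] at h
  exact h

theorem im_smul_sl (γ : SL(2, ℝ)) (z : ℍ) : (γ • z).im = z.im / ‖autFactor γ z‖ ^ 2 := by
  have h := UpperHalfPlane.im_smul_eq_div_normSq (γ : GL (Fin 2) ℝ) z
  rw [autFactor_eq_denom, ← Complex.normSq_eq_norm_sq]
  simp only [Matrix.SpecialLinearGroup.det_coe, Matrix.SpecialLinearGroup.coe_GL_coe_matrix,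
    Matrix.GeneralLinearGroup.val_det_apply, abs_one, one_mul] at h
  exact h

theorem hDeriv_smul (γ : SL(2, ℝ)) (z : ℍ) (w : ℂ) :
    hDeriv (γ • ·) z w = (autFactor γ z ^ 2)⁻¹ * w := by
  have h := ((hasDerivAt_smul γ z).hasDerivAt.hasFDerivAt.restrictScalars ℝ).fderiv
  rw [hDeriv, h]
  simp [mul_comm]

theorem continuous_smul_sl (γ : SL(2, ℝ)) : Continuous (γ • · : ℍ → ℍ) :=
  continuous_const_smul (γ : GL (Fin 2) ℝ)

theorem differentiableAt_smul (γ : SL(2, ℝ)) (z : ℍ) :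
    DifferentiableAt ℝ (inCoord (γ • ·)) (z : ℂ) :=
  ((hasDerivAt_smul γ z).hasDerivAt.hasFDerivAt.restrictScalars ℝ).differentiableAt

theorem hDeriv_comp {g h : ℍ → ℍ} {z : ℍ} (hg : DifferentiableAt ℝ (inCoord g) (h z : ℂ))
    (hh : DifferentiableAt ℝ (inCoord h) (z : ℂ)) :
    hDeriv (g ∘ h) z = (hDeriv g (h z)).comp (hDeriv h z) := by
  unfold hDeriv
  rw [← inCoord_comp, fderiv_comp, inCoord_coe]
  · rwa [inCoord_coe]
  · exact hh

theorem differentiableAt_of_commute {h : ℍ → ℍ} {γ : SL(2, ℝ)}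
    (hγ : ∀ z, h (γ • z) = γ • h z) (z : ℍ)
    (hd : DifferentiableAt ℝ (inCoord h) ((γ • z : ℍ) : ℂ)) :
    DifferentiableAt ℝ (inCoord h) (z : ℂ) := by
  have h1 : h = (γ⁻¹ • · : ℍ → ℍ) ∘ h ∘ (γ • · : ℍ → ℍ) := by
    funext z
    simp [hγ]
  rw [h1, ← inCoord_comp, ← inCoord_comp]
  refine DifferentiableAt.comp _ ?_ (DifferentiableAt.comp _ ?_ (differentiableAt_smul γ z))
  · simp only [Function.comp_apply, inCoord_coe]
    exact differentiableAt_smul _ _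
  · simpa using hd

/-- The differential of an equivariant map transforms as it should, also where the map is
not differentiable. -/
theorem hDeriv_equivariant {h : ℍ → ℍ} {γ : SL(2, ℝ)} (hγ : ∀ z, h (γ • z) = γ • h z) (z : ℍ)
    (w : ℂ) :
    hDeriv h (γ • z) w = (autFactor γ (h z) ^ 2)⁻¹ * hDeriv h z (autFactor γ z ^ 2 * w) := by
  by_cases hd : DifferentiableAt ℝ (inCoord h) ((γ • z : ℍ) : ℂ)
  · have hd' := differentiableAt_of_commute hγ z hd
    have h1 : h ∘ (γ • · : ℍ → ℍ) = (γ • · : ℍ → ℍ) ∘ h := funext hγ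
    have h2 := hDeriv_comp (g := h) (h := (γ • · : ℍ → ℍ)) hd (differentiableAt_smul γ z)
    have h3 := hDeriv_comp (g := (γ • · : ℍ → ℍ)) (h := h) (differentiableAt_smul γ (h z)) hd'
    rw [h1, h3] at h2
    have h4 := DFunLike.congr_fun h2 (autFactor γ z ^ 2 * w)
    simp only [ContinuousLinearMap.comp_apply, hDeriv_smul] at h4
    rw [h4, inv_mul_cancel_left₀ (pow_ne_zero 2 (autFactor_ne_zero γ z))]
  -- If `h` is not differentiable at `γ • z`, then it is not differentiable at `z` either, and both
  -- differentials have the default value zero.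
  · have hγ' : ∀ z, h (γ⁻¹ • z) = γ⁻¹ • h z := fun z => by
      rw [eq_inv_smul_iff, ← hγ, smul_inv_smul]
    have hd' : ¬ DifferentiableAt ℝ (inCoord h) (z : ℂ) := by
      intro h1
      refine hd (differentiableAt_of_commute hγ' _ ?_)
      rwa [inv_smul_smul]
    rw [hDeriv, hDeriv, fderiv_zero_of_not_differentiableAt hd,
      fderiv_zero_of_not_differentiableAt hd']
    simp

/-- `h` is an orientation preserving local diffeomorphism at `z`. -/
def IsDiffeoAt (h : ℍ → ℍ) (z : ℍ) : Prop :=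
  ContDiffAt ℝ ∞ (inCoord h) (z : ℂ) ∧ 0 < (hDeriv h z).det

theorem IsDiffeoAt.differentiableAt {h : ℍ → ℍ} {z : ℍ} (hz : IsDiffeoAt h z) :
    DifferentiableAt ℝ (inCoord h) (z : ℂ) :=
  hz.1.differentiableAt (by simp)

theorem IsDiffeoAt.comp {g h : ℍ → ℍ} {z : ℍ} (hg : IsDiffeoAt g (h z)) (hh : IsDiffeoAt h z) :
    IsDiffeoAt (g ∘ h) z := by
  refine ⟨?_, ?_⟩
  · rw [← inCoord_comp]
    refine ContDiffAt.comp _ ?_ hh.1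
    rw [inCoord_coe]
    exact hg.1
  · rw [hDeriv_comp hg.differentiableAt hh.differentiableAt]
    have : ((hDeriv g (h z)).comp (hDeriv h z)).det = (hDeriv g (h z)).det * (hDeriv h z).det := by
      simp [ContinuousLinearMap.det]
    rw [this]
    exact mul_pos hg.2 hh.2

theorem isDiffeoAt_id (z : ℍ) : IsDiffeoAt (fun z => z) z := by
  refine ⟨contDiffAt_id.congr_of_eventuallyEq (inCoord_id_eventuallyEq z), ?_⟩
  rw [hDeriv, (inCoord_id_eventuallyEq z).fderiv_eq, fderiv_fun_id]
  simp [ContinuousLinearMap.det]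

theorem IsDiffeoAt.injective {h : ℍ → ℍ} {z : ℍ} (hz : IsDiffeoAt h z) :
    Function.Injective (hDeriv h z) :=
  ((hDeriv h z).toContinuousLinearEquivOfDetNeZero hz.2.ne').injective

/-- A homeomorphism of `ℍ` as a partial homeomorphism of `ℂ`. -/
def coordHomeo (h : ℍ ≃ₜ ℍ) : OpenPartialHomeomorph ℂ ℂ :=
  ofComplex.trans (h.toOpenPartialHomeomorph.trans ofComplex.symm)

theorem coordHomeo_coe (h : ℍ ≃ₜ ℍ) : ⇑(coordHomeo h) = inCoord h := by
  funext w
  simp [coordHomeo, inCoord, ofComplex]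

theorem coordHomeo_symm_coe (h : ℍ ≃ₜ ℍ) : ⇑(coordHomeo h).symm = inCoord h.symm := by
  funext w
  simp [coordHomeo, inCoord, ofComplex]

theorem coordHomeo_source (h : ℍ ≃ₜ ℍ) : (coordHomeo h).source = {w | 0 < w.im} := by
  ext w
  simp [coordHomeo, ofComplex]

theorem coordHomeo_target (h : ℍ ≃ₜ ℍ) : (coordHomeo h).target = {w | 0 < w.im} := by
  ext w
  simp [coordHomeo, ofComplex]

/-- The inverse function theorem gives smoothness. The determinants of the two differentials
multiply to that of the identity, so they have the same sign. -/
theorem IsDiffeoAt.symm {h : ℍ ≃ₜ ℍ} {z : ℍ} (hz : IsDiffeoAt h z) : IsDiffeoAt h.symm (h z) := by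
  have h1 : ContDiffAt ℝ ∞ (inCoord h.symm) (h z : ℂ) := by
    have h2 := (coordHomeo h).contDiffAt_symm (n := ∞) (a := (h z : ℂ))
      (f₀' := (hDeriv h z).toContinuousLinearEquivOfDetNeZero hz.2.ne')
      (by rw [coordHomeo_target]; exact (h z).im_pos)
    rw [coordHomeo_symm_coe, coordHomeo_coe, inCoord_coe, h.symm_apply_apply] at h2
    exact h2 hz.differentiableAt.hasFDerivAt hz.1
  refine ⟨h1, ?_⟩
  have h2 := hDeriv_comp (g := h.symm) (h := h) (z := z) (h1.differentiableAt (by simp))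
    hz.differentiableAt
  have h3 : (h.symm ∘ h : ℍ → ℍ) = fun z => z := funext h.symm_apply_apply
  have h4 := (isDiffeoAt_id z).2
  rw [← h3, h2] at h4
  have : ((hDeriv h.symm (h z)).comp (hDeriv h z)).det =
      (hDeriv h.symm (h z)).det * (hDeriv h z).det := by
    simp [ContinuousLinearMap.det]
  rw [this] at h4
  exact (pos_iff_pos_of_mul_pos h4).mpr hz.2

theorem hDeriv_id (z : ℍ) (w : ℂ) : hDeriv (fun z => z) z w = w := by
  rw [hDeriv, (inCoord_id_eventuallyEq z).fderiv_eq, fderiv_fun_id]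
  rfl

theorem IsDiffeoAt.hDeriv_symm_apply {h : ℍ ≃ₜ ℍ} {z : ℍ} (hz : IsDiffeoAt h z) (w : ℂ) :
    hDeriv h.symm (h z) (hDeriv h z w) = w := by
  have h2 := hDeriv_comp (g := h.symm) (h := h) (z := z) hz.symm.differentiableAt
    hz.differentiableAt
  have h3 : (h.symm ∘ h : ℍ → ℍ) = fun z => z := funext h.symm_apply_apply
  have h4 := DFunLike.congr_fun h2 w
  rw [h3, hDeriv_id] at h4
  exact h4.symm

namespace ClosedSurface

theorem IsPiecewiseDiffeo.exists_diffeoAt {h : ℍ ≃ₜ ℍ} (hh : IsPiecewiseDiffeo h) :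
    ∃ E : Set ℍ, IsLocFinite E ∧ ∀ z ∉ E, IsDiffeoAt h z := hh

theorem IsPiecewiseDiffeo.symm {h : ℍ ≃ₜ ℍ} (hh : IsPiecewiseDiffeo h) :
    IsPiecewiseDiffeo h.symm := by
  obtain ⟨E, hE, hd⟩ := hh
  refine ⟨h.symm ⁻¹' E, hE.preimage h.symm, fun z hz => ?_⟩
  have h1 : IsDiffeoAt h (h.symm z) := hd _ hz
  have h2 := h1.symm
  rw [h.apply_symm_apply] at h2
  exact h2

theorem IsPiecewiseDiffeo.trans {h₁ h₂ : ℍ ≃ₜ ℍ} (hh₁ : IsPiecewiseDiffeo h₁)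
    (hh₂ : IsPiecewiseDiffeo h₂) : IsPiecewiseDiffeo (h₁.trans h₂) := by
  obtain ⟨E₁, hE₁, hd₁⟩ := hh₁
  obtain ⟨E₂, hE₂, hd₂⟩ := hh₂
  refine ⟨E₁ ∪ h₁ ⁻¹' E₂, hE₁.union (hE₂.preimage h₁), fun z hz => ?_⟩
  rw [mem_union, not_or] at hz
  exact IsDiffeoAt.comp (hd₂ (h₁ z) hz.2) (hd₁ z hz.1)

theorem isPiecewiseDiffeo_refl : IsPiecewiseDiffeo (Homeomorph.refl ℍ) :=
  ⟨∅, isLocFinite_empty, fun z _ => isDiffeoAt_id z⟩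

variable (S : ClosedSurface)

theorem IsLiftOfTrivial.symm {S : ClosedSurface} {h : ℍ ≃ₜ ℍ} (hh : S.IsLiftOfTrivial h) :
    S.IsLiftOfTrivial h.symm := by
  refine ⟨IsPiecewiseDiffeo.symm hh.1, fun γ hγ z => ?_⟩
  rw [h.symm_apply_eq, hh.2 γ hγ, h.apply_symm_apply]

theorem IsLiftOfTrivial.trans {S : ClosedSurface} {h₁ h₂ : ℍ ≃ₜ ℍ} (hh₁ : S.IsLiftOfTrivial h₁)
    (hh₂ : S.IsLiftOfTrivial h₂) : S.IsLiftOfTrivial (h₁.trans h₂) := by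
  refine ⟨IsPiecewiseDiffeo.trans hh₁.1 hh₂.1, fun γ hγ z => ?_⟩
  simp [hh₁.2 γ hγ, hh₂.2 γ hγ]

theorem isLiftOfTrivial_refl : S.IsLiftOfTrivial (Homeomorph.refl ℍ) :=
  ⟨isPiecewiseDiffeo_refl, fun _ _ _ => rfl⟩

/-! ### Quasiconformal maps between complex structures -/

/-- The norm of a tangent vector in the metric `|dz + b dz̄|`. -/
def CplxStr.nrm {S : ClosedSurface} (b : S.CplxStr) (z : ℍ) (w : ℂ) : ℝ := ‖w + b.b z * conj w‖

theorem CplxStr.norm_lt_one {S : ClosedSurface} (b : S.CplxStr) (z : ℍ) : ‖b.b z‖ < 1 := by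
  obtain ⟨k, hk, h⟩ := b.bound
  exact (h z).trans_lt hk

theorem CplxStr.nrm_le {S : ClosedSurface} (b : S.CplxStr) {k : ℝ} {z : ℍ} (h : ‖b.b z‖ ≤ k)
    (w : ℂ) : b.nrm z w ≤ (1 + k) * ‖w‖ := by
  refine (norm_add_le _ _).trans ?_
  rw [norm_mul, RCLike.norm_conj]
  nlinarith [norm_nonneg w]

theorem CplxStr.le_nrm {S : ClosedSurface} (b : S.CplxStr) {k : ℝ} {z : ℍ} (h : ‖b.b z‖ ≤ k)
    (w : ℂ) : (1 - k) * ‖w‖ ≤ b.nrm z w := by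
  have h1 := norm_sub_le (w + b.b z * conj w) (b.b z * conj w)
  rw [add_sub_cancel_right, norm_mul, RCLike.norm_conj] at h1
  unfold nrm
  nlinarith [norm_nonneg w]

theorem CplxStr.nrm_nonneg {S : ClosedSurface} (b : S.CplxStr) (z : ℍ) (w : ℂ) : 0 ≤ b.nrm z w :=
  norm_nonneg _

theorem CplxStr.nrm_pos {S : ClosedSurface} (b : S.CplxStr) (z : ℍ) {w : ℂ} (hw : w ≠ 0) :
    0 < b.nrm z w :=
  (mul_pos (sub_pos.mpr (b.norm_lt_one z)) (norm_pos_iff.mpr hw)).trans_le (b.le_nrm le_rfl w)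

variable {S}

theorem isQC_iff {b₁ b₂ : S.CplxStr} {K : ℝ} {h : ℍ ≃ₜ ℍ} : S.IsQC b₁ b₂ K h ↔
    ∃ E : Set ℍ, IsLocFinite E ∧ ∀ z ∉ E, ∀ w w' : ℂ,
      b₂.nrm (h z) (hDeriv h z w) * b₁.nrm z w' ≤
        K * (b₂.nrm (h z) (hDeriv h z w') * b₁.nrm z w) := Iff.rfl

/-- The condition bounds the ratio of any two stretches at a point. The inverse map inverts the
stretches, so it satisfies the same bound with the two vectors exchanged. -/
theorem IsQC.symm {b₁ b₂ : S.CplxStr} {K : ℝ} {h : ℍ ≃ₜ ℍ} (hq : S.IsQC b₁ b₂ K h)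
    (hh : IsPiecewiseDiffeo h) : S.IsQC b₂ b₁ K h.symm := by
  rw [isQC_iff] at hq ⊢
  obtain ⟨E, hE, hq⟩ := hq
  obtain ⟨F, hF, hd⟩ := hh.symm.exists_diffeoAt
  refine ⟨h.symm ⁻¹' E ∪ F, (hE.preimage h.symm).union hF, fun z hz w w' => ?_⟩
  rw [mem_union, not_or] at hz
  have h1 := hq _ hz.1 (hDeriv h.symm z w') (hDeriv h.symm z w)
  have h2 := fun w => (hd z hz.2).hDeriv_symm_apply w
  simp only [Homeomorph.symm_symm] at h2
  rw [h2, h2, h.apply_symm_apply] at h1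
  linarith

theorem IsQC.trans {b₁ b₂ b₃ : S.CplxStr} {K₁ K₂ : ℝ} {h₁ h₂ : ℍ ≃ₜ ℍ}
    (hq₁ : S.IsQC b₁ b₂ K₁ h₁) (hh₁ : IsPiecewiseDiffeo h₁)
    (hq₂ : S.IsQC b₂ b₃ K₂ h₂) (hh₂ : IsPiecewiseDiffeo h₂) (hK₂ : 0 ≤ K₂) :
    S.IsQC b₁ b₃ (K₁ * K₂) (h₁.trans h₂) := by
  rw [isQC_iff] at hq₁ hq₂ ⊢
  obtain ⟨E₁, hE₁, hq₁⟩ := hq₁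
  obtain ⟨E₂, hE₂, hq₂⟩ := hq₂
  obtain ⟨F₁, hF₁, hd₁⟩ := hh₁.exists_diffeoAt
  obtain ⟨F₂, hF₂, hd₂⟩ := hh₂.exists_diffeoAt
  refine ⟨(E₁ ∪ F₁) ∪ h₁ ⁻¹' (E₂ ∪ F₂),
    (hE₁.union hF₁).union ((hE₂.union hF₂).preimage h₁), fun z hz w w' => ?_⟩
  simp only [mem_union, not_or, mem_preimage] at hz
  obtain ⟨⟨hz1, hz2⟩, hz3, hz4⟩ := hz
  have hc : hDeriv (h₁.trans h₂) z = (hDeriv h₂ (h₁ z)).comp (hDeriv h₁ z) :=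
    hDeriv_comp (hd₂ _ hz4).differentiableAt (hd₁ z hz2).differentiableAt
  rw [hc]
  simp only [ContinuousLinearMap.comp_apply, Homeomorph.trans_apply]
  set v := hDeriv h₁ z w with hv
  set v' := hDeriv h₁ z w' with hv'
  by_cases h0 : w = 0
  · have : v = 0 := by rw [hv, h0, map_zero]
    simp [this, h0, CplxStr.nrm]
  by_cases h0' : w' = 0
  · have : v' = 0 := by rw [hv', h0', map_zero]
    simp [this, h0', CplxStr.nrm]
  have hv0 : v ≠ 0 := fun h => h0 ((hd₁ z hz2).injective (by rw [map_zero]; exact h))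
  have hv0' : v' ≠ 0 := fun h => h0' ((hd₁ z hz2).injective (by rw [map_zero]; exact h))
  have i1 := hq₁ z hz1 w w'
  have i2 := hq₂ (h₁ z) hz3 v v'
  have p1 := b₂.nrm_pos (h₁ z) hv0
  have p2 := b₂.nrm_pos (h₁ z) hv0'
  -- The product of the two distortion inequalities contains the intermediate norms on both sides;
  -- they are positive since the differential of `h₁` is injective, and cancel.
  refine le_of_mul_le_mul_right ?_ (mul_pos p1 p2)
  have i3 := mul_le_mul i2 i1 (mul_nonneg (b₂.nrm_nonneg _ _) (b₁.nrm_nonneg _ _))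
    (mul_nonneg hK₂ (mul_nonneg (b₃.nrm_nonneg _ _) (b₂.nrm_nonneg _ _)))
  rw [← hv, ← hv'] at i3
  nlinarith [i3]

/-- The identity changes norms at most by the eccentricities of the two metrics. This shows that any
two structures are at finite distance, and for `k₁ = 0`, `k₂ = tanh r` the constant is the
dilatation `e^{2r}` of a Teichmüller map. -/
theorem isQC_refl {b₁ b₂ : S.CplxStr} {k₁ k₂ : ℝ} (h₁ : ∀ z, ‖b₁.b z‖ ≤ k₁) (hk₁ : k₁ < 1)
    (h₂ : ∀ z, ‖b₂.b z‖ ≤ k₂) (hk₂ : k₂ < 1) :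
    S.IsQC b₁ b₂ ((1 + k₁) / (1 - k₁) * ((1 + k₂) / (1 - k₂))) (Homeomorph.refl ℍ) := by
  rw [isQC_iff]
  refine ⟨∅, isLocFinite_empty, fun z _ w w' => ?_⟩
  have hid : ∀ w, hDeriv (Homeomorph.refl ℍ) z w = w := hDeriv_id z
  rw [hid, hid, Homeomorph.refl_apply, id_eq]
  have hk₁0 : 0 ≤ k₁ := (norm_nonneg _).trans (h₁ z)
  have hk₂0 : 0 ≤ k₂ := (norm_nonneg _).trans (h₂ z)
  have d1 : 0 < 1 - k₁ := sub_pos.mpr hk₁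
  have d2 : 0 < 1 - k₂ := sub_pos.mpr hk₂
  have i1 : b₂.nrm z w * b₁.nrm z w' ≤ ((1 + k₂) * ‖w‖) * ((1 + k₁) * ‖w'‖) :=
    mul_le_mul (b₂.nrm_le (h₂ z) w) (b₁.nrm_le (h₁ z) w') (b₁.nrm_nonneg _ _) (by positivity)
  have i2 : ((1 - k₂) * ‖w'‖) * ((1 - k₁) * ‖w‖) ≤ b₂.nrm z w' * b₁.nrm z w :=
    mul_le_mul (b₂.le_nrm (h₂ z) w') (b₁.le_nrm (h₁ z) w) (by positivity) (b₂.nrm_nonneg _ _)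
  refine i1.trans ?_
  rw [div_mul_div_comm, div_mul_eq_mul_div, le_div_iff₀ (by positivity)]
  have := mul_le_mul_of_nonneg_left i2 (show 0 ≤ (1 + k₁) * (1 + k₂) by positivity)
  nlinarith [this]

/-- There is a `K`-quasiconformal map from `b₁` to `b₂` which is homotopic to the identity. -/
def QCRel (K : ℝ) (b₁ b₂ : S.CplxStr) : Prop := ∃ h, S.IsLiftOfTrivial h ∧ S.IsQC b₁ b₂ K h

theorem QCRel.symm {K : ℝ} {b₁ b₂ : S.CplxStr} (h : QCRel K b₁ b₂) : QCRel K b₂ b₁ := by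
  obtain ⟨h, h1, h2⟩ := h
  exact ⟨h.symm, h1.symm, h2.symm h1.1⟩

theorem QCRel.trans {K₁ K₂ : ℝ} {b₁ b₂ b₃ : S.CplxStr} (h : QCRel K₁ b₁ b₂) (h' : QCRel K₂ b₂ b₃)
    (hK₂ : 0 ≤ K₂) : QCRel (K₁ * K₂) b₁ b₃ := by
  obtain ⟨h, h1, h2⟩ := h
  obtain ⟨h', h3, h4⟩ := h'
  exact ⟨h.trans h', h1.trans h3, h2.trans h1.1 h4 h3.1 hK₂⟩

theorem qcRel_one_refl (b : S.CplxStr) : QCRel 1 b b := by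
  refine ⟨Homeomorph.refl ℍ, S.isLiftOfTrivial_refl, isQC_iff.mpr ⟨∅, isLocFinite_empty, ?_⟩⟩
  intro z _ w w'
  have hid : ∀ w, hDeriv (Homeomorph.refl ℍ) z w = w := hDeriv_id z
  rw [hid, hid, Homeomorph.refl_apply, id_eq]
  linarith

/-- Equality in a quotient by `TeichRel` refers to the equivalence relation that it generates;
1-quasiconformal maps compose and invert, so nothing new is generated. -/
theorem qcRel_one_of_mkTeich_eq {b₁ b₂ : S.CplxStr} (h : S.mkTeich b₁ = S.mkTeich b₂) :
    QCRel 1 b₁ b₂ := by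
  have h1 : Relation.EqvGen S.TeichRel b₁ b₂ := Quot.eq.mp h
  induction h1 with
  | rel x y h' => exact h'
  | refl x => exact qcRel_one_refl x
  | symm x y _ ih => exact (ih (Quot.eq.mpr ‹_›)).symm
  | trans x y z _ _ ih1 ih2 =>
    simpa using (ih1 (Quot.eq.mpr ‹_›)).trans (ih2 (Quot.eq.mpr ‹_›)) zero_le_one

theorem exists_qcRel (b₁ b₂ : S.CplxStr) : ∃ K, 1 ≤ K ∧ QCRel K b₁ b₂ := by
  obtain ⟨k₁, hk₁, h₁⟩ := b₁.bound
  obtain ⟨k₂, hk₂, h₂⟩ := b₂.bound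
  have hk₁0 : 0 ≤ k₁ := (norm_nonneg _).trans (h₁ I)
  have hk₂0 : 0 ≤ k₂ := (norm_nonneg _).trans (h₂ I)
  refine ⟨_, ?_, Homeomorph.refl ℍ, S.isLiftOfTrivial_refl, isQC_refl h₁ hk₁ h₂ hk₂⟩
  have d1 : 1 ≤ (1 + k₁) / (1 - k₁) := by
    rw [le_div_iff₀ (sub_pos.mpr hk₁)]; linarith
  have d2 : 1 ≤ (1 + k₂) / (1 - k₂) := by
    rw [le_div_iff₀ (sub_pos.mpr hk₂)]; linarith
  nlinarith

/-! ### The Teichmüller distance -/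

theorem teichDist_mk_le {b₁ b₂ : S.CplxStr} {K : ℝ} (hK : 1 ≤ K) (h : QCRel K b₁ b₂) :
    S.teichDist (S.mkTeich b₁) (S.mkTeich b₂) ≤ 1 / 2 * Real.log K := by
  unfold teichDist
  have hmem : K ∈ {K : ℝ | 1 ≤ K ∧ ∃ b₁' b₂' : S.CplxStr, S.mkTeich b₁' = S.mkTeich b₁ ∧
    S.mkTeich b₂' = S.mkTeich b₂ ∧ ∃ h : ℍ ≃ₜ ℍ, S.IsLiftOfTrivial h ∧ S.IsQC b₁' b₂' K h} :=
    ⟨hK, b₁, b₂, rfl, rfl, h⟩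
  have h1 := csInf_le ⟨1, fun K hK => hK.1⟩ hmem
  have h2 := le_csInf ⟨K, hmem⟩ fun K hK => hK.1
  have h3 := Real.log_le_log (by linarith) h1
  linarith

theorem exists_qcRel_of_teichDist_lt {b₁ b₂ : S.CplxStr} {δ : ℝ}
    (h : S.teichDist (S.mkTeich b₁) (S.mkTeich b₂) < δ) :
    ∃ K, 1 ≤ K ∧ K < Real.exp (2 * δ) ∧ QCRel K b₁ b₂ := by
  unfold teichDist at h
  set A := {K : ℝ | 1 ≤ K ∧ ∃ b₁' b₂' : S.CplxStr, S.mkTeich b₁' = S.mkTeich b₁ ∧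
    S.mkTeich b₂' = S.mkTeich b₂ ∧ ∃ h : ℍ ≃ₜ ℍ, S.IsLiftOfTrivial h ∧ S.IsQC b₁' b₂' K h} with hA
  obtain ⟨K₀, hK₀, h₀⟩ := exists_qcRel b₁ b₂
  have hne : A.Nonempty := ⟨K₀, hK₀, b₁, b₂, rfl, rfl, h₀⟩
  have h2 := le_csInf hne fun K hK => hK.1
  have h3 : sInf A < Real.exp (2 * δ) := by
    rw [← Real.log_lt_iff_lt_exp (by linarith)]
    linarith
  obtain ⟨K, ⟨hK1, b₁', b₂', e1, e2, hq⟩, hK2⟩ := exists_lt_of_csInf_lt hne h3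
  refine ⟨K, hK1, hK2, ?_⟩
  have hK0 : (0 : ℝ) ≤ K := by linarith
  -- The infimum provides a map between other representatives; composing with 1-quasiconformal maps
  -- on both sides costs nothing.
  have := ((qcRel_one_of_mkTeich_eq e1.symm).trans (show QCRel K b₁' b₂' from hq)
    hK0).trans (qcRel_one_of_mkTeich_eq e2) zero_le_one
  simpa using this

theorem teichDist_comm (x y : S.Teich) : S.teichDist x y = S.teichDist y x := by
  unfold teichDist
  congr 3
  ext K
  constructor
  · rintro ⟨h1, b₁, b₂, e1, e2, h⟩
    exact ⟨h1, b₂, b₁, e2, e1, QCRel.symm h⟩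
  · rintro ⟨h1, b₁, b₂, e1, e2, h⟩
    exact ⟨h1, b₂, b₁, e2, e1, QCRel.symm h⟩

theorem qcRel_rayStr {r : ℝ} (hr : 0 ≤ r) (q : S.UnitQD) :
    QCRel (Real.exp (2 * r)) S.baseStr (S.rayStr r q) := by
  refine ⟨Homeomorph.refl ℍ, S.isLiftOfTrivial_refl, ?_⟩
  have ht0 : 0 ≤ Real.tanh r := by
    rw [Real.tanh_eq_sinh_div_cosh]
    exact div_nonneg (Real.sinh_nonneg_iff.mpr hr) (Real.cosh_pos r).le
  have h := isQC_refl (b₁ := S.baseStr) (b₂ := S.rayStr r q) (k₁ := 0) (k₂ := Real.tanh r)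
    (fun z => by simp [baseStr]) one_pos (fun z => by
      simp only [rayStr]
      rw [norm_mul, norm_div, Complex.norm_real, Complex.norm_real, RCLike.norm_conj, norm_norm,
        Real.norm_eq_abs, abs_of_nonneg ht0]
      exact mul_le_of_le_one_right ht0 (div_self_le_one _)) (Real.tanh_lt_one r)
  convert h using 1
  have hc := Real.cosh_pos r
  rw [Real.tanh_eq_sinh_div_cosh]
  have h1 : Real.cosh r - Real.sinh r = Real.exp (-r) := by rw [Real.cosh_sub_sinh]
  have h2 : Real.cosh r + Real.sinh r = Real.exp r := by rw [Real.cosh_add_sinh]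
  have h3 : (1 + Real.sinh r / Real.cosh r) / (1 - Real.sinh r / Real.cosh r) =
      (Real.cosh r + Real.sinh r) / (Real.cosh r - Real.sinh r) := by
    have h4 : Real.cosh r - Real.sinh r ≠ 0 := by rw [h1]; exact (Real.exp_pos _).ne'
    have h5 : 1 - Real.sinh r / Real.cosh r ≠ 0 := by
      rw [one_sub_div hc.ne']
      exact div_ne_zero h4 hc.ne'
    rw [div_eq_div_iff h5 h4]
    field_simp
  rw [h3, h1, h2, ← Real.exp_sub]
  norm_num
  ring_nf

end ClosedSurface

namespace ClosedSurface

variable (S : ClosedSurface)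

/-! ### Finite generation of the surface group and countability of the orbit -/

/-- Each element moves the point `I` into some set of a countable compact exhaustion, and for each
such set there are only finitely many elements. -/
instance countable_group : Countable S.Γ := by
  have h1 : (S.Γ : Set SL(2, ℝ)) ⊆ ⋃ n : ℕ, {γ : SL(2, ℝ) | γ ∈ S.Γ ∧
      ((γ • · : ℍ → ℍ) '' (compactCovering ℍ n ∪ {I}) ∩ (compactCovering ℍ n ∪ {I})).Nonempty} := by
    intro γ hγ
    obtain ⟨n, hn⟩ := exists_mem_compactCovering (γ • I : ℍ)
    exact mem_iUnion.mpr ⟨n, hγ, γ • I, ⟨I, Or.inr rfl, rfl⟩, Or.inl hn⟩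
  exact ((countable_iUnion fun n => (S.properlyDisc _
    ((isCompact_compactCovering ℍ n).union isCompact_singleton)).countable).mono h1).to_subtype

instance countable_curve : Countable S.Curve :=
  inferInstanceAs (Countable {a : S.Γ // S.IsSimpleClass a})

/-- The elements moving a compact set `K'` to meet itself generate, because `ℍ` is connected: the
translates of the interior of `K'` by the generated subgroup, and those by the remaining elements,
are disjoint open sets that cover `ℍ`. A homotopy class of lifts is then determined by finitely many
group elements. -/
theorem exists_finite_generators : ∃ F : Set SL(2, ℝ), F.Finite ∧ F ⊆ S.Γ ∧
    S.Γ ≤ Subgroup.closure F := by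
  obtain ⟨K, hK, hcov⟩ := S.cocompact
  -- The interior of `K'` already meets every orbit, so that the translates in the covering are
  -- open.
  obtain ⟨K', hK', hKK'⟩ := exists_compact_superset hK
  refine ⟨_, S.properlyDisc K' hK', fun γ hγ => hγ.1, ?_⟩
  set F := {γ : SL(2, ℝ) | γ ∈ S.Γ ∧ ((γ • · : ℍ → ℍ) '' K' ∩ K').Nonempty} with hF
  have hopen : ∀ A : Set SL(2, ℝ), IsOpen (⋃ γ ∈ A, (γ⁻¹ • · : ℍ → ℍ) ⁻¹' interior K') := fun A =>
    isOpen_biUnion fun γ _ => isOpen_interior.preimage (continuous_smul_sl γ⁻¹)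
  let U : Set ℍ := ⋃ γ ∈ {γ | γ ∈ S.Γ ∧ γ ∈ Subgroup.closure F},
    (γ⁻¹ • · : ℍ → ℍ) ⁻¹' interior K'
  let V : Set ℍ := ⋃ γ ∈ {γ | γ ∈ S.Γ ∧ γ ∉ Subgroup.closure F},
    (γ⁻¹ • · : ℍ → ℍ) ⁻¹' interior K'
  have hUV : Uᶜ = V := by
    ext z
    constructor
    · intro hz
      obtain ⟨γ, hγ, hγz⟩ := hcov z
      refine mem_iUnion₂.mpr ⟨γ⁻¹, ⟨S.Γ.inv_mem hγ, fun hcl => hz ?_⟩, ?_⟩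
      · refine mem_iUnion₂.mpr ⟨γ⁻¹, ⟨S.Γ.inv_mem hγ, hcl⟩, ?_⟩
        simpa using hKK' hγz
      · simpa using hKK' hγz
    · rintro hz hz'
      obtain ⟨γ, ⟨hγ1, hγ2⟩, hγ3⟩ := mem_iUnion₂.mp hz
      obtain ⟨δ, ⟨hδ1, hδ2⟩, hδ3⟩ := mem_iUnion₂.mp hz'
      refine hγ2 ?_
      have h1 : δ⁻¹ * γ ∈ F := by
        refine ⟨S.Γ.mul_mem (S.Γ.inv_mem hδ1) hγ1, δ⁻¹ • z, ⟨γ⁻¹ • z, interior_subset hγ3, ?_⟩,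
          interior_subset hδ3⟩
        simp [mul_smul]
      have h2 := (Subgroup.closure F).mul_mem hδ2 (Subgroup.subset_closure h1)
      rwa [mul_inv_cancel_left] at h2
  have hclopen : IsClopen U := ⟨⟨by rw [hUV]; exact hopen _⟩, hopen _⟩
  obtain ⟨γ₀, hγ₀, hz₀⟩ := hcov I
  have hUne : U.Nonempty := ⟨γ₀ • I, mem_iUnion₂.mpr ⟨1, ⟨S.Γ.one_mem, one_mem _⟩, by
    simpa using hKK' hz₀⟩⟩
  have hU := hclopen.eq_univ hUne
  intro γ hγ
  by_contra hcl
  have h1 : γ • (γ₀ • I : ℍ) ∈ V := mem_iUnion₂.mpr ⟨γ, ⟨hγ, hcl⟩, by simpa using hKK' hz₀⟩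
  rw [← hUV, hU, compl_univ] at h1
  exact h1

theorem base_mem_mcgOrbit : S.base ∈ S.mcgOrbit := by
  have h0 : ∀ z, ‖S.baseStr.b z‖ ≤ 0 := fun z => by simp [baseStr]
  have h1 := isQC_refl h0 one_pos h0 one_pos
  refine ⟨S.baseStr, rfl, Homeomorph.refl ℍ, ⟨isPiecewiseDiffeo_refl, ?_, ?_⟩, by simpa using h1⟩
  · exact fun γ hγ => ⟨γ, hγ, fun _ => rfl⟩
  · exact fun γ hγ => ⟨γ, hγ, fun _ => rfl⟩

instance nonempty_mcgOrbit : Nonempty S.mcgOrbit := ⟨⟨S.base, S.base_mem_mcgOrbit⟩⟩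

variable {S}

/-- Lifts of maps that act in the same way on generators of the group differ by the lift of a
map homotopic to the identity. -/
theorem IsLiftOfMap.symm_trans {F : Set SL(2, ℝ)} (hF : S.Γ ≤ Subgroup.closure F)
    {h₁ h₂ : ℍ ≃ₜ ℍ} (hh₁ : S.IsLiftOfMap h₁) (hh₂ : S.IsLiftOfMap h₂)
    (heq : ∀ γ ∈ F, ∃ ε : SL(2, ℝ), (∀ z : ℍ, h₁ (γ • z) = ε • h₁ z) ∧
      ∀ z : ℍ, h₂ (γ • z) = ε • h₂ z) : S.IsLiftOfTrivial (h₁.symm.trans h₂) := by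
  have hP : ∀ γ ∈ Subgroup.closure F, ∃ ε : SL(2, ℝ), (∀ z : ℍ, h₁ (γ • z) = ε • h₁ z) ∧
      ∀ z : ℍ, h₂ (γ • z) = ε • h₂ z := by
    intro γ hγ
    induction hγ using Subgroup.closure_induction with
    | mem γ hγ => exact heq γ hγ
    | one => exact ⟨1, fun z => by simp, fun z => by simp⟩
    | mul γ δ _ _ ih1 ih2 =>
      obtain ⟨ε, e1, e2⟩ := ih1
      obtain ⟨ε', e3, e4⟩ := ih2
      exact ⟨ε * ε', fun z => by rw [mul_smul, e1, e3, mul_smul],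
        fun z => by rw [mul_smul, e2, e4, mul_smul]⟩
    | inv γ _ ih =>
      obtain ⟨ε, e1, e2⟩ := ih
      exact ⟨ε⁻¹, fun z => by rw [eq_inv_smul_iff, ← e1, smul_inv_smul],
        fun z => by rw [eq_inv_smul_iff, ← e2, smul_inv_smul]⟩
  refine ⟨(IsPiecewiseDiffeo.symm hh₁.1).trans hh₂.1, fun δ hδ z => ?_⟩
  obtain ⟨γ, hγ, e1⟩ := hh₁.2.2 δ hδ
  obtain ⟨ε, e2, e3⟩ := hP γ (hF hγ)
  -- Both `δ` and `ε` act as the conjugate of `γ` by `h₁`; they need not be equal as matrices.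
  have h1 : ∀ w : ℍ, δ • w = ε • w := fun w => by
    rw [← h₁.apply_symm_apply (δ • w), e1, e2, h₁.apply_symm_apply]
  rw [h1 (h₁.symm.trans h₂ z)]
  simp [e1, e3]

variable (S)

/-- Send an orbit point to the images of the finitely many generators under a representing lift. Two
points with the same images differ by a conformal map homotopic to the identity, so this injects the
orbit into the countable set of functions `F → Γ`. -/
instance countable_mcgOrbit : Countable S.mcgOrbit := by
  obtain ⟨F, hfin, hFΓ, hF⟩ := S.exists_finite_generators
  have hfin' : Finite F := hfin
  choose b hb h hh hq using fun y : S.mcgOrbit => y.2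
  choose φ hφ hφ' using fun y : S.mcgOrbit => fun γ : F => (hh y).2.1 γ.1 (hFΓ γ.2)
  let Φ : S.mcgOrbit → F → S.Γ := fun y γ => ⟨φ y γ, hφ y γ⟩
  refine Function.Injective.countable (f := Φ) fun y₁ y₂ heq => Subtype.ext ?_
  rw [← hb y₁, ← hb y₂]
  refine Quot.sound ⟨(h y₁).symm.trans (h y₂), ?_, ?_⟩
  · refine IsLiftOfMap.symm_trans hF (hh y₁) (hh y₂) fun γ hγ => ⟨φ y₁ ⟨γ, hγ⟩, hφ' y₁ ⟨γ, hγ⟩, ?_⟩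
    have h1 : φ y₁ ⟨γ, hγ⟩ = φ y₂ ⟨γ, hγ⟩ := congrArg Subtype.val (congrFun heq ⟨γ, hγ⟩)
    rw [h1]
    exact hφ' y₂ ⟨γ, hγ⟩
  · simpa using ((hq y₁).symm (hh y₁).1).trans (IsPiecewiseDiffeo.symm (hh y₁).1) (hq y₂) (hh y₂).1
      zero_le_one

end ClosedSurface

namespace ClosedSurface

/-! ### Transverse measures -/

theorem cpow_half_sq (Q : ℂ) : (Q ^ (1 / 2 : ℂ)) ^ 2 = Q := by
  have h := Complex.cpow_nat_inv_pow Q (n := 2) two_ne_zero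
  rwa [Nat.cast_ofNat, ← one_div] at h

/-- `|Re s|` as a function of `s²`. -/
def absReSqrt (ζ : ℂ) : ℝ := √((‖ζ‖ + ζ.re) / 2)

theorem absReSqrt_sq (s : ℂ) : absReSqrt (s ^ 2) = |s.re| := by
  have h1 : ‖s ^ 2‖ = s.re ^ 2 + s.im ^ 2 := by
    rw [norm_pow, ← Complex.normSq_eq_norm_sq, Complex.normSq_apply]; ring
  have h2 : (s ^ 2).re = s.re ^ 2 - s.im ^ 2 := by
    simp [pow_two]
  rw [absReSqrt, h1, h2, ← Real.sqrt_sq_eq_abs]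
  congr 1
  ring

theorem continuous_absReSqrt : Continuous absReSqrt := by
  unfold absReSqrt
  fun_prop

/-- The transverse measure depends only on `Q w²`. This removes the branch of the square root, and
with it the discontinuity. -/
theorem transverse_eq (Q w : ℂ) : transverse Q w = absReSqrt (Q * w ^ 2) := by
  rw [transverse, ← absReSqrt_sq, mul_pow, cpow_half_sq]

theorem transverse_sq (η w : ℂ) : transverse (η ^ 2) w = |(η * w).re| := by
  rw [transverse_eq, ← mul_pow, absReSqrt_sq]

theorem transverse_congr {Q Q' w w' : ℂ} (h : Q * w ^ 2 = Q' * w' ^ 2) :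
    transverse Q w = transverse Q' w' := by rw [transverse_eq, transverse_eq, h]

theorem transverse_nonneg (Q w : ℂ) : 0 ≤ transverse Q w := abs_nonneg _

theorem transverse_real_smul (Q w : ℂ) (t : ℝ) :
    transverse Q (t * w) = |t| * transverse Q w := by
  rw [transverse, transverse, ← abs_mul, ← Complex.re_ofReal_mul]
  congr 2
  ring

theorem transverse_sq_real_mul (Q w : ℂ) (t : ℝ) :
    transverse ((t : ℂ) ^ 2 * Q) w = |t| * transverse Q w := by
  rw [← transverse_real_smul]
  exact transverse_congr (by ring)

theorem continuous_transverse : Continuous fun p : ℂ × ℂ => transverse p.1 p.2 := by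
  simp only [transverse_eq]
  exact continuous_absReSqrt.comp (by fun_prop)

theorem absReSqrt_sq_mul_two (ζ : ℂ) : 2 * absReSqrt ζ ^ 2 = ‖ζ‖ + ζ.re := by
  rw [absReSqrt, Real.sq_sqrt]
  · ring
  · have := (abs_le.mp (Complex.abs_re_le_norm ζ)).1
    linarith

/-- The transverse measure determines the quadratic differential. -/
theorem eq_of_transverse_eq {Q Q' : ℂ} (h : ∀ w, transverse Q w = transverse Q' w) : Q = Q' := by
  -- Every `u` is the square of a tangent vector. The values at `u = 1, -1, I` determine first the
  -- modulus and the real part, then the imaginary part.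
  have h1 : ∀ u : ℂ, ‖Q * u‖ + (Q * u).re = ‖Q' * u‖ + (Q' * u).re := fun u => by
    have h2 := h (u ^ (1 / 2 : ℂ))
    rw [transverse_eq, transverse_eq, cpow_half_sq] at h2
    rw [← absReSqrt_sq_mul_two, ← absReSqrt_sq_mul_two, h2]
  have e1 := h1 1
  have e2 := h1 (-1)
  have e3 := h1 Complex.I
  simp only [mul_one, mul_neg, norm_neg, Complex.neg_re, norm_mul, Complex.norm_I,
    Complex.mul_re, Complex.I_re, Complex.I_im, mul_zero, zero_sub] at e1 e2 e3
  refine Complex.ext (by linarith) (by linarith)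

/-- The pull-back of a quadratic differential, as far as its vertical foliation is concerned. -/
def pullQD (g : ℍ → ℍ) (Q : ℍ → ℂ) (z : ℍ) : ℂ :=
  (((Q (g z) ^ (1 / 2 : ℂ) * hDeriv g z 1).re : ℂ) -
    ((Q (g z) ^ (1 / 2 : ℂ) * hDeriv g z Complex.I).re : ℂ) * Complex.I) ^ 2

theorem clm_apply_eq (T : ℂ →L[ℝ] ℂ) (w : ℂ) : T w = w.re * T 1 + w.im * T Complex.I := by
  conv_lhs => rw [← Complex.re_add_im w]
  rw [map_add]
  congr 1
  · rw [show (w.re : ℂ) = w.re • (1 : ℂ) by simp, map_smul]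
    simp
  · rw [show (w.im : ℂ) * Complex.I = w.im • Complex.I by simp, map_smul]
    simp

/-- The real linear form `w ↦ Re (√Q · Dg w)` is `Re (η w)`, where `η` has real part the value at
`1` and imaginary part minus the value at `I`; `pullQD` is `η²`. -/
theorem transverse_pullQD (g : ℍ → ℍ) (Q : ℍ → ℂ) (z : ℍ) (w : ℂ) :
    transverse (pullQD g Q z) w = transverse (Q (g z)) (hDeriv g z w) := by
  rw [pullQD, transverse_sq, transverse]
  congr 1
  rw [clm_apply_eq (hDeriv g z) w]
  simp only [Complex.mul_re, Complex.sub_re, Complex.sub_im, Complex.ofReal_re, Complex.ofReal_im,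
    Complex.I_re, Complex.I_im, Complex.mul_im, Complex.add_re, Complex.add_im]
  ring

variable (S : ClosedSurface)

/-- Transverse measures pull back, and they determine the differential, whence the invariance. The
prong charts are those of `Q` composed with `g`. -/
theorem isMeasuredFoliation_pullQD {S : ClosedSurface} {g : ℍ ≃ₜ ℍ} (hg : S.IsLiftOfTrivial g)
    {Q : ℍ → ℂ} (hQ : S.IsMeasuredFoliation Q) : S.IsMeasuredFoliation (pullQD g Q) := by
  refine ⟨fun γ hγ z => eq_of_transverse_eq fun w => ?_, fun p => ?_⟩
  · have hγ' := hg.2 γ hγ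
    rw [transverse_pullQD, hγ', hQ.1 γ hγ, hDeriv_equivariant hγ']
    have h1 : transverse (autFactor γ z ^ 4 * pullQD g Q z) w =
        transverse (pullQD g Q z) (autFactor γ z ^ 2 * w) := transverse_congr (by ring)
    rw [h1, transverse_pullQD]
    refine transverse_congr ?_
    have := autFactor_ne_zero γ (g z)
    field_simp
  · obtain ⟨E, hE, hd⟩ := IsPiecewiseDiffeo.exists_diffeoAt hg.1
    obtain ⟨ψ, n, h1, h2, h3, h4⟩ := hQ.2 (g p)
    -- The chart is shrunk until `g` is singular at most at the centre, where a prong chart need not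
    -- be smooth.
    obtain ⟨V, hV, hVo, hpV⟩ := eventually_nhds_iff.mp (hE.eventually_notMem p)
    have hVo' : IsOpen (UpperHalfPlane.coe '' V) := isOpenEmbedding_coe.isOpenMap V hVo
    refine ⟨((coordHomeo g).trans ψ).restrOpen _ hVo', n, ?_, ?_, ?_, ?_⟩
    · simp only [OpenPartialHomeomorph.restrOpen_source, OpenPartialHomeomorph.trans_source,
        coordHomeo_source, coordHomeo_coe]
      exact ⟨⟨p.im_pos, by simpa using h1⟩, mem_image_of_mem _ hpV⟩
    · simp only [OpenPartialHomeomorph.restrOpen_source, OpenPartialHomeomorph.trans_source,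
        coordHomeo_source]
      exact fun z hz => hz.1.1
    · simp [coordHomeo_coe, h3]
    · intro z hz hzp
      simp only [OpenPartialHomeomorph.restrOpen_source, OpenPartialHomeomorph.trans_source,
        coordHomeo_source, coordHomeo_coe] at hz
      have hzψ : ((g z : ℍ) : ℂ) ∈ ψ.source := by simpa using hz.1.2
      obtain ⟨z', hz', hzz⟩ := hz.2
      rw [UpperHalfPlane.ext hzz] at hz'
      have hdz := hd z (hV z hz' hzp)
      obtain ⟨i1, i2, i3⟩ := h4 (g z) hzψ (g.injective.ne hzp)
      have hcoe : ⇑(((coordHomeo g).trans ψ).restrOpen _ hVo') = ψ ∘ inCoord g := by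
        funext w; simp [coordHomeo_coe]
      have hfd : fderiv ℝ (ψ ∘ inCoord g) (z : ℂ) =
          (fderiv ℝ ψ (g z : ℂ)).comp (hDeriv g z) := by
        rw [fderiv_comp, inCoord_coe]
        · rfl
        · rw [inCoord_coe]; exact i1.differentiableAt (by simp)
        · exact hdz.differentiableAt
      rw [hcoe, hfd]
      refine ⟨?_, ?_, fun w => ?_⟩
      · refine ContDiffAt.comp _ ?_ hdz.1
        rw [inCoord_coe]; exact i1
      · have : ((fderiv ℝ ψ (g z : ℂ)).comp (hDeriv g z)).det =
            (fderiv ℝ ψ (g z : ℂ)).det * (hDeriv g z).det := by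
          simp [ContinuousLinearMap.det]
        rw [this]
        exact mul_ne_zero i2 hdz.2.ne'
      · rw [transverse_pullQD, i3]
        simp

/-! ### Intersection numbers with curves -/

/-- The infimum defining the intersection number with a curve. -/
def curveInf (Q : ℍ → ℂ) (α : S.Curve) : ℝ≥0∞ :=
  ⨅ (c : ℝ → ℍ) (E : Set ℍ) (_ : S.IsLoopLift α.1 c) (_ : IsLocFinite E)
    (_ : ∀ t ∈ Ioo (0 : ℝ) 1, c t ∉ E → ContDiffAt ℝ 1 (fun s => (c s : ℂ)) t),
    ∫⁻ t in {t | t ∈ Ioo (0 : ℝ) 1 ∧ c t ∉ E},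
      ENNReal.ofReal (transverse (Q (c t)) (deriv (fun s => (c s : ℂ)) t))

theorem height_eq (Q : ℍ → ℂ) (α : S.Curve) : S.height Q α = (S.curveInf Q α).toReal := rfl

theorem curveInf_le {S : ClosedSurface} (Q : ℍ → ℂ) {α : S.Curve} {c : ℝ → ℍ} {E : Set ℍ}
    (hc : S.IsLoopLift α.1 c) (hE : IsLocFinite E)
    (hcd : ∀ t ∈ Ioo (0 : ℝ) 1, c t ∉ E → ContDiffAt ℝ 1 (fun s => (c s : ℂ)) t) :
    S.curveInf Q α ≤ ∫⁻ t in {t | t ∈ Ioo (0 : ℝ) 1 ∧ c t ∉ E},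
      ENNReal.ofReal (transverse (Q (c t)) (deriv (fun s => (c s : ℂ)) t)) :=
  iInf_le_of_le c <| iInf_le_of_le E <| iInf_le_of_le hc <| iInf_le_of_le hE <|
    iInf_le_of_le hcd le_rfl

theorem isOpen_regularTimes {c : ℝ → ℍ} {a b : ℝ} (hc : ContinuousOn c (Icc a b)) {E : Set ℍ}
    (hE : IsLocFinite E) : IsOpen {t | t ∈ Ioo a b ∧ c t ∉ E} :=
  (hc.mono Ioo_subset_Icc_self).isOpen_inter_preimage isOpen_Ioo hE.isClosed.isOpen_compl

/-- Curves are pushed forward by `g`, which preserves their homotopy class. The points where `g` is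
singular are added to the set that is not counted; since only finitely many lie in a compact set,
the new set is still admissible. -/
theorem curveInf_le_of_map {S : ClosedSurface} {g : ℍ ≃ₜ ℍ} (hg : S.IsLiftOfTrivial g)
    {Q Q' : ℍ → ℂ} (hQ : ∃ F, IsLocFinite F ∧ ∀ z ∉ F, IsDiffeoAt g z ∧
      ∀ w, transverse (Q' (g z)) (hDeriv g z w) ≤ transverse (Q z) w) (α : S.Curve) :
    S.curveInf Q' α ≤ S.curveInf Q α := by
  obtain ⟨F, hF, hQ⟩ := hQ
  refine le_iInf fun c => le_iInf fun E => le_iInf fun hc => le_iInf fun hE =>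
      le_iInf fun hcd => ?_
  have hcomp : ∀ t ∈ Ioo (0 : ℝ) 1, c t ∉ E ∪ F →
      (ContDiffAt ℝ 1 (fun s => (g (c s) : ℂ)) t) ∧
        deriv (fun s => (g (c s) : ℂ)) t = hDeriv g (c t) (deriv (fun s => (c s : ℂ)) t) := by
    intro t ht htE
    rw [mem_union, not_or] at htE
    have h1 : (fun s => (g (c s) : ℂ)) = inCoord g ∘ fun s => (c s : ℂ) := by
      funext s; simp
    have h2 := (hQ _ htE.2).1
    have h3 := hcd t ht htE.1
    rw [h1]
    refine ⟨ContDiffAt.comp t (h2.1.of_le (by simp)) h3, ?_⟩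
    exact (HasFDerivAt.comp_hasDerivAt t h2.differentiableAt.hasFDerivAt
      (h3.differentiableAt (by simp)).hasDerivAt).deriv
  have hE' : IsLocFinite (g.symm ⁻¹' (E ∪ F)) := (hE.union hF).preimage g.symm
  have hmem : ∀ t, g (c t) ∉ g.symm ⁻¹' (E ∪ F) ↔ c t ∉ E ∪ F := fun t => by simp
  have hloop : S.IsLoopLift α.1 fun t => g (c t) := by
    refine ⟨g.continuous.comp_continuousOn hc.1, ?_⟩
    simp only [hc.2]
    exact hg.2 _ α.1.2 _
  refine (curveInf_le Q' hloop hE' ?_).trans ?_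
  · intro t ht htE
    exact (hcomp t ht ((hmem t).mp htE)).1
  · simp only [hmem]
    calc _ ≤ ∫⁻ t in {t | t ∈ Ioo (0 : ℝ) 1 ∧ c t ∉ E ∪ F},
            ENNReal.ofReal (transverse (Q (c t)) (deriv (fun s => (c s : ℂ)) t)) := by
          refine setLIntegral_mono' (isOpen_regularTimes hc.1 (hE.union hF)).measurableSet
            fun t ht => ?_
          rw [(hcomp t ht.1 ht.2).2]
          exact ENNReal.ofReal_le_ofReal ((hQ _ fun h => ht.2 (Or.inr h)).2 _)
      _ ≤ _ := lintegral_mono_set fun t ht =>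
          And.intro ht.1 fun h => ht.2 (Or.inl h)

theorem height_pullQD {S : ClosedSurface} {g : ℍ ≃ₜ ℍ} (hg : S.IsLiftOfTrivial g) (Q : ℍ → ℂ) :
    S.height (pullQD g Q) = S.height Q := by
  funext α
  rw [height_eq, height_eq]
  obtain ⟨F, hF, hd⟩ := IsPiecewiseDiffeo.exists_diffeoAt hg.1
  congr 1
  refine le_antisymm (curveInf_le_of_map hg.symm ⟨g.symm ⁻¹' F, hF.preimage _, fun z hz => ?_⟩ α)
    (curveInf_le_of_map hg ⟨F, hF, fun z hz => ⟨hd z hz, fun w => ?_⟩⟩ α)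
  · have h1 : IsDiffeoAt g (g.symm z) := hd _ hz
    have h2 := h1.symm
    rw [g.apply_symm_apply] at h2
    refine ⟨h2, fun w => ?_⟩
    rw [transverse_pullQD, g.apply_symm_apply]
    have h3 := h2.hDeriv_symm_apply w
    rw [Homeomorph.symm_symm] at h3
    rw [h3]
  · rw [transverse_pullQD]

end ClosedSurface

/-! ### Integration on the surface -/

theorem setLIntegral_lebH (s : Set ℍ) (f : ℍ → ℝ≥0∞) :
    ∫⁻ z in s, f z ∂lebH = ∫⁻ w in UpperHalfPlane.coe '' s, f (ofComplex w) := by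
  have hmp : MeasurePreserving UpperHalfPlane.coe lebH
      (volume.restrict (range UpperHalfPlane.coe)) :=
    ⟨measurable_coe, by rw [lebH, measurableEmbedding_coe.map_comap]⟩
  have h := hmp.setLIntegral_comp_emb measurableEmbedding_coe (fun w => f (ofComplex w)) s
  simp only [ofComplex_apply] at h
  rw [h, Measure.restrict_restrict_of_subset (image_subset_range _ _)]

theorem lebH_countable {E : Set ℍ} (hE : E.Countable) : lebH E = 0 := by
  rw [lebH, measurableEmbedding_coe.comap_apply]
  exact (hE.image _).measure_zero _

theorem ae_lebH_of_locFinite {E : Set ℍ} (hE : IsLocFinite E) : ∀ᵐ z ∂lebH, z ∉ E :=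
  measure_eq_zero_iff_ae_notMem.mp (lebH_countable hE.countable)

namespace ClosedSurface

/-- The change of variables formula, applied off the singular points of `h`, which are countable and
hence null. -/
theorem setLIntegral_image_lebH {h : ℍ ≃ₜ ℍ} (hh : IsPiecewiseDiffeo h) {s : Set ℍ}
    (hs : MeasurableSet s) (φ : ℍ → ℝ≥0∞) :
    ∫⁻ z in h '' s, φ z ∂lebH =
      ∫⁻ z in s, ENNReal.ofReal (hDeriv h z).det * φ (h z) ∂lebH := by
  obtain ⟨E, hE, hd⟩ := hh.exists_diffeoAt
  have hEm : MeasurableSet E := hE.isClosed.measurableSet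
  have h1 : ∫⁻ z in h '' s, φ z ∂lebH = ∫⁻ z in h '' (s \ E), φ z ∂lebH := by
    refine setLIntegral_congr ?_
    rw [image_sdiff h.injective]
    exact (sdiff_null_ae_eq_self (lebH_countable (hE.countable.image _))).symm
  have h2 : ∫⁻ z in s, ENNReal.ofReal (hDeriv h z).det * φ (h z) ∂lebH =
      ∫⁻ z in s \ E, ENNReal.ofReal (hDeriv h z).det * φ (h z) ∂lebH :=
    setLIntegral_congr (sdiff_null_ae_eq_self (lebH_countable hE.countable)).symm
  rw [h1, h2, setLIntegral_lebH, setLIntegral_lebH]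
  have h3 : UpperHalfPlane.coe '' (h '' (s \ E)) = inCoord h '' (UpperHalfPlane.coe '' (s \ E)) := by
    rw [image_image, image_image]
    simp
  have hsE : MeasurableSet (UpperHalfPlane.coe '' (s \ E)) :=
    measurableEmbedding_coe.measurableSet_image.mpr (hs.diff hEm)
  rw [h3, lintegral_image_eq_lintegral_abs_det_fderiv_mul volume hsE (f' := fderiv ℝ (inCoord h))]
  · refine setLIntegral_congr_fun hsE ?_
    rintro _ ⟨z, hz, rfl⟩
    have h4 := (hd z hz.2).2
    simp only [inCoord_coe, ofComplex_apply]
    congr 2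
    exact abs_of_pos h4
  · rintro _ ⟨z, hz, rfl⟩
    exact (hd z hz.2).differentiableAt.hasFDerivAt.hasFDerivWithinAt
  · rintro _ ⟨z, hz, rfl⟩ _ ⟨w, hw, rfl⟩ h4
    rw [inCoord_coe, inCoord_coe] at h4
    exact congrArg _ (h.injective (UpperHalfPlane.ext h4))

variable (S : ClosedSurface)

/-- The group of deck transformations. -/
def deckGroup : Subgroup (Equiv.Perm ℍ) := (MulAction.toPermHom S.Γ ℍ).range

theorem deckGroup_apply (g : S.deckGroup) : ∃ γ ∈ S.Γ, ∀ z : ℍ, g • z = γ • z := by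
  obtain ⟨g, γ, rfl⟩ := g
  exact ⟨γ, γ.2, fun z => rfl⟩

instance countable_deckGroup : Countable S.deckGroup :=
  (countable_range (MulAction.toPermHom S.Γ ℍ)).to_subtype

theorem volume_preimage_smul (γ : SL(2, ℝ)) (s : Set ℍ) :
    volume ((γ • · : ℍ → ℍ) ⁻¹' s) = volume s :=
  measure_preimage_smul (volume : Measure ℍ) (γ : GL (Fin 2) ℝ) s

instance measurableConstSMul_deckGroup : MeasurableConstSMul S.deckGroup ℍ where
  measurable_const_smul g := by
    obtain ⟨γ, _, h⟩ := S.deckGroup_apply g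
    have h1 : (g • · : ℍ → ℍ) = (γ • · : ℍ → ℍ) := funext h
    rw [h1]
    exact (continuous_smul_sl γ).measurable

instance smulInvariantMeasure_deckGroup : SMulInvariantMeasure S.deckGroup ℍ volume where
  measure_preimage_smul g s _ := by
    obtain ⟨γ, _, h⟩ := S.deckGroup_apply g
    have h1 : (g • · : ℍ → ℍ) = (γ • · : ℍ → ℍ) := funext h
    rw [h1, volume_preimage_smul]

/-- Exact measurable fundamental domains. -/
structure IsExactDomain (D : Set ℍ) : Prop where
  meas : MeasurableSet D
  cover : ∀ z : ℍ, ∃ γ ∈ S.Γ, γ • z ∈ D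
  unique : ∀ γ ∈ S.Γ, ∀ z ∈ D, γ • z ∈ D → γ • z = z

theorem isExactDomain_D : S.IsExactDomain S.D := ⟨S.D_meas, S.D_cover, S.D_unique⟩

variable {S}

theorem IsExactDomain.image {D : Set ℍ} (hD : S.IsExactDomain D) {h : ℍ ≃ₜ ℍ}
    (hh : S.IsLiftOfTrivial h) : S.IsExactDomain (h '' D) := by
  refine ⟨h.measurableEmbedding.measurableSet_image.mpr hD.meas, fun z => ?_, ?_⟩
  · obtain ⟨γ, hγ, h1⟩ := hD.cover (h.symm z)
    refine ⟨γ, hγ, γ • h.symm z, h1, ?_⟩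
    rw [hh.2 γ hγ, h.apply_symm_apply]
  · rintro γ hγ _ ⟨z, hz, rfl⟩ ⟨w, hw, hwz⟩
    rw [← hh.2 γ hγ] at hwz ⊢
    rw [h.injective hwz] at hw
    rw [hD.unique γ hγ z hz hw]

/-- Uniqueness holds for the permutation of `ℍ` and not for the matrix, since `-1` acts trivially.
This is why the deck group consists of permutations. -/
theorem IsExactDomain.isFundamentalDomain {D : Set ℍ} (hD : S.IsExactDomain D) :
    IsFundamentalDomain S.deckGroup D (volume : Measure ℍ) := by
  refine IsFundamentalDomain.mk' hD.meas.nullMeasurableSet fun z => ?_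
  obtain ⟨γ, hγ, hz⟩ := hD.cover z
  refine ⟨⟨MulAction.toPermHom S.Γ ℍ ⟨γ, hγ⟩, ⟨γ, hγ⟩, rfl⟩, hz, fun g hg => ?_⟩
  obtain ⟨g, δ, rfl⟩ := g
  have h1 : ((δ : SL(2, ℝ)) * γ⁻¹) • (γ • z) = (δ : SL(2, ℝ)) • z := by
    rw [smul_smul, inv_mul_cancel_right]
  have h2 : (δ : SL(2, ℝ)) • z ∈ D := hg
  have hmem := S.Γ.mul_mem δ.2 (S.Γ.inv_mem hγ)
  have h3 := hD.unique _ hmem _ hz (by rw [h1]; exact h2)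
  have h4 := S.free _ hmem _ h3
  refine Subtype.ext (Equiv.ext fun w => ?_)
  change (δ : SL(2, ℝ)) • w = γ • w
  have h5 := h4 (γ • w)
  rwa [smul_smul, inv_mul_cancel_right] at h5

/-- The integral of an invariant density does not depend on the fundamental domain. -/
theorem IsExactDomain.setLIntegral_eq {D D' : Set ℍ} (hD : S.IsExactDomain D)
    (hD' : S.IsExactDomain D') {φ : ℍ → ℝ≥0∞}
    (hφ : ∀ γ ∈ S.Γ, ∀ z : ℍ, φ (γ • z) = φ z * ENNReal.ofReal (‖autFactor γ z‖ ^ 4)) :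
    ∫⁻ z in D, φ z ∂lebH = ∫⁻ z in D', φ z ∂lebH := by
  have hm : Measurable fun z : ℍ => (((1 / NNReal.mk z.im z.im_pos.le : ℝ≥0) ^ 2 : ℝ≥0) : ℝ≥0∞) := by
    refine Measurable.coe_nnreal_ennreal (Measurable.pow_const (Measurable.const_div ?_ _) _)
    exact (UpperHalfPlane.continuous_im.subtype_mk _).measurable
  -- Lebesgue measure is `(Im z)²` times the invariant hyperbolic area. The product `φ (Im z)²` is
  -- then an invariant function, to which the comparison of fundamental domains applies.
  have key : ∀ A : Set ℍ, MeasurableSet A → ∫⁻ z in A, φ z ∂lebH =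
      ∫⁻ z in A, φ z * ENNReal.ofReal (z.im ^ 2) ∂(volume : Measure ℍ) := by
    intro A hA
    rw [UpperHalfPlane.volume_def, setLIntegral_withDensity_eq_setLIntegral_mul_non_measurable _ hm _
      hA (Eventually.of_forall fun z => ENNReal.coe_lt_top)]
    refine lintegral_congr fun z => ?_
    have h1 : ENNReal.ofReal (z.im ^ 2) = ((NNReal.mk z.im z.im_pos.le ^ 2 : ℝ≥0) : ℝ≥0∞) := by
      rw [ENNReal.ofReal, Real.toNNReal_pow z.im_pos.le, Real.toNNReal_of_nonneg z.im_pos.le]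
    have h0 : NNReal.mk z.im z.im_pos.le ≠ 0 := fun h => z.im_pos.ne' (congrArg NNReal.toReal h)
    simp only [Pi.mul_apply]
    rw [h1, mul_left_comm, ← ENNReal.coe_mul, ← mul_pow, one_div, inv_mul_cancel₀ h0]
    simp
  rw [key D hD.meas, key D' hD'.meas]
  refine hD.isFundamentalDomain.setLIntegral_eq hD'.isFundamentalDomain _ fun g z => ?_
  obtain ⟨γ, hγ, h⟩ := S.deckGroup_apply g
  rw [h, hφ γ hγ, im_smul_sl, mul_assoc, ← ENNReal.ofReal_mul (by positivity)]
  have := norm_pos_iff.mpr (autFactor_ne_zero γ z)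
  congr 2
  field_simp

/-! ### Linear algebra of quasiconformal maps -/

theorem _root_.Complex.det_eq_of_clm (T : ℂ →L[ℝ] ℂ) :
    T.det = (T 1).re * (T Complex.I).im - (T Complex.I).re * (T 1).im := by
  rw [ContinuousLinearMap.det, ← LinearMap.det_toMatrix Complex.basisOneI, Matrix.det_fin_two]
  simp [LinearMap.toMatrix_apply]

/-- The `ℂ`-linear part of a real linear map. -/
def linPart (T : ℂ →L[ℝ] ℂ) : ℂ := (T 1 - Complex.I * T Complex.I) / 2

/-- The conjugate linear part of a real linear map. -/
def conjPart (T : ℂ →L[ℝ] ℂ) : ℂ := (T 1 + Complex.I * T Complex.I) / 2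

theorem apply_eq_linPart_add (T : ℂ →L[ℝ] ℂ) (w : ℂ) :
    T w = linPart T * w + conjPart T * conj w := by
  rw [clm_apply_eq T w, linPart, conjPart]
  apply Complex.ext <;> simp <;> ring

theorem det_eq_normSq_sub (T : ℂ →L[ℝ] ℂ) :
    T.det = Complex.normSq (linPart T) - Complex.normSq (conjPart T) := by
  rw [Complex.det_eq_of_clm, linPart, conjPart]
  simp [Complex.normSq_apply]
  ring

/-- The two terms are parallel or opposite according to the phase of `u² A conj B`. So `u` and `u'`
are square roots of `c` and `-c`, where `c` is the unit number that makes `c A conj B` nonnegative.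
-/
theorem exists_aligned (A B : ℂ) : ∃ u u' : ℂ, ‖u‖ = 1 ∧ ‖u'‖ = 1 ∧
    ‖A * u + B * conj u‖ = ‖A‖ + ‖B‖ ∧ ‖A * u' + B * conj u'‖ = |‖A‖ - ‖B‖| := by
  obtain ⟨c, hc, hcAB⟩ : ∃ c : ℂ, ‖c‖ = 1 ∧ c * (A * conj B) = (‖A‖ * ‖B‖ : ℝ) := by
    by_cases h0 : A * conj B = 0
    · refine ⟨1, norm_one, ?_⟩
      have h1 : ‖A‖ * ‖B‖ = 0 := by
        rw [← RCLike.norm_conj B, ← norm_mul, h0, norm_zero]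
      rw [h0, h1]; simp
    · refine ⟨conj (A * conj B) / ‖A * conj B‖, ?_, ?_⟩
      · rw [norm_div, RCLike.norm_conj, Complex.norm_real, norm_norm,
          div_self (norm_ne_zero_iff.mpr h0)]
      · have h1 : (‖A * conj B‖ : ℂ) ≠ 0 := by simpa using h0
        rw [div_mul_eq_mul_div, Complex.conj_mul', div_eq_iff h1, norm_mul, RCLike.norm_conj]
        push_cast
        ring
  have key : ∀ (v : ℂ), ‖v‖ = 1 → ∀ ε : ℝ, v ^ 2 = ε * c →
      ‖A * v + B * conj v‖ ^ 2 = ‖A‖ ^ 2 + ‖B‖ ^ 2 + 2 * ε * (‖A‖ * ‖B‖) := by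
    intro v hv ε hε
    rw [← Complex.normSq_eq_norm_sq, Complex.normSq_add, map_mul (starRingEnd ℂ), Complex.conj_conj,
      Complex.normSq_mul, Complex.normSq_mul, Complex.normSq_conj]
    have h1 : A * v * (conj B * v) = ((ε * (‖A‖ * ‖B‖) : ℝ) : ℂ) := by
      have : A * v * (conj B * v) = v ^ 2 * (A * conj B) := by ring
      rw [this, hε, mul_assoc, hcAB]
      push_cast
      ring
    rw [h1, Complex.ofReal_re]
    simp only [Complex.normSq_eq_norm_sq, hv]
    ring
  have hsqrt : ∀ d : ℂ, ‖d‖ = 1 → ‖d ^ (1 / 2 : ℂ)‖ = 1 := fun d hd => by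
    have h1 := congrArg norm (cpow_half_sq d)
    rw [norm_pow, hd] at h1
    exact (pow_eq_one_iff_of_nonneg (norm_nonneg _) two_ne_zero).mp h1
  have hc' : ‖-c‖ = 1 := by rw [norm_neg, hc]
  refine ⟨c ^ (1 / 2 : ℂ), (-c) ^ (1 / 2 : ℂ), hsqrt c hc, hsqrt _ hc', ?_, ?_⟩
  · rw [← sq_eq_sq₀ (norm_nonneg _) (by positivity), key _ (hsqrt c hc) 1 (by
      rw [cpow_half_sq]; simp)]
    ring
  · rw [← sq_eq_sq₀ (norm_nonneg _) (abs_nonneg _), key _ (hsqrt _ hc') (-1) (by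
      rw [cpow_half_sq]; simp), sq_abs]
    ring

/-- The largest stretch of `T`, from the metric `|dz + b₁ dz̄|` to the metric `|dz + b₂ dz̄|`. -/
def maxStretch (b₁ b₂ : ℂ) (T : ℂ →L[ℝ] ℂ) : ℝ :=
  let A := linPart T + b₂ * conj (conjPart T)
  let B := conjPart T + b₂ * conj (linPart T)
  (‖A - B * conj b₁‖ + ‖B - A * b₁‖) / (1 - ‖b₁‖ ^ 2)

section Stretch

variable {b₁ b₂ : ℂ} {T : ℂ →L[ℝ] ℂ}

theorem one_sub_normSq_pos {b : ℂ} (hb : ‖b‖ < 1) : 0 < 1 - ‖b‖ ^ 2 := by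
  nlinarith [norm_nonneg b]

theorem maxStretch_nonneg (hb₁ : ‖b₁‖ < 1) : 0 ≤ maxStretch b₁ b₂ T :=
  div_nonneg (by positivity) (one_sub_normSq_pos hb₁).le

/-- In the coordinates `w + b dz̄`-adapted to the two metrics, the map becomes `ω ↦ x ω + y conj ω`
up to the factor `1 - ‖b₁‖²`, and both norms become the round one. -/
theorem stretch_identity (b₁ b₂ : ℂ) (T : ℂ →L[ℝ] ℂ) (w : ℂ) :
    (T w + b₂ * conj (T w)) * ((1 - ‖b₁‖ ^ 2 : ℝ) : ℂ) =
      (linPart T + b₂ * conj (conjPart T) - (conjPart T + b₂ * conj (linPart T)) * conj b₁) *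
        (w + b₁ * conj w) +
      (conjPart T + b₂ * conj (linPart T) - (linPart T + b₂ * conj (conjPart T)) * b₁) *
        conj (w + b₁ * conj w) := by
  have h1 : ((1 - ‖b₁‖ ^ 2 : ℝ) : ℂ) = 1 - b₁ * conj b₁ := by
    rw [Complex.mul_conj']
    push_cast
    ring
  rw [h1, apply_eq_linPart_add T w]
  simp only [map_add, map_mul, Complex.conj_conj]
  ring

theorem norm_le_maxStretch_mul (hb₁ : ‖b₁‖ < 1) (w : ℂ) :
    ‖T w + b₂ * conj (T w)‖ ≤ maxStretch b₁ b₂ T * ‖w + b₁ * conj w‖ := by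
  have h0 := one_sub_normSq_pos hb₁
  have h1 := congrArg norm (stretch_identity b₁ b₂ T w)
  rw [norm_mul, Complex.norm_real, Real.norm_of_nonneg h0.le] at h1
  rw [maxStretch, div_mul_eq_mul_div, le_div_iff₀ h0, h1]
  refine (norm_add_le _ _).trans ?_
  rw [norm_mul, norm_mul, RCLike.norm_conj]
  exact le_of_eq (by ring)

theorem stretch_det (b₁ b₂ : ℂ) (T : ℂ →L[ℝ] ℂ) :
    ‖linPart T + b₂ * conj (conjPart T) - (conjPart T + b₂ * conj (linPart T)) * conj b₁‖ ^ 2 -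
      ‖conjPart T + b₂ * conj (linPart T) - (linPart T + b₂ * conj (conjPart T)) * b₁‖ ^ 2 =
      T.det * (1 - ‖b₂‖ ^ 2) * (1 - ‖b₁‖ ^ 2) := by
  rw [det_eq_normSq_sub]
  simp only [← Complex.normSq_eq_norm_sq, Complex.normSq_apply, Complex.add_re, Complex.add_im,
    Complex.sub_re, Complex.sub_im, Complex.mul_re, Complex.mul_im, Complex.conj_re,
    Complex.conj_im]
  ring

/-- With `x`, `y` the norms of the two coefficients, this is `x² - y² ≤ (x + y)²`. -/
theorem det_le_maxStretch_sq (hb₁ : ‖b₁‖ < 1) :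
    T.det * (1 - ‖b₂‖ ^ 2) ≤ maxStretch b₁ b₂ T ^ 2 * (1 - ‖b₁‖ ^ 2) := by
  have h0 := one_sub_normSq_pos hb₁
  have h1 := stretch_det b₁ b₂ T
  refine le_of_mul_le_mul_right ?_ h0
  rw [← h1]
  rw [maxStretch, div_pow, mul_assoc, ← pow_two, div_mul_cancel₀ _ (pow_ne_zero 2 h0.ne')]
  refine le_of_sub_nonneg ?_
  ring_nf
  positivity

/-- The extreme stretches are proportional to `x + y` and `x - y`. The hypothesis at vectors
realizing them says `x + y ≤ K (x - y)`; multiplication by `x + y` turns the right hand side into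
`K` times the Jacobian. -/
theorem maxStretch_sq_le (hb₁ : ‖b₁‖ < 1) (hb₂ : ‖b₂‖ < 1) (hT : 0 < T.det) {K : ℝ}
    (hq : ∀ w w' : ℂ, ‖T w + b₂ * conj (T w)‖ * ‖w' + b₁ * conj w'‖ ≤
      K * (‖T w' + b₂ * conj (T w')‖ * ‖w + b₁ * conj w‖)) :
    maxStretch b₁ b₂ T ^ 2 * (1 - ‖b₁‖ ^ 2) ≤ K * (T.det * (1 - ‖b₂‖ ^ 2)) := by
  have h0 := one_sub_normSq_pos hb₁
  have h2 := one_sub_normSq_pos hb₂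
  have h1 := stretch_det b₁ b₂ T
  obtain ⟨u, u', hu, hu', hmax, hmin⟩ := exists_aligned
    (linPart T + b₂ * conj (conjPart T) - (conjPart T + b₂ * conj (linPart T)) * conj b₁)
    (conjPart T + b₂ * conj (linPart T) - (linPart T + b₂ * conj (conjPart T)) * b₁)
  -- solve `w + b₁ * conj w = u`
  have hsolve : ∀ u : ℂ, ∃ w : ℂ, w + b₁ * conj w = u := fun u => by
    refine ⟨(u - b₁ * conj u) / ((1 - ‖b₁‖ ^ 2 : ℝ) : ℂ), ?_⟩
    have h3 : ((1 - ‖b₁‖ ^ 2 : ℝ) : ℂ) ≠ 0 := by exact_mod_cast h0.ne'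
    have h4 : ((1 - ‖b₁‖ ^ 2 : ℝ) : ℂ) = 1 - b₁ * conj b₁ := by
      rw [Complex.mul_conj']
      push_cast
      ring
    rw [map_div₀, Complex.conj_ofReal, mul_div_assoc', ← add_div, div_eq_iff h3, h4]
    simp only [map_sub, map_mul, Complex.conj_conj]
    ring
  obtain ⟨w, hw⟩ := hsolve u
  obtain ⟨w', hw'⟩ := hsolve u'
  have e1 := congrArg norm (stretch_identity b₁ b₂ T w)
  have e2 := congrArg norm (stretch_identity b₁ b₂ T w')
  rw [hw, hmax, norm_mul, Complex.norm_real, Real.norm_of_nonneg h0.le] at e1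
  rw [hw', hmin, norm_mul, Complex.norm_real, Real.norm_of_nonneg h0.le] at e2
  have e3 := hq w w'
  rw [hw, hw', hu, hu', mul_one, mul_one] at e3
  rw [maxStretch]
  set x := ‖linPart T + b₂ * conj (conjPart T) -
    (conjPart T + b₂ * conj (linPart T)) * conj b₁‖
  set y := ‖conjPart T + b₂ * conj (linPart T) -
    (linPart T + b₂ * conj (conjPart T)) * b₁‖
  have hx : 0 ≤ x := norm_nonneg _
  have hy : 0 ≤ y := norm_nonneg _
  have hpos : 0 < x ^ 2 - y ^ 2 := by rw [h1]; positivity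
  have hxy : 0 < x - y := by nlinarith
  rw [abs_of_pos hxy] at e2
  have e4 : x + y ≤ K * (x - y) := by
    rw [← e1, ← e2]
    nlinarith
  rw [div_pow, div_mul_eq_mul_div, div_le_iff₀ (by positivity)]
  have e5 : (x + y) ^ 2 ≤ K * (T.det * (1 - ‖b₂‖ ^ 2) * (1 - ‖b₁‖ ^ 2)) := by
    rw [← h1]
    nlinarith
  nlinarith

end Stretch

end ClosedSurface

namespace ClosedSurface

/-! ### Quasi-invariance of extremal length -/

variable {S : ClosedSurface}

theorem CplxStr.measurable (b : S.CplxStr) : Measurable b.b := by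
  classical
  obtain ⟨E, hE, hd⟩ := b.smooth
  have hc : ContinuousOn b.b Eᶜ := by
    intro z hz
    have h1 : ContinuousAt ((fun w : ℂ => b.b (ofComplex w)) ∘ UpperHalfPlane.coe) z :=
      ContinuousAt.comp (hd z hz).continuousAt UpperHalfPlane.continuous_coe.continuousAt
    have h2 : (fun w : ℂ => b.b (ofComplex w)) ∘ UpperHalfPlane.coe = b.b := by
      funext w; simp
    rw [h2] at h1
    exact h1.continuousWithinAt
  have hm : Measurable (Eᶜ.piecewise b.b 0) :=
    hc.measurable_piecewise continuousOn_const hE.isClosed.measurableSet.compl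
  refine hm.measurable_of_countable_ne (hE.countable.mono fun z hz => ?_)
  by_contra h
  exact hz (piecewise_eq_of_mem _ _ _ h)

theorem measurable_hDeriv_apply (h : ℍ → ℍ) (w : ℂ) : Measurable fun z => hDeriv h z w :=
  (measurable_fderiv_apply_const ℝ (inCoord h) w).comp measurable_coe

theorem measurable_maxStretch (b₁ b₂ : S.CplxStr) (h : ℍ ≃ₜ ℍ) :
    Measurable fun z => maxStretch (b₁.b z) (b₂.b (h z)) (hDeriv h z) := by
  have m1 := b₁.measurable
  have m2 := b₂.measurable.comp h.measurable
  have m3 := measurable_hDeriv_apply h 1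
  have m4 := measurable_hDeriv_apply h Complex.I
  have hc : Measurable (conj : ℂ → ℂ) := Complex.continuous_conj.measurable
  have ml : Measurable fun z => linPart (hDeriv h z) := (m3.sub (m4.const_mul _)).div_const _
  have mc : Measurable fun z => conjPart (hDeriv h z) := (m3.add (m4.const_mul _)).div_const _
  have mA := ml.add (m2.mul (hc.comp mc))
  have mB := mc.add (m2.mul (hc.comp ml))
  have mA' := (mA.sub (mB.mul (hc.comp m1))).norm
  have mB' := (mB.sub (mA.mul m1)).norm
  exact (mA'.add mB').div ((m1.norm.pow_const 2).const_sub 1)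

theorem linPart_conjPart_unique {T : ℂ →L[ℝ] ℂ} {x y : ℂ} (h : ∀ w, T w = x * w + y * conj w) :
    linPart T = x ∧ conjPart T = y := by
  constructor
  · rw [linPart, h, h]
    simp only [map_one, Complex.conj_I]
    linear_combination (y / 2 - x / 2) * Complex.I_mul_I
  · rw [conjPart, h, h]
    simp only [map_one, Complex.conj_I]
    linear_combination (x / 2 - y / 2) * Complex.I_mul_I

theorem CplxStr.smul_eq (b : S.CplxStr) {γ : SL(2, ℝ)} (hγ : γ ∈ S.Γ) (z : ℍ) :
    b.b (γ • z) = b.b z * conj (autFactor γ z) ^ 2 / autFactor γ z ^ 2 := by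
  rw [eq_div_iff (pow_ne_zero 2 (autFactor_ne_zero γ z)), b.equiv γ hγ]

theorem CplxStr.norm_smul_eq (b : S.CplxStr) {γ : SL(2, ℝ)} (hγ : γ ∈ S.Γ) (z : ℍ) :
    ‖b.b (γ • z)‖ = ‖b.b z‖ := by
  have := norm_pos_iff.mpr (autFactor_ne_zero γ z)
  rw [b.smul_eq hγ, norm_div, norm_mul, norm_pow, norm_pow, RCLike.norm_conj]
  field_simp

theorem maxStretch_smul (b₁ b₂ : S.CplxStr) {h : ℍ ≃ₜ ℍ} (hh : S.IsLiftOfTrivial h)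
    {γ : SL(2, ℝ)} (hγ : γ ∈ S.Γ) (z : ℍ) :
    maxStretch (b₁.b (γ • z)) (b₂.b (h (γ • z))) (hDeriv h (γ • z)) * ‖autFactor γ (h z)‖ ^ 2 =
      ‖autFactor γ z‖ ^ 2 * maxStretch (b₁.b z) (b₂.b (h z)) (hDeriv h z) := by
  set a := autFactor γ z with ha
  set a' := autFactor γ (h z) with ha'
  have ha0 : a ≠ 0 := autFactor_ne_zero γ z
  have ha0' : a' ≠ 0 := autFactor_ne_zero γ (h z)
  have hca : conj a ≠ 0 := by simpa using ha0
  have hca' : conj a' ≠ 0 := by simpa using ha0'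
  obtain ⟨e1, e2⟩ := linPart_conjPart_unique (T := hDeriv h (γ • z))
    (x := (a' ^ 2)⁻¹ * linPart (hDeriv h z) * a ^ 2)
    (y := (a' ^ 2)⁻¹ * conjPart (hDeriv h z) * conj a ^ 2) fun w => by
      rw [hDeriv_equivariant (hh.2 γ hγ), apply_eq_linPart_add (hDeriv h z)]
      simp only [map_mul, map_pow]
      ring
  rw [maxStretch, maxStretch, e1, e2, b₁.norm_smul_eq hγ, hh.2 γ hγ, b₁.smul_eq hγ, b₂.smul_eq hγ,
    ← ha, ← ha']
  set α := linPart (hDeriv h z)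
  set β := conjPart (hDeriv h z)
  have hA : (a' ^ 2)⁻¹ * α * a ^ 2 + b₂.b (h z) * conj a' ^ 2 / a' ^ 2 *
      conj ((a' ^ 2)⁻¹ * β * conj a ^ 2) = a ^ 2 / a' ^ 2 * (α + b₂.b (h z) * conj β) := by
    simp only [map_mul, map_pow, map_inv₀, Complex.conj_conj]
    field_simp
  have hB : (a' ^ 2)⁻¹ * β * conj a ^ 2 + b₂.b (h z) * conj a' ^ 2 / a' ^ 2 *
      conj ((a' ^ 2)⁻¹ * α * a ^ 2) = conj a ^ 2 / a' ^ 2 * (β + b₂.b (h z) * conj α) := by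
    simp only [map_mul, map_pow, map_inv₀]
    field_simp
  simp only [hA, hB]
  set A := α + b₂.b (h z) * conj β
  set B := β + b₂.b (h z) * conj α
  have h1 : a ^ 2 / a' ^ 2 * A - conj a ^ 2 / a' ^ 2 * B * conj (b₁.b z * conj a ^ 2 / a ^ 2) =
      a ^ 2 / a' ^ 2 * (A - B * conj (b₁.b z)) := by
    simp only [map_mul, map_pow, map_div₀, Complex.conj_conj]
    field_simp
  have h2 : conj a ^ 2 / a' ^ 2 * B - a ^ 2 / a' ^ 2 * A * (b₁.b z * conj a ^ 2 / a ^ 2) =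
      conj a ^ 2 / a' ^ 2 * (B - A * b₁.b z) := by
    field_simp
  rw [h1, h2, norm_mul, norm_mul, norm_div, norm_div, norm_pow, norm_pow, norm_pow,
    RCLike.norm_conj]
  have := norm_pos_iff.mpr ha0'
  field_simp

theorem norm_leaf_eq (b s : ℂ) :
    ‖conj s - b * s‖ = ‖Complex.I * conj s + b * conj (Complex.I * conj s)‖ := by
  have h1 : Complex.I * conj s + b * conj (Complex.I * conj s) = Complex.I * (conj s - b * s) := by
    simp only [map_mul, Complex.conj_I, Complex.conj_conj]
    ring
  rw [h1, norm_mul, Complex.norm_I, one_mul]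

theorem norm_leaf_congr {s s' : ℂ} (b : ℂ) (h : s ^ 2 = s' ^ 2) :
    ‖conj s - b * s‖ = ‖conj s' - b * s'‖ := by
  rcases sq_eq_sq_iff_eq_or_eq_neg.mp h with h | h
  · rw [h]
  · rw [h, ← norm_neg]
    congr 1
    simp only [map_neg]
    ring

/-- Let `σ` be the root of `Q` with `Re (s T w) = Re (σ w)`. Then `T` carries the leaf vector `i
conj σ` to `det T` times the leaf vector `i conj s`. So the left hand side is the length of the
image of a leaf vector, which is at most the largest stretch times its length. -/
theorem det_mul_leaf_le {b₁ b₂ : ℂ} (hb₁ : ‖b₁‖ < 1) {T : ℂ →L[ℝ] ℂ} (hT : 0 < T.det) {Q Q' : ℂ}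
    (h : ∀ w, transverse Q' (T w) = transverse Q w) :
    T.det * ‖conj (Q' ^ (1 / 2 : ℂ)) - b₂ * Q' ^ (1 / 2 : ℂ)‖ ≤
      maxStretch b₁ b₂ T * ‖conj (Q ^ (1 / 2 : ℂ)) - b₁ * Q ^ (1 / 2 : ℂ)‖ := by
  set s := Q' ^ (1 / 2 : ℂ) with hs
  set σ := s * linPart T + conj (s * conjPart T) with hσ
  have h1 : ∀ w, (s * T w).re = (σ * w).re := fun w => by
    rw [apply_eq_linPart_add T w, hσ]
    simp only [map_mul, Complex.mul_re, Complex.mul_im, Complex.add_re, Complex.add_im,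
      Complex.conj_re, Complex.conj_im]
    ring
  have h2 : σ ^ 2 = Q := eq_of_transverse_eq fun w => by
    rw [← h, transverse_sq, ← h1]
    rfl
  have h3 : σ ^ 2 = (Q ^ (1 / 2 : ℂ)) ^ 2 := by rw [h2, cpow_half_sq]
  rw [← norm_leaf_congr b₁ h3, norm_leaf_eq, norm_leaf_eq]
  refine le_trans (le_of_eq ?_) (norm_le_maxStretch_mul hb₁ _)
  have h4 : T (Complex.I * conj σ) = (T.det : ℂ) * (Complex.I * conj s) := by
    rw [det_eq_normSq_sub, apply_eq_linPart_add T, hσ]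
    push_cast
    rw [Complex.normSq_eq_conj_mul_self, Complex.normSq_eq_conj_mul_self]
    simp only [map_add, map_mul, Complex.conj_conj, Complex.conj_I]
    ring
  have h5 : (T.det : ℂ) * (Complex.I * conj s) + b₂ * conj ((T.det : ℂ) * (Complex.I * conj s)) =
      (T.det : ℂ) * (Complex.I * conj s + b₂ * conj (Complex.I * conj s)) := by
    rw [map_mul, Complex.conj_ofReal]; ring
  rw [h4, h5, norm_mul (T.det : ℂ), Complex.norm_real, Real.norm_of_nonneg hT.le]

/-- Admissible conformal factors. -/
def IsInvariantFactor (S : ClosedSurface) (ρ : ℍ → ℝ≥0) : Prop :=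
  ∀ γ ∈ S.Γ, ∀ z : ℍ, (ρ (γ • z) : ℝ) = ρ z * ‖autFactor γ z‖ ^ 2

theorem IsInvariantFactor.leaf {ρ : ℍ → ℝ≥0} (hρ : S.IsInvariantFactor ρ) (b : S.CplxStr)
    {Q : ℍ → ℂ} (hQ : S.IsMeasuredFoliation Q) : ∀ γ ∈ S.Γ, ∀ z : ℍ,
    ENNReal.ofReal (ρ (γ • z) * ‖conj (Q (γ • z) ^ (1 / 2 : ℂ)) -
      b.b (γ • z) * Q (γ • z) ^ (1 / 2 : ℂ)‖) =
    ENNReal.ofReal (ρ z * ‖conj (Q z ^ (1 / 2 : ℂ)) - b.b z * Q z ^ (1 / 2 : ℂ)‖) *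
      ENNReal.ofReal (‖autFactor γ z‖ ^ 4) := by
  intro γ hγ z
  rw [← ENNReal.ofReal_mul (by positivity), hρ γ hγ]
  congr 1
  have ha := autFactor_ne_zero γ z
  have h1 : (Q (γ • z) ^ (1 / 2 : ℂ)) ^ 2 = (autFactor γ z ^ 2 * Q z ^ (1 / 2 : ℂ)) ^ 2 := by
    rw [cpow_half_sq, mul_pow, cpow_half_sq, hQ.1 γ hγ]; ring
  rw [norm_leaf_congr _ h1, b.smul_eq hγ]
  have h2 : conj (autFactor γ z ^ 2 * Q z ^ (1 / 2 : ℂ)) -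
      b.b z * conj (autFactor γ z) ^ 2 / autFactor γ z ^ 2 *
        (autFactor γ z ^ 2 * Q z ^ (1 / 2 : ℂ)) =
      conj (autFactor γ z) ^ 2 * (conj (Q z ^ (1 / 2 : ℂ)) - b.b z * Q z ^ (1 / 2 : ℂ)) := by
    rw [map_mul, map_pow]
    field_simp
  rw [h2, norm_mul, norm_pow, RCLike.norm_conj]
  ring

theorem IsInvariantFactor.area {ρ : ℍ → ℝ≥0} (hρ : S.IsInvariantFactor ρ) (b : S.CplxStr) :
    ∀ γ ∈ S.Γ, ∀ z : ℍ,
    ENNReal.ofReal ((ρ (γ • z) : ℝ) ^ 2 * (1 - ‖b.b (γ • z)‖ ^ 2)) =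
    ENNReal.ofReal ((ρ z : ℝ) ^ 2 * (1 - ‖b.b z‖ ^ 2)) *
      ENNReal.ofReal (‖autFactor γ z‖ ^ 4) := by
  intro γ hγ z
  rw [← ENNReal.ofReal_mul (mul_nonneg (sq_nonneg _) (one_sub_normSq_pos (b.norm_lt_one z)).le),
    hρ γ hγ, b.norm_smul_eq hγ]
  congr 1
  ring

/-- The conformal factor for `b₁` obtained by pulling back `ρ` with the largest stretch. -/
def pullFactor (b₁ b₂ : S.CplxStr) (h : ℍ ≃ₜ ℍ) (ρ : ℍ → ℝ≥0) (z : ℍ) : ℝ≥0 :=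
  ρ (h z) * (maxStretch (b₁.b z) (b₂.b (h z)) (hDeriv h z)).toNNReal

theorem coe_pullFactor (b₁ b₂ : S.CplxStr) (h : ℍ ≃ₜ ℍ) (ρ : ℍ → ℝ≥0) (z : ℍ) :
    (pullFactor b₁ b₂ h ρ z : ℝ) = ρ (h z) * maxStretch (b₁.b z) (b₂.b (h z)) (hDeriv h z) := by
  rw [pullFactor, NNReal.coe_mul, Real.coe_toNNReal _ (maxStretch_nonneg (b₁.norm_lt_one z))]

theorem isInvariantFactor_pullFactor (b₁ b₂ : S.CplxStr) {h : ℍ ≃ₜ ℍ} (hh : S.IsLiftOfTrivial h)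
    {ρ : ℍ → ℝ≥0} (hρ : S.IsInvariantFactor ρ) :
    S.IsInvariantFactor (pullFactor b₁ b₂ h ρ) := by
  intro γ hγ z
  rw [coe_pullFactor, coe_pullFactor]
  have h1 := maxStretch_smul b₁ b₂ hh hγ z
  have h2 := hρ γ hγ (h z)
  rw [← hh.2 γ hγ] at h2
  rw [h2, mul_assoc, mul_comm (‖autFactor γ (h z)‖ ^ 2), h1]
  ring

theorem foliationLength_pull_le (b₁ b₂ : S.CplxStr) {h : ℍ ≃ₜ ℍ} (hh : S.IsLiftOfTrivial h)
    {ρ : ℍ → ℝ≥0} (hρ : S.IsInvariantFactor ρ) {Q : ℍ → ℂ} (hQ : S.IsMeasuredFoliation Q) :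
    S.foliationLength b₂ ρ (pullQD h.symm Q) ≤
      S.foliationLength b₁ (pullFactor b₁ b₂ h ρ) Q := by
  have hQ' := isMeasuredFoliation_pullQD hh.symm hQ
  obtain ⟨E, hE, hd⟩ := IsPiecewiseDiffeo.exists_diffeoAt hh.1
  -- The image of the fundamental domain under `h` is again one; integrating over it makes the
  -- change of variables land on `S.D`.
  rw [foliationLength, S.isExactDomain_D.setLIntegral_eq (S.isExactDomain_D.image hh)
    (hρ.leaf b₂ hQ'), setLIntegral_image_lebH hh.1 S.D_meas, foliationLength]
  refine lintegral_mono_ae (ae_restrict_of_ae ?_)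
  filter_upwards [ae_lebH_of_locFinite hE] with z hz
  have hdz := hd z hz
  rw [← ENNReal.ofReal_mul hdz.2.le, coe_pullFactor]
  refine ENNReal.ofReal_le_ofReal ?_
  have h1 := det_mul_leaf_le (b₂ := b₂.b (h z)) (b₁.norm_lt_one z) hdz.2 (Q := Q z)
    (Q' := pullQD h.symm Q (h z)) fun w => by
      rw [transverse_pullQD, h.symm_apply_apply, hdz.hDeriv_symm_apply]
  have h2 := mul_le_mul_of_nonneg_left h1 (ρ (h z)).2
  rw [mul_left_comm, mul_assoc]
  exact h2

/-- This is where quasiconformality enters: the square of the largest stretch is at most `K` times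
the Jacobian. -/
theorem metricArea_pull_le {b₁ b₂ : S.CplxStr} {h : ℍ ≃ₜ ℍ} (hh : S.IsLiftOfTrivial h) {K : ℝ}
    (hK : 0 ≤ K) (hq : S.IsQC b₁ b₂ K h) {ρ : ℍ → ℝ≥0} (hρ : S.IsInvariantFactor ρ) :
    S.metricArea b₁ (pullFactor b₁ b₂ h ρ) ≤ ENNReal.ofReal K * S.metricArea b₂ ρ := by
  obtain ⟨E, hE, hd⟩ := IsPiecewiseDiffeo.exists_diffeoAt hh.1
  obtain ⟨F, hF, hq⟩ := isQC_iff.mp hq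
  have he := S.isExactDomain_D.setLIntegral_eq (S.isExactDomain_D.image hh)
    (φ := fun z => ENNReal.ofReal ((ρ z : ℝ) ^ 2 * (1 - ‖b₂.b z‖ ^ 2))) (hρ.area b₂)
  rw [metricArea, metricArea, he, setLIntegral_image_lebH hh.1 S.D_meas,
    ← lintegral_const_mul' _ _ ENNReal.ofReal_ne_top]
  refine lintegral_mono_ae (ae_restrict_of_ae ?_)
  filter_upwards [ae_lebH_of_locFinite hE, ae_lebH_of_locFinite hF] with z hz hz'
  have hdz := hd z hz
  rw [← ENNReal.ofReal_mul hdz.2.le, ← ENNReal.ofReal_mul hK, coe_pullFactor]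
  refine ENNReal.ofReal_le_ofReal ?_
  have h1 := maxStretch_sq_le (b₁.norm_lt_one z) (b₂.norm_lt_one (h z)) hdz.2 (hq z hz')
  have h2 := mul_le_mul_of_nonneg_left h1 (sq_nonneg (ρ (h z) : ℝ))
  calc _ = _ := by ring
    _ ≤ _ := h2
    _ = _ := by ring

/-- Needed to know that the pulled back metric has positive area and so is admissible in the
supremum defining extremal length. -/
theorem le_metricArea_pull (b₁ b₂ : S.CplxStr) {h : ℍ ≃ₜ ℍ} (hh : S.IsLiftOfTrivial h)
    {ρ : ℍ → ℝ≥0} (hρ : S.IsInvariantFactor ρ) :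
    S.metricArea b₂ ρ ≤ S.metricArea b₁ (pullFactor b₁ b₂ h ρ) := by
  obtain ⟨E, hE, hd⟩ := IsPiecewiseDiffeo.exists_diffeoAt hh.1
  rw [metricArea, metricArea, S.isExactDomain_D.setLIntegral_eq (S.isExactDomain_D.image hh)
    (hρ.area b₂), setLIntegral_image_lebH hh.1 S.D_meas]
  refine lintegral_mono_ae (ae_restrict_of_ae ?_)
  filter_upwards [ae_lebH_of_locFinite hE] with z hz
  have hdz := hd z hz
  rw [← ENNReal.ofReal_mul hdz.2.le, coe_pullFactor]
  refine ENNReal.ofReal_le_ofReal ?_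
  have h1 := det_le_maxStretch_sq (b₂ := b₂.b (h z)) (T := hDeriv h z) (b₁.norm_lt_one z)
  have h2 := mul_le_mul_of_nonneg_left h1 (sq_nonneg (ρ (h z) : ℝ))
  calc _ = _ := by ring
    _ ≤ _ := h2
    _ = _ := by ring

/-- Extremal length changes at most by the factor `K` under `K`-quasiconformal maps. -/
theorem QCRel.extStr_le {K : ℝ} (hK : 1 ≤ K) {b₁ b₂ : S.CplxStr} (h : QCRel K b₁ b₂)
    (ξ : S.Curve → ℝ) : S.extStr b₂ ξ ≤ ENNReal.ofReal K * S.extStr b₁ ξ := by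
  obtain ⟨h, hh, hq⟩ := h
  refine iSup_le fun ρ => iSup_le fun hρm => iSup_le fun hρ => iSup_le fun h0 =>
    iSup_le fun hfin => ?_
  have hK0 : 0 ≤ K := zero_le_one.trans hK
  have hle := metricArea_pull_le hh hK0 hq hρ
  have hpos := h0.trans_le (le_metricArea_pull b₁ b₂ hh hρ)
  have hm : Measurable (pullFactor b₁ b₂ h ρ) :=
    (hρm.comp h.measurable).mul (measurable_maxStretch b₁ b₂ h).real_toNNReal
  -- Each foliation in the class competes through its transport by `h`, which stays in the class
  -- because `h` is homotopic to the identity.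
  have hlen : (⨅ (Q : ℍ → ℂ) (_ : S.IsMeasuredFoliation Q) (_ : S.height Q = ξ),
      S.foliationLength b₂ ρ Q) ≤ ⨅ (Q : ℍ → ℂ) (_ : S.IsMeasuredFoliation Q)
      (_ : S.height Q = ξ), S.foliationLength b₁ (pullFactor b₁ b₂ h ρ) Q := by
    refine le_iInf fun Q => le_iInf fun hQ => le_iInf fun hξ => ?_
    refine le_trans ?_ (foliationLength_pull_le b₁ b₂ hh hρ hQ)
    exact iInf_le_of_le (pullQD h.symm Q) <| iInf_le_of_le
      (isMeasuredFoliation_pullQD hh.symm hQ) <| iInf_le_of_le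
      ((height_pullQD hh.symm Q).trans hξ) le_rfl
  have hext : (⨅ (Q : ℍ → ℂ) (_ : S.IsMeasuredFoliation Q) (_ : S.height Q = ξ),
      S.foliationLength b₁ (pullFactor b₁ b₂ h ρ) Q) ^ 2 /
        S.metricArea b₁ (pullFactor b₁ b₂ h ρ) ≤ S.extStr b₁ ξ :=
    le_iSup_of_le _ <| le_iSup_of_le hm <| le_iSup_of_le
      (isInvariantFactor_pullFactor b₁ b₂ hh hρ) <| le_iSup_of_le hpos <| le_iSup_of_le
      (hle.trans_lt (ENNReal.mul_lt_top ENNReal.ofReal_lt_top hfin)) le_rfl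
  refine le_trans ?_ (mul_le_mul_right hext (ENNReal.ofReal K))
  have hKpos : ENNReal.ofReal K ≠ 0 := (ENNReal.ofReal_pos.mpr (by linarith)).ne'
  have hinv : (S.metricArea b₂ ρ)⁻¹ ≤
      ENNReal.ofReal K * (S.metricArea b₁ (pullFactor b₁ b₂ h ρ))⁻¹ := by
    have h1 := ENNReal.inv_le_inv.mpr hle
    rw [ENNReal.mul_inv (Or.inl hKpos) (Or.inl ENNReal.ofReal_ne_top)] at h1
    calc (S.metricArea b₂ ρ)⁻¹
        = ENNReal.ofReal K * ((ENNReal.ofReal K)⁻¹ * (S.metricArea b₂ ρ)⁻¹) := by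
          rw [← mul_assoc, ENNReal.mul_inv_cancel hKpos ENNReal.ofReal_ne_top, one_mul]
      _ ≤ _ := by gcongr
  rw [div_eq_mul_inv, div_eq_mul_inv, mul_left_comm]
  gcongr

/-- Representatives of one point are related by 1-quasiconformal maps, so the infimum is over equal
numbers. -/
theorem extLength_mkTeich (b : S.CplxStr) (ξ : S.Curve → ℝ) :
    S.extLength (S.mkTeich b) ξ = S.extStr b ξ := by
  unfold extLength
  refine le_antisymm (iInf₂_le_of_le b rfl le_rfl) (le_iInf₂ fun b' hb' => ?_)
  simpa using (qcRel_one_of_mkTeich_eq hb').extStr_le le_rfl ξ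

end ClosedSurface

/-! ### Natural coordinates of holomorphic quadratic differentials -/

theorem AnalyticAt.exists_root {f : ℂ → ℂ} {p : ℂ} (hf : AnalyticAt ℂ f p) (h0 : f p ≠ 0) {N : ℕ}
    (hN : N ≠ 0) : ∃ r : ℂ → ℂ, AnalyticAt ℂ r p ∧ ∀ᶠ z in 𝓝 p, r z ^ N = f z := by
  have h1 : AnalyticAt ℂ (fun z => f z / f p) p := hf.fun_div analyticAt_const h0
  have h2 : f p / f p ∈ Complex.slitPlane := by
    rw [div_self h0]; exact Complex.one_mem_slitPlane
  refine ⟨fun z => f p ^ ((N : ℂ)⁻¹) * Complex.exp (Complex.log (f z / f p) / N),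
    analyticAt_const.fun_mul ((h1.clog h2).fun_div analyticAt_const (by exact_mod_cast hN)).cexp, ?_⟩
  filter_upwards [hf.continuousAt.eventually_ne h0] with z hz
  rw [mul_pow, Complex.cpow_nat_inv_pow _ hN, ← Complex.exp_nat_mul, mul_div_cancel₀,
    Complex.exp_log (div_ne_zero hz h0), mul_div_cancel₀ _ h0]
  exact_mod_cast hN

/-- The coefficients of `s` are divided by `m + n`. The equation says that `(z - p)^m G` is a
primitive of `(z - p)^{m-1} s`, without mentioning fractional powers. -/
theorem AnalyticAt.exists_euler_solution {s : ℂ → ℂ} {p : ℂ} (hs : AnalyticAt ℂ s p) {m : ℝ}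
    (hm : 1 ≤ m) : ∃ G : ℂ → ℂ, AnalyticAt ℂ G p ∧
      ∀ᶠ z in 𝓝 p, m * G z + (z - p) * deriv G z = s z := by
  obtain ⟨P, hP⟩ := hs
  rw [hasFPowerSeriesAt_iff] at hP
  obtain ⟨ε, hε, hball⟩ := Metric.eventually_nhds_iff.mp hP
  set a := P.coeff with ha
  set R := ε / 2 with hR
  have hR0 : 0 < R := by positivity
  have hsum : Summable fun n => ‖(R : ℂ) ^ n • a n‖ := by
    refine (hball (y := (R : ℂ)) ?_).summable.norm
    rw [dist_zero_right, Complex.norm_real, Real.norm_of_nonneg hR0.le]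
    linarith
  have hmn : ∀ n : ℕ, (m : ℂ) + n ≠ 0 := fun n => by
    have : (0 : ℝ) < m + n := by positivity
    exact_mod_cast this.ne'
  have hmn' : ∀ n : ℕ, ‖(m : ℂ) + n‖ = m + n := fun n => by
    have : (0 : ℝ) ≤ m + n := by positivity
    rw [← Real.norm_of_nonneg this, ← Complex.norm_real]
    push_cast
    rfl
  set g : ℕ → ℂ → ℂ := fun n z => z ^ n * (a n / (m + n)) with hg
  set g' : ℕ → ℂ → ℂ := fun n z => (n * z ^ (n - 1)) * (a n / (m + n)) with hg'
  have hd : ∀ n : ℕ, ∀ y ∈ Metric.ball (0 : ℂ) R, HasDerivAt (g n) (g' n y) y := fun n y _ =>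
    (hasDerivAt_pow n y).mul_const _
  -- Since `n / (m + n) ≤ 1`, the differentiated series is dominated by the one of `s` at radius
  -- `R`.
  have hbd : ∀ n : ℕ, ∀ y ∈ Metric.ball (0 : ℂ) R, ‖g' n y‖ ≤ ‖(R : ℂ) ^ n • a n‖ / R := by
    intro n y hy
    rw [mem_ball_zero_iff] at hy
    rcases n with _ | n
    · simp only [hg', Nat.cast_zero, zero_mul, norm_zero]
      positivity
    · simp only [hg', add_tsub_cancel_right, norm_mul, norm_div, norm_pow, smul_eq_mul, hmn',
        Complex.norm_real, Real.norm_of_nonneg hR0.le, Complex.norm_natCast]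
      rw [pow_succ, show R ^ n * R * ‖a (n + 1)‖ / R = R ^ n * ‖a (n + 1)‖ by field_simp]
      have h1 : (0 : ℝ) < m + ((n + 1 : ℕ) : ℝ) := by positivity
      have h2 : ((n + 1 : ℕ) : ℝ) * (‖a (n + 1)‖ / (m + ((n + 1 : ℕ) : ℝ))) ≤ ‖a (n + 1)‖ := by
        rw [mul_div_assoc', div_le_iff₀ h1, mul_comm]
        gcongr
        linarith
      calc _ = ‖y‖ ^ n * (((n + 1 : ℕ) : ℝ) * (‖a (n + 1)‖ / (m + ((n + 1 : ℕ) : ℝ)))) := by ring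
        _ ≤ R ^ n * ‖a (n + 1)‖ := by gcongr
  have h0 : (0 : ℂ) ∈ Metric.ball (0 : ℂ) R := Metric.mem_ball_self hR0
  have hs0 : Summable fun n => g n 0 := by
    refine summable_of_ne_finset_zero (s := {0}) fun n hn => ?_
    rw [Finset.mem_singleton] at hn
    simp [hg, hn]
  have hder : ∀ y ∈ Metric.ball (0 : ℂ) R,
      HasDerivAt (fun z => ∑' n, g n z) (∑' n, g' n y) y := fun y hy =>
    hasDerivAt_tsum_of_isPreconnected (hsum.div_const R) Metric.isOpen_ball
      (convex_ball 0 R).isPreconnected hd hbd h0 hs0 hy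
  have hder' : ∀ z ∈ Metric.ball p R,
      HasDerivAt (fun z => ∑' n, g n (z - p)) (∑' n, g' n (z - p)) z := fun z hz => by
    have := hder (z - p) (by simpa [dist_eq_norm] using hz)
    exact this.comp_sub_const z p
  refine ⟨fun z => ∑' n, g n (z - p), ?_, ?_⟩
  · have : DifferentiableOn ℂ (fun z => ∑' n, g n (z - p)) (Metric.ball p R) := fun z hz =>
      (hder' z hz).differentiableAt.differentiableWithinAt
    exact this.analyticAt (Metric.ball_mem_nhds p hR0)
  · filter_upwards [Metric.ball_mem_nhds p hR0] with z hz
    rw [(hder' z hz).deriv]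
    have hz' : z - p ∈ Metric.ball (0 : ℂ) R := by simpa [dist_eq_norm] using hz
    have hS := hball (y := z - p) (by
      rw [mem_ball_zero_iff] at hz'; rw [dist_zero_right]; linarith)
    rw [add_sub_cancel] at hS
    have hg's : Summable fun n => g' n (z - p) :=
      Summable.of_norm_bounded (hsum.div_const R) fun n => hbd n _ hz'
    have hgs : Summable fun n => g n (z - p) := by
      refine Summable.of_norm_bounded hsum fun n => ?_
      rw [mem_ball_zero_iff] at hz'
      simp only [hg, norm_mul, norm_div, norm_pow, smul_eq_mul, hmn',
        Complex.norm_real, Real.norm_of_nonneg hR0.le]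
      have h1 : (1 : ℝ) ≤ m + n := by
        have : (0 : ℝ) ≤ n := by positivity
        linarith
      gcongr
      exact div_le_self (norm_nonneg _) h1
    rw [← hS.tsum_eq, ← tsum_mul_left, ← tsum_mul_left, ← (hgs.mul_left _).tsum_add
      (hg's.mul_left _)]
    congr 1
    funext n
    simp only [hg, hg', smul_eq_mul]
    have := hmn n
    rcases n with _ | n
    · simp only [Nat.cast_zero, add_zero, pow_zero] at this ⊢
      field_simp
      simp [mul_comm]
    · simp only [add_tsub_cancel_right]
      field_simp
      ring

/-- Near a zero of order `n`, a holomorphic quadratic differential is `ζⁿ dζ²`. -/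
theorem AnalyticAt.exists_natural_coordinate {q : ℂ → ℂ} {p : ℂ} (hq : AnalyticAt ℂ q p)
    (h0 : ¬∀ᶠ z in 𝓝 p, q z = 0) : ∃ (n : ℕ) (ψ : ℂ → ℂ), AnalyticAt ℂ ψ p ∧ ψ p = 0 ∧
      deriv ψ p ≠ 0 ∧ ∀ᶠ z in 𝓝 p, ψ z ^ n * deriv ψ z ^ 2 = q z := by
  obtain ⟨n, g, hg, hg0, hqg⟩ := hq.exists_eventuallyEq_pow_smul_nonzero_iff.mpr h0
  obtain ⟨s, hs, hsg⟩ := hg.exists_root hg0 two_ne_zero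
  have hs0 : s p ≠ 0 := fun h => hg0 (by rw [← hsg.self_of_nhds, h]; simp)
  -- Formally `ζ^m / m` is a primitive of `√q = (z - p)^{n/2} s`, that is `(z - p)^m G`. Hence `ζ =
  -- (z - p) (m G)^{1/m}`, where the last factor is an `(n+2)`-nd root of `(m G)²` and so analytic
  -- also for odd `n`.
  set m : ℝ := n / 2 + 1 with hm
  have hm1 : 1 ≤ m := by
    have : (0 : ℝ) ≤ n := by positivity
    rw [hm]; linarith
  obtain ⟨G, hG, hGs⟩ := hs.exists_euler_solution hm1
  have hm0 : (m : ℂ) ≠ 0 := by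
    have : m ≠ 0 := by linarith
    exact_mod_cast this
  set k : ℂ → ℂ := fun z => m * G z with hk
  have hka : AnalyticAt ℂ k p := analyticAt_const.fun_mul hG
  have hk0 : k p ≠ 0 := by
    have := hGs.self_of_nhds
    rw [sub_self, zero_mul, add_zero] at this
    rw [hk]
    simpa [this] using hs0
  obtain ⟨r, hr, hrk⟩ := (hka.fun_pow 2).exists_root (pow_ne_zero 2 hk0) (N := n + 2) (by omega)
  have hr0 : r p ≠ 0 := fun h => pow_ne_zero 2 hk0 (by rw [← hrk.self_of_nhds, h]; simp)
  have hψ : ∀ z, AnalyticAt ℂ r z →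
      HasDerivAt (fun z => (z - p) * r z) (r z + (z - p) * deriv r z) z := by
    intro z hz
    have := ((hasDerivAt_id' z).sub_const p).fun_mul hz.differentiableAt.hasDerivAt
    simpa using this
  refine ⟨n, fun z => (z - p) * r z,
    (analyticAt_id.fun_sub analyticAt_const).fun_mul hr, by simp, ?_, ?_⟩
  · rw [(hψ p hr).deriv]; simpa using hr0
  · filter_upwards [hqg, hsg, hGs, hrk.eventually_nhds, hr.eventually_analyticAt,
      hka.eventually_analyticAt, hG.eventually_analyticAt, hka.continuousAt.eventually_ne hk0]
      with z h1 h2 h3 h4 h5 h6 h7 h8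
    rw [(hψ z h5).deriv, h1, ← h2, ← h3]
    have h4' := h4.self_of_nhds
    have hdk : deriv k z = m * deriv G z := deriv_const_mul _ h7.differentiableAt
    have hdr : ((n : ℂ) + 2) * r z ^ (n + 1) * deriv r z = 2 * k z * (m * deriv G z) := by
      have e1 : HasDerivAt (fun z => r z ^ (n + 2))
          (((n + 2 : ℕ) : ℂ) * r z ^ (n + 1) * deriv r z) z :=
        h5.differentiableAt.hasDerivAt.fun_pow (n + 2)
      have e2 : HasDerivAt (fun z => k z ^ 2) (((2 : ℕ) : ℂ) * k z ^ (2 - 1) * deriv k z) z :=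
        h6.differentiableAt.hasDerivAt.fun_pow 2
      have e3 := (e1.congr_of_eventuallyEq (h4.mono fun _ h => h.symm)).unique e2
      rw [hdk] at e3
      push_cast at e3
      simpa using e3
    have hmn : ((n : ℂ) + 2) = 2 * m := by rw [hm]; push_cast; ring
    rw [hmn] at hdr
    have hdr' : r z ^ (n + 1) * deriv r z = k z * deriv G z := by
      have : (2 * (m : ℂ)) ≠ 0 := mul_ne_zero two_ne_zero hm0
      apply mul_left_cancel₀ this
      linear_combination hdr
    have hkz : k z = m * G z := rfl
    have key : ((r z) ^ n * (r z + (z - p) * deriv r z) ^ 2) * k z ^ 2 =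
        (k z + (z - p) * deriv G z) ^ 2 * k z ^ 2 := by
      calc _ = (r z ^ n * (r z + (z - p) * deriv r z) ^ 2) * r z ^ (n + 2) := by rw [h4']
        _ = (r z ^ (n + 2) + (z - p) * (r z ^ (n + 1) * deriv r z)) ^ 2 := by ring
        _ = (k z ^ 2 + (z - p) * (k z * deriv G z)) ^ 2 := by rw [h4', hdr']
        _ = _ := by ring
    have key' := mul_right_cancel₀ (pow_ne_zero 2 h8) key
    rw [← hkz, smul_eq_mul, ← key', mul_pow]
    ring

namespace ClosedSurface

variable {S : ClosedSurface}

theorem UnitQD.isMeasuredFoliation (q : S.UnitQD) : S.IsMeasuredFoliation q.1 := by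
  refine ⟨q.2.2.1, fun p => ?_⟩
  have hne : ¬∀ᶠ z in 𝓝 (p : ℂ), q.1 (ofComplex z) = 0 := by
    intro h
    have h1 : ∀ᶠ z : ℍ in 𝓝 p, q.1 z = 0 := by
      have := UpperHalfPlane.continuous_coe.continuousAt.eventually h
      simpa using this
    obtain ⟨V, hV, hVo, hpV⟩ := eventually_nhds_iff.mp
      (h1.and ((UnitQD.isLocFinite_zeros S q).eventually_notMem p))
    have hVo' : IsOpen (UpperHalfPlane.coe '' V) := isOpenEmbedding_coe.isOpenMap V hVo
    have h2 : (UpperHalfPlane.coe '' V) ∈ 𝓝[≠] (p : ℂ) :=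
      nhdsWithin_le_nhds (hVo'.mem_nhds (mem_image_of_mem _ hpV))
    obtain ⟨w, ⟨z, hz, rfl⟩, hwp⟩ := (NormedField.nhdsNE_neBot (p : ℂ)).nonempty_of_mem
      (inter_mem h2 self_mem_nhdsWithin)
    exact (hV z hz).2 (fun h => hwp (by rw [h]; rfl)) (hV z hz).1
  obtain ⟨n, ψ, hψ, hψ0, hψ', heq⟩ := (UnitQD.analyticAt S q p).exists_natural_coordinate hne
  have hst := hψ.hasStrictDerivAt.hasStrictFDerivAt_equiv hψ'
  obtain ⟨V, hV, hVo, hpV⟩ := eventually_nhds_iff.mp (heq.and (hψ.eventually_analyticAt.and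
    ((hψ.deriv.continuousAt.eventually_ne hψ').and (upperHalf_mem_nhds p))))
  refine ⟨(hst.toOpenPartialHomeomorph ψ).restrOpen V hVo, n, ?_, ?_, ?_, ?_⟩
  · rw [OpenPartialHomeomorph.restrOpen_source]
    exact ⟨hst.mem_toOpenPartialHomeomorph_source, hpV⟩
  · rw [OpenPartialHomeomorph.restrOpen_source]
    exact fun z hz => (hV z hz.2).2.2.2
  · exact hψ0
  · intro z hz _
    rw [OpenPartialHomeomorph.restrOpen_source] at hz
    obtain ⟨h1, h2, h3, -⟩ := hV z hz.2
    have hcoe : ⇑((hst.toOpenPartialHomeomorph ψ).restrOpen V hVo) = ψ := rfl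
    have hfd : ∀ w, fderiv ℝ ψ (z : ℂ) w = deriv ψ z * w := fun w => by
      have := (h2.differentiableAt.hasDerivAt.hasFDerivAt.restrictScalars ℝ).fderiv
      rw [this]
      simp [mul_comm]
    rw [hcoe]
    refine ⟨(h2.contDiffAt (n := ∞)).restrict_scalars ℝ, ?_, fun w => ?_⟩
    · intro hdet
      obtain ⟨v, hv, hv0⟩ := (Submodule.ne_bot_iff _).mp (LinearMap.bot_lt_ker_of_det_eq_zero
        (f := (fderiv ℝ ψ (z : ℂ)).toLinearMap) hdet).ne'
      have : deriv ψ z * v = 0 := by rw [← hfd]; exact hv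
      exact (mul_ne_zero h3 hv0) this
    · refine transverse_congr ?_
      rw [hfd, mul_pow, ← mul_assoc, h1, ofComplex_apply]

/-! ### Scaling -/

theorem IsMeasuredFoliation.sq_mul {Q : ℍ → ℂ} (hQ : S.IsMeasuredFoliation Q) {t : ℝ} (ht : 0 < t) :
    S.IsMeasuredFoliation fun z => (t : ℂ) ^ 2 * Q z := by
  refine ⟨fun γ hγ z => by simp only [hQ.1 γ hγ]; ring, fun p => ?_⟩
  obtain ⟨ψ, n, h1, h2, h3, h4⟩ := hQ.2 p
  -- Scaling the chart by `l` multiplies the model form `ζ^{n/2} dζ` by `l^{(n+2)/2}`, which has to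
  -- be `t`.
  set l : ℝ := t ^ (2 / ((n : ℝ) + 2)) with hl
  have hl0 : 0 < l := Real.rpow_pos_of_pos ht _
  have hl0' : (l : ℂ) ≠ 0 := by exact_mod_cast hl0.ne'
  have hlt : l ^ (n + 2) = t ^ 2 := by
    rw [hl, ← Real.rpow_natCast, ← Real.rpow_mul ht.le, ← Real.rpow_natCast]
    congr 1
    push_cast
    field_simp
  refine ⟨ψ.transHomeomorph (Homeomorph.mulLeft₀ (l : ℂ) hl0'), n, h1, h2, ?_, ?_⟩
  · simp [h3]
  · intro z hz hzp
    obtain ⟨i1, i2, i3⟩ := h4 z hz hzp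
    have hcoe : ⇑(ψ.transHomeomorph (Homeomorph.mulLeft₀ (l : ℂ) hl0')) = fun w => l • ψ w := by
      funext w
      simp
    have hfd : fderiv ℝ (fun w => l • ψ w) (z : ℂ) = l • fderiv ℝ ψ z :=
      fderiv_fun_const_smul (i1.differentiableAt (by simp)) l
    rw [hcoe, hfd]
    refine ⟨i1.const_smul l, ?_, fun w => ?_⟩
    · have : (l • fderiv ℝ ψ (z : ℂ)).det = l ^ Module.finrank ℝ ℂ * (fderiv ℝ ψ (z : ℂ)).det := by
        rw [ContinuousLinearMap.det, ContinuousLinearMap.det, ContinuousLinearMap.toLinearMap_smul,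
          LinearMap.det_smul]
      rw [this]
      exact mul_ne_zero (pow_ne_zero _ hl0.ne') i2
    · rw [transverse_sq_real_mul, i3, ← transverse_sq_real_mul]
      refine transverse_congr ?_
      have hlt' : (l : ℂ) ^ (n + 2) = (t : ℂ) ^ 2 := by exact_mod_cast hlt
      simp only [smul_apply, ← hlt', Complex.real_smul]
      ring

theorem curveInf_sq_mul (Q : ℍ → ℂ) (α : S.Curve) {t : ℝ} (ht : 0 < t) :
    S.curveInf (fun z => (t : ℂ) ^ 2 * Q z) α = ENNReal.ofReal t * S.curveInf Q α := by
  have h0 : ENNReal.ofReal t ≠ 0 := (ENNReal.ofReal_pos.mpr ht).ne'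
  simp only [curveInf, transverse_sq_real_mul, abs_of_pos ht, ENNReal.ofReal_mul ht.le,
    lintegral_const_mul' _ _ ENNReal.ofReal_ne_top,
    ENNReal.mul_iInf_of_ne h0 ENNReal.ofReal_ne_top]

theorem height_sq_mul (Q : ℍ → ℂ) {t : ℝ} (ht : 0 < t) :
    S.height (fun z => (t : ℂ) ^ 2 * Q z) = t • S.height Q := by
  funext α
  rw [height_eq, curveInf_sq_mul Q α ht, ENNReal.toReal_mul, ENNReal.toReal_ofReal ht.le]
  rfl

theorem foliationLength_sq_mul (b : S.CplxStr) (ρ : ℍ → ℝ≥0) (Q : ℍ → ℂ) {t : ℝ} (ht : 0 < t) :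
    S.foliationLength b ρ (fun z => (t : ℂ) ^ 2 * Q z) =
      ENNReal.ofReal t * S.foliationLength b ρ Q := by
  rw [foliationLength, foliationLength, ← lintegral_const_mul' _ _ ENNReal.ofReal_ne_top]
  refine lintegral_congr fun z => ?_
  rw [← ENNReal.ofReal_mul ht.le]
  congr 1
  have h1 : (((t : ℂ) ^ 2 * Q z) ^ (1 / 2 : ℂ)) ^ 2 = ((t : ℂ) * Q z ^ (1 / 2 : ℂ)) ^ 2 := by
    rw [cpow_half_sq, mul_pow, cpow_half_sq]
  have h2 : conj ((t : ℂ) * Q z ^ (1 / 2 : ℂ)) - b.b z * ((t : ℂ) * Q z ^ (1 / 2 : ℂ)) =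
      t * (conj (Q z ^ (1 / 2 : ℂ)) - b.b z * Q z ^ (1 / 2 : ℂ)) := by
    rw [map_mul, Complex.conj_ofReal]; ring
  rw [norm_leaf_congr _ h1, h2, norm_mul, Complex.norm_real, Real.norm_of_nonneg ht.le]
  ring

theorem extStr_smul_le (b : S.CplxStr) (ξ : S.Curve → ℝ) {t : ℝ} (ht : 0 < t) :
    S.extStr b (t • ξ) ≤ ENNReal.ofReal (t ^ 2) * S.extStr b ξ := by
  refine iSup_le fun ρ => iSup_le fun hρm => iSup_le fun hρ => iSup_le fun h0 =>
    iSup_le fun hfin => ?_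
  have h1 : (⨅ (Q : ℍ → ℂ) (_ : S.IsMeasuredFoliation Q) (_ : S.height Q = t • ξ),
      S.foliationLength b ρ Q) ≤ ENNReal.ofReal t * ⨅ (Q : ℍ → ℂ) (_ : S.IsMeasuredFoliation Q)
      (_ : S.height Q = ξ), S.foliationLength b ρ Q := by
    have ht0 : ENNReal.ofReal t ≠ 0 := (ENNReal.ofReal_pos.mpr ht).ne'
    simp only [ENNReal.mul_iInf_of_ne ht0 ENNReal.ofReal_ne_top]
    refine le_iInf fun Q => le_iInf fun hQ => le_iInf fun hξ => ?_
    refine iInf_le_of_le (fun z => (t : ℂ) ^ 2 * Q z) <| iInf_le_of_le (hQ.sq_mul ht) <|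
      iInf_le_of_le ?_ (foliationLength_sq_mul b ρ Q ht).le
    rw [height_sq_mul Q ht, hξ]
  have h2 : (⨅ (Q : ℍ → ℂ) (_ : S.IsMeasuredFoliation Q) (_ : S.height Q = ξ),
      S.foliationLength b ρ Q) ^ 2 / S.metricArea b ρ ≤ S.extStr b ξ :=
    le_iSup_of_le ρ <| le_iSup_of_le hρm <| le_iSup_of_le hρ <| le_iSup_of_le h0 <|
      le_iSup_of_le hfin le_rfl
  refine le_trans ?_ (mul_le_mul_right h2 _)
  rw [ENNReal.ofReal_pow ht.le, ← mul_div_assoc, ← mul_pow]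
  gcongr

/-! ### Extremal length along a Teichmüller ray -/

theorem UnitQD.continuous (q : S.UnitQD) : Continuous q.1 := by
  refine continuous_iff_continuousAt.mpr fun z => ?_
  have h2 : ContinuousAt ((fun w : ℂ => q.1 (ofComplex w)) ∘ UpperHalfPlane.coe) z :=
    ContinuousAt.comp (UnitQD.analyticAt S q z).continuousAt
      UpperHalfPlane.continuous_coe.continuousAt
  have h3 : (fun w : ℂ => q.1 (ofComplex w)) ∘ UpperHalfPlane.coe = q.1 := by
    funext w; simp
  rwa [h3] at h2

theorem exp_neg_two_mul_mul_one_sub_tanh_sq (r : ℝ) :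
    Real.exp (-2 * r) * (1 - Real.tanh r ^ 2) = (1 - Real.tanh r) ^ 2 := by
  have hc := (Real.cosh_pos r).ne'
  have h1 : Real.exp (-2 * r) * (Real.cosh r + Real.sinh r) = Real.cosh r - Real.sinh r := by
    rw [Real.cosh_add_sinh, Real.cosh_sub_sinh, ← Real.exp_add]
    congr 1
    ring
  generalize Real.exp (-2 * r) = e at *
  rw [Real.tanh_eq_sinh_div_cosh]
  field_simp
  linear_combination (Real.cosh r - Real.sinh r) * h1

/-- With `s` the root of `q`, the Beltrami coefficient satisfies `b s = tanh r · conj s`: the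
vertical leaves are the most contracted direction. -/
theorem norm_leaf_rayStr (r : ℝ) (q : S.UnitQD) (z : ℍ) :
    ‖conj (q.1 z ^ (1 / 2 : ℂ)) - (S.rayStr r q).b z * q.1 z ^ (1 / 2 : ℂ)‖ =
      (1 - Real.tanh r) * ‖q.1 z‖ ^ (1 / 2 : ℝ) := by
  set s := q.1 z ^ (1 / 2 : ℂ) with hs
  have hq : q.1 z = s ^ 2 := (cpow_half_sq _).symm
  have hb : (S.rayStr r q).b z = (Real.tanh r : ℂ) * (conj (q.1 z) / (‖q.1 z‖ : ℂ)) := rfl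
  have h1 : (S.rayStr r q).b z * s = Real.tanh r * conj s := by
    rw [hb, hq]
    by_cases h0 : s = 0
    · simp [h0]
    have hc : conj s ≠ 0 := by simpa using h0
    rw [norm_pow, Complex.ofReal_pow, ← Complex.mul_conj', map_pow]
    field_simp
  have h2 : conj s - (Real.tanh r : ℂ) * conj s = ((1 - Real.tanh r : ℝ) : ℂ) * conj s := by
    push_cast; ring
  rw [h1, h2, norm_mul, Complex.norm_real, RCLike.norm_conj,
    Real.norm_of_nonneg (by linarith [(abs_lt.mp (Real.abs_tanh_lt_one r)).2]), hq, norm_pow,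
    ← Real.sqrt_eq_rpow, Real.sqrt_sq (norm_nonneg _)]

theorem norm_rayStr_le (r : ℝ) (q : S.UnitQD) (z : ℍ) :
    ‖(S.rayStr r q).b z‖ ≤ |Real.tanh r| := by
  have hb : (S.rayStr r q).b z = (Real.tanh r : ℂ) * (conj (q.1 z) / (‖q.1 z‖ : ℂ)) := rfl
  rw [hb, norm_mul, norm_div, Complex.norm_real, Complex.norm_real, RCLike.norm_conj, norm_norm,
    Real.norm_eq_abs]
  exact mul_le_of_le_one_right (abs_nonneg _) (div_self_le_one _)

/-- The vertical foliation of `q` itself is a competitor. Its length for `ρ` is `(1 - tanh r) ∫ ρ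
|q|^{1/2}`, and Cauchy-Schwarz with `∫ |q| = 1` bounds the square by `(1 - tanh r)² ∫ ρ²`. The area
is at least `(1 - tanh² r) ∫ ρ²`, and the quotient of the factors is `e^{-2r}`. -/
theorem extStr_rayStr_le (r : ℝ) (q : S.UnitQD) :
    S.extStr (S.rayStr r q) (S.height q.1) ≤ ENNReal.ofReal (Real.exp (-2 * r)) := by
  refine iSup_le fun ρ => iSup_le fun hρm => iSup_le fun _ => iSup_le fun _ => iSup_le fun _ => ?_
  have ht : 0 ≤ 1 - Real.tanh r := by linarith [(abs_lt.mp (Real.abs_tanh_lt_one r)).2]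
  refine ENNReal.div_le_of_le_mul ?_
  have h1 : (⨅ (Q : ℍ → ℂ) (_ : S.IsMeasuredFoliation Q) (_ : S.height Q = S.height q.1),
      S.foliationLength (S.rayStr r q) ρ Q) ≤ S.foliationLength (S.rayStr r q) ρ q.1 :=
    iInf_le_of_le q.1 <| iInf_le_of_le q.isMeasuredFoliation <| iInf_le_of_le rfl le_rfl
  have h2 : S.foliationLength (S.rayStr r q) ρ q.1 = ENNReal.ofReal (1 - Real.tanh r) *
      ∫⁻ z in S.D, (ρ z : ℝ≥0∞) * ‖q.1 z‖ₑ ^ (1 / 2 : ℝ) ∂lebH := by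
    rw [foliationLength, ← lintegral_const_mul' _ _ ENNReal.ofReal_ne_top]
    refine lintegral_congr fun z => ?_
    rw [norm_leaf_rayStr, mul_left_comm, ENNReal.ofReal_mul ht,
      ENNReal.ofReal_mul (NNReal.coe_nonneg _),
      ENNReal.ofReal_coe_nnreal, ← ENNReal.ofReal_rpow_of_nonneg (norm_nonneg _) (by norm_num),
      ofReal_norm]
  have h3 : (∫⁻ z in S.D, (ρ z : ℝ≥0∞) * ‖q.1 z‖ₑ ^ (1 / 2 : ℝ) ∂lebH) ^ 2 ≤
      ∫⁻ z in S.D, (ρ z : ℝ≥0∞) ^ 2 ∂lebH := by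
    have h := ENNReal.lintegral_mul_le_Lp_mul_Lq (lebH.restrict S.D) Real.HolderConjugate.two_two
      (f := fun z => (ρ z : ℝ≥0∞)) (g := fun z => ‖q.1 z‖ₑ ^ (1 / 2 : ℝ))
      hρm.coe_nnreal_ennreal.aemeasurable (q.continuous.measurable.enorm.pow_const _).aemeasurable
    have hg : ∀ z : ℍ, (‖q.1 z‖ₑ ^ (1 / 2 : ℝ)) ^ (2 : ℝ) = ‖q.1 z‖ₑ := fun z => by
      rw [← ENNReal.rpow_mul]; norm_num
    simp only [hg, q.2.2.2, ENNReal.one_rpow, mul_one, Pi.mul_apply, ENNReal.rpow_two] at h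
    calc _ ≤ ((∫⁻ z in S.D, (ρ z : ℝ≥0∞) ^ 2 ∂lebH) ^ (1 / 2 : ℝ)) ^ 2 := by gcongr
      _ = _ := by
        rw [← ENNReal.rpow_two, ← ENNReal.rpow_mul]; norm_num
  have h4 : ENNReal.ofReal (1 - Real.tanh r ^ 2) * ∫⁻ z in S.D, (ρ z : ℝ≥0∞) ^ 2 ∂lebH ≤
      S.metricArea (S.rayStr r q) ρ := by
    rw [metricArea, ← lintegral_const_mul' _ _ ENNReal.ofReal_ne_top]
    refine lintegral_mono fun z => ?_
    have hn := norm_rayStr_le r q z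
    have hn2 : ‖(S.rayStr r q).b z‖ ^ 2 ≤ Real.tanh r ^ 2 := by
      rw [← sq_abs (Real.tanh r)]; gcongr
    rw [mul_comm, ← ENNReal.ofReal_coe_nnreal, ← ENNReal.ofReal_pow (NNReal.coe_nonneg _),
      ← ENNReal.ofReal_mul (by positivity)]
    exact ENNReal.ofReal_le_ofReal (by gcongr)
  calc _ ≤ (S.foliationLength (S.rayStr r q) ρ q.1) ^ 2 := by gcongr
    _ = ENNReal.ofReal ((1 - Real.tanh r) ^ 2) *
        (∫⁻ z in S.D, (ρ z : ℝ≥0∞) * ‖q.1 z‖ₑ ^ (1 / 2 : ℝ) ∂lebH) ^ 2 := by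
      rw [h2, mul_pow, ENNReal.ofReal_pow ht]
    _ ≤ ENNReal.ofReal ((1 - Real.tanh r) ^ 2) * ∫⁻ z in S.D, (ρ z : ℝ≥0∞) ^ 2 ∂lebH := by gcongr
    _ = ENNReal.ofReal (Real.exp (-2 * r)) * (ENNReal.ofReal (1 - Real.tanh r ^ 2) *
        ∫⁻ z in S.D, (ρ z : ℝ≥0∞) ^ 2 ∂lebH) := by
      rw [← exp_neg_two_mul_mul_one_sub_tanh_sq, ENNReal.ofReal_mul (Real.exp_nonneg _), mul_assoc]
    _ ≤ _ := by gcongr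

end ClosedSurface

/-! ### Images of locally Lipschitz functions -/

/-- The image of `U` under a function of local Lipschitz constant at most `g` has length at most
`∫ g`. -/
theorem volume_image_le_lintegral {f g : ℝ → ℝ} {U : Set ℝ} (hU : IsOpen U) (hfin : volume U < ⊤)
    (hg : ∀ t ∈ U, 0 ≤ g t) (hgc : ∀ t ∈ U, ContinuousAt g t)
    (hf : ∀ t ∈ U, ∀ ε > 0, ∃ V ∈ 𝓝 t, ∀ s ∈ V, ∀ s' ∈ V, |f s - f s'| ≤ (g t + ε) * |s - s'|) :
    volume (f '' U) ≤ ∫⁻ t in U, ENNReal.ofReal (g t) := by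
  rcases U.eq_empty_or_nonempty with rfl | hne
  · simp
  refine ENNReal.le_of_forall_pos_le_add fun ε hε _ => ?_
  obtain ⟨δ, hδ, hδε⟩ : ∃ δ : ℝ≥0, 0 < δ ∧ (2 * δ : ℝ≥0∞) * volume U ≤ ε := by
    set M := volume U + 1 with hM
    have hM0 : M ≠ 0 := by simp [hM]
    have hMt : M ≠ ⊤ := ENNReal.add_ne_top.mpr ⟨hfin.ne, ENNReal.one_ne_top⟩
    have hpos : 0 < (ε : ℝ≥0∞) / (2 * M) := ENNReal.div_pos (by exact_mod_cast hε.ne')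
      (ENNReal.mul_ne_top (by simp) hMt)
    obtain ⟨δ, h1, h2⟩ := ENNReal.lt_iff_exists_nnreal_btwn.mp hpos
    refine ⟨δ, by exact_mod_cast h1, ?_⟩
    calc (2 * δ : ℝ≥0∞) * volume U ≤ 2 * ((ε : ℝ≥0∞) / (2 * M)) * M := by
          gcongr
          exact le_self_add
      _ = ((ε : ℝ≥0∞) / (2 * M)) * (2 * M) := by ring
      _ ≤ ε := by rw [mul_comm]; exact ENNReal.mul_div_le
  -- Near `t` the Lipschitz constant is at most `g t + δ`, and `g t` exceeds `g s` by at most `δ`;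
  -- hence the total error `2 δ`.
  have key : ∀ t : U, ∃ V : Set ℝ, IsOpen V ∧ (t : ℝ) ∈ V ∧ V ⊆ U ∧
      LipschitzOnWith (Real.toNNReal (g t + δ)) f V ∧ ∀ s ∈ V, g t ≤ g s + δ := by
    intro t
    have hδ' : (0 : ℝ) < δ := by exact_mod_cast hδ
    obtain ⟨V, hV, hVf⟩ := hf t t.2 δ hδ'
    have h1 : ∀ᶠ s in 𝓝 (t : ℝ), g t ≤ g s + δ := by
      filter_upwards [(hgc t t.2).eventually (lt_mem_nhds (sub_lt_self (g t) hδ'))] with s hs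
      linarith
    obtain ⟨W, hW, hWo, htW⟩ := eventually_nhds_iff.mp ((h1.and (hU.mem_nhds t.2)).and hV)
    refine ⟨W, hWo, htW, fun s hs => (hW s hs).1.2, ?_, fun s hs => (hW s hs).1.1⟩
    refine LipschitzOnWith.of_dist_le_mul fun s hs s' hs' => ?_
    rw [Real.dist_eq, Real.dist_eq, Real.coe_toNNReal _ (by linarith [hg t t.2])]
    exact hVf s (hW s hs).2 s' (hW s' hs').2
  choose V hVo hVt hVU hVL hVg using key
  obtain ⟨T, hT⟩ := TopologicalSpace.isOpen_iUnion_countable V hVo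
  have hcov : U ⊆ ⋃ t, V t := fun t ht => mem_iUnion.mpr ⟨⟨t, ht⟩, hVt ⟨t, ht⟩⟩
  rw [← hT.2] at hcov
  have hTne : T.Nonempty := by
    obtain ⟨t, ht⟩ := hne
    obtain ⟨i, hi, -⟩ := mem_iUnion₂.mp (hcov ht)
    exact ⟨i, hi⟩
  obtain ⟨e, he⟩ := hT.1.exists_eq_range hTne
  -- Countably many of the neighbourhoods cover `U`; they are made disjoint so that the integrals
  -- over them add up.
  set P : ℕ → Set ℝ := disjointed fun n => V (e n) with hP
  have hPV : ∀ n, P n ⊆ V (e n) := fun n => disjointed_subset _ n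
  have hPm : ∀ n, MeasurableSet (P n) := fun n =>
    MeasurableSet.disjointed (fun n => (hVo (e n)).measurableSet) n
  have hPU : ⋃ n, P n = U := by
    rw [hP, iUnion_disjointed]
    refine Subset.antisymm (iUnion_subset fun n => hVU _) fun t ht => ?_
    obtain ⟨i, hi, hti⟩ := mem_iUnion₂.mp (hcov ht)
    rw [he] at hi
    obtain ⟨n, rfl⟩ := hi
    exact mem_iUnion.mpr ⟨n, hti⟩
  have hpiece : ∀ n, volume (f '' P n) ≤ ∫⁻ t in P n, (ENNReal.ofReal (g t) + 2 * δ) := by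
    intro n
    have h1 := ((hVL (e n)).mono (hPV n)).hausdorffMeasure_image_le zero_le_one
    rw [hausdorffMeasure_real, ENNReal.rpow_one, ← setLIntegral_const] at h1
    refine h1.trans (setLIntegral_mono' (hPm n) fun s hs => ?_)
    have h2 := hVg (e n) s (hPV n hs)
    have h3 := hg s (hVU _ (hPV n hs))
    have h4 : (2 * δ : ℝ≥0∞) = ENNReal.ofReal (2 * δ) := by
      rw [ENNReal.ofReal_mul (by norm_num), ENNReal.ofReal_coe_nnreal]; simp
    rw [h4, ← ENNReal.ofReal_add h3 (by positivity)]
    exact ENNReal.ofReal_le_ofReal (by linarith)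
  calc volume (f '' U) = volume (⋃ n, f '' P n) := by rw [← image_iUnion, hPU]
    _ ≤ ∑' n, volume (f '' P n) := measure_iUnion_le _
    _ ≤ ∑' n, ∫⁻ t in P n, (ENNReal.ofReal (g t) + 2 * δ) := ENNReal.tsum_le_tsum hpiece
    _ = ∫⁻ t in U, (ENNReal.ofReal (g t) + 2 * δ) := by
      rw [← lintegral_iUnion hPm (disjoint_disjointed _), hPU]
    _ = (∫⁻ t in U, ENNReal.ofReal (g t)) + 2 * δ * volume U := by
      rw [lintegral_add_right _ measurable_const, setLIntegral_const]
    _ ≤ _ := by gcongr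

namespace ClosedSurface

/-! ### Segments and polygons -/

/-- The Euclidean segment from `x` to `y`, at constant speed for `t ∈ [0,1]`. -/
def segPt (x y : ℍ) (t : ℝ) : ℍ :=
  -- Clamping the parameter keeps the point in the convex set `ℍ` for all real `t`.
  ⟨(x : ℂ) + ((projIcc (0 : ℝ) 1 zero_le_one t : ℝ) : ℂ) * ((y : ℂ) - x), by
    have h := (projIcc (0 : ℝ) 1 zero_le_one t).2
    set τ : ℝ := (projIcc (0 : ℝ) 1 zero_le_one t : ℝ)
    have hx := x.coe_im_pos
    have hy := y.coe_im_pos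
    rw [Complex.add_im, Complex.im_ofReal_mul, Complex.sub_im]
    rcases h.2.eq_or_lt with h1 | h1
    · rw [h1]; linarith
    · nlinarith [mul_nonneg h.1 hy.le, mul_pos (sub_pos.mpr h1) hx]⟩

theorem coe_segPt (x y : ℍ) {t : ℝ} (ht : t ∈ Icc (0 : ℝ) 1) :
    (segPt x y t : ℂ) = x + t * ((y : ℂ) - x) := by
  change (x : ℂ) + ((projIcc (0 : ℝ) 1 zero_le_one t : ℝ) : ℂ) * ((y : ℂ) - x) = _
  rw [projIcc_of_mem _ ht]

theorem segPt_self (x : ℍ) (t : ℝ) : segPt x x t = x := by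
  refine UpperHalfPlane.ext ?_
  change (x : ℂ) + ((projIcc (0 : ℝ) 1 zero_le_one t : ℝ) : ℂ) * ((x : ℂ) - x) = _
  simp

theorem continuous_segPt : Continuous fun p : (ℍ × ℍ) × ℝ => segPt p.1.1 p.1.2 p.2 := by
  refine isOpenEmbedding_coe.isEmbedding.continuous_iff.mpr ?_
  change Continuous fun p : (ℍ × ℍ) × ℝ => (p.1.1 : ℂ) +
    ((projIcc (0 : ℝ) 1 zero_le_one p.2 : ℝ) : ℂ) * ((p.1.2 : ℂ) - p.1.1)
  have h1 := UpperHalfPlane.continuous_coe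
  have h2 : Continuous fun p : (ℍ × ℍ) × ℝ => (projIcc (0 : ℝ) 1 zero_le_one p.2 : ℝ) :=
    continuous_subtype_val.comp (continuous_projIcc.comp continuous_snd)
  fun_prop

/-- The average over the segment from `x` to `y` of the transverse measure of `w`. -/
def segInt (Q : ℍ → ℂ) (x y : ℍ) (w : ℂ) : ℝ := ∫ t in (0 : ℝ)..1, transverse (Q (segPt x y t)) w

/-- The transverse measure of the segment from `x` to `y`. -/
def seg (Q : ℍ → ℂ) (x y : ℍ) : ℝ := segInt Q x y ((y : ℂ) - x)

theorem segInt_nonneg (Q : ℍ → ℂ) (x y : ℍ) (w : ℂ) : 0 ≤ segInt Q x y w :=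
  intervalIntegral.integral_nonneg zero_le_one fun _ _ => transverse_nonneg _ _

theorem seg_nonneg (Q : ℍ → ℂ) (x y : ℍ) : 0 ≤ seg Q x y := segInt_nonneg _ _ _ _

theorem segInt_real_mul (Q : ℍ → ℂ) (x y : ℍ) (w : ℂ) (t : ℝ) :
    segInt Q x y (t * w) = |t| * segInt Q x y w := by
  simp only [segInt, transverse_real_smul, intervalIntegral.integral_const_mul]

theorem segInt_self (Q : ℍ → ℂ) (x : ℍ) (w : ℂ) : segInt Q x x w = transverse (Q x) w := by
  simp [segInt, segPt_self]

theorem seg_self (Q : ℍ → ℂ) (x : ℍ) : seg Q x x = 0 := by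
  rw [seg, sub_self, segInt_self]
  simp [transverse]

variable {Q : ℍ → ℂ}

theorem continuous_segInt (hQ : Continuous Q) :
    Continuous fun p : (ℍ × ℍ) × ℂ => segInt Q p.1.1 p.1.2 p.2 := by
  refine intervalIntegral.continuous_parametric_intervalIntegral_of_continuous' ?_ 0 1
  have h1 : Continuous fun p : ((ℍ × ℍ) × ℂ) × ℝ => Q (segPt p.1.1.1 p.1.1.2 p.2) :=
    hQ.comp (continuous_segPt.comp (by fun_prop : Continuous fun p : ((ℍ × ℍ) × ℂ) × ℝ =>
      (p.1.1, p.2)))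
  exact continuous_transverse.comp (h1.prodMk (by fun_prop : Continuous fun p : ((ℍ × ℍ) × ℂ) × ℝ =>
      p.1.2))

theorem continuous_seg (hQ : Continuous Q) : Continuous fun p : ℍ × ℍ => seg Q p.1 p.2 := by
  have h1 : Continuous fun p : ℍ × ℍ => (p, (p.2 : ℂ) - p.1) :=
    continuous_id.prodMk ((UpperHalfPlane.continuous_coe.comp continuous_snd).sub
      (UpperHalfPlane.continuous_coe.comp continuous_fst))
  have h2 := (continuous_segInt hQ).comp h1
  exact h2

/-- The transverse measure of short chords of a differentiable curve. -/
theorem seg_le_of_hasStrictDerivAt (hQ : Continuous Q) {c : ℝ → ℍ} {t : ℝ} {v : ℂ}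
    (hc : HasStrictDerivAt (fun s => (c s : ℂ)) v t) {ε : ℝ} (hε : 0 < ε) :
    ∃ V ∈ 𝓝 t, ∀ s ∈ V, ∀ s' ∈ V, seg Q (c s) (c s') ≤ (transverse (Q (c t)) v + ε) * |s - s'| := by
  -- The average over a segment is continuous in its endpoints and in the vector. Strict
  -- differentiability makes the difference quotients of nearby pairs close to `v`, uniformly.
  have h1 : ∀ᶠ p : (ℍ × ℍ) × ℂ in 𝓝 ((c t, c t), v),
      segInt Q p.1.1 p.1.2 p.2 < transverse (Q (c t)) v + ε := by
    refine (continuous_segInt hQ).continuousAt.eventually (gt_mem_nhds ?_)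
    simp only [segInt_self]
    linarith
  rw [nhds_prod_eq, nhds_prod_eq, eventually_prod_iff] at h1
  obtain ⟨pa, hpa, pb, hpb, hab⟩ := h1
  obtain ⟨η, hη, hηb⟩ := Metric.eventually_nhds_iff.mp hpb
  have hcc : ContinuousAt c t :=
    isOpenEmbedding_coe.isEmbedding.continuousAt_iff.mpr hc.hasDerivAt.continuousAt
  have h2 : ∀ᶠ p : ℝ × ℝ in 𝓝 (t, t), pa (c p.1, c p.2) := by
    rw [← nhds_prod_eq] at hpa
    have hcc2 : ContinuousAt (fun p : ℝ × ℝ => (c p.1, c p.2)) (t, t) :=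
      ContinuousAt.prodMk (hcc.comp_of_eq continuousAt_fst rfl) (hcc.comp_of_eq continuousAt_snd rfl)
    exact hcc2.eventually hpa
  have h3 := hc.hasStrictFDerivAt.isLittleO.def (half_pos hη)
  have h4 := h2.and h3
  rw [nhds_prod_eq] at h4
  obtain ⟨V, hV, h4⟩ := eventually_prod_self_iff'.mp h4
  refine ⟨V, hV, fun s hs s' hs' => ?_⟩
  rcases eq_or_ne s s' with rfl | hne
  · simp [seg_self]
  obtain ⟨h5, -⟩ := h4 s hs s' hs'
  obtain ⟨-, h6⟩ := h4 s' hs' s hs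
  have hne' : ((s' - s : ℝ) : ℂ) ≠ 0 := by exact_mod_cast sub_ne_zero.mpr hne.symm
  set w : ℂ := ((c s' : ℂ) - c s) / ((s' - s : ℝ) : ℂ) with hw
  have hseg : seg Q (c s) (c s') = |s - s'| * segInt Q (c s) (c s') w := by
    rw [seg, abs_sub_comm, ← segInt_real_mul, hw, mul_div_cancel₀ _ hne']
  have hwv : dist w v < η := by
    have h7 : w - v = ((c s' : ℂ) - c s - ((s' - s : ℝ) : ℂ) * v) / ((s' - s : ℝ) : ℂ) := by
      rw [hw]; field_simp
    rw [dist_eq_norm, h7, norm_div, div_lt_iff₀ (norm_pos_iff.mpr hne'), Complex.norm_real]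
    have h8 : ‖(c s' : ℂ) - c s - ((s' - s : ℝ) : ℂ) * v‖ ≤ η / 2 * ‖s' - s‖ := by
      simpa using h6
    have h9 : 0 < ‖s' - s‖ := norm_pos_iff.mpr (sub_ne_zero.mpr hne.symm)
    nlinarith
  rw [hseg, mul_comm]
  exact mul_le_mul_of_nonneg_right (hab h5 (hηb hwv)).le (abs_nonneg _)

/-- A dense sequence of points. -/
def densePt (n : ℕ) : ℍ := TopologicalSpace.denseSeq ℍ n

theorem exists_densePt {p : ℍ → Prop} {z : ℍ} (h : ∀ᶠ w in 𝓝 z, p w) : ∃ n, p (densePt n) := by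
  obtain ⟨V, hV, hVo, hzV⟩ := eventually_nhds_iff.mp h
  obtain ⟨n, hn⟩ := (TopologicalSpace.denseRange_denseSeq ℍ).exists_mem_open hVo ⟨z, hzV⟩
  exact ⟨n, hV _ hn⟩

/-- The transverse measure of a polygon. -/
def chainSum (Q : ℍ → ℂ) (x : ℍ) : List ℕ → ℍ → ℝ
  | [], y => seg Q x y
  | n :: L, y => seg Q x (densePt n) + chainSum Q (densePt n) L y

theorem chainSum_nonneg (Q : ℍ → ℂ) (x : ℍ) (L : List ℕ) (y : ℍ) : 0 ≤ chainSum Q x L y := by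
  induction L generalizing x with
  | nil => exact seg_nonneg _ _ _
  | cons n L ih => exact add_nonneg (seg_nonneg _ _ _) (ih _)

theorem continuous_chainSum (hQ : Continuous Q) (L : List ℕ) :
    Continuous fun p : ℍ × ℍ => chainSum Q p.1 L p.2 := by
  induction L with
  | nil =>
    simp only [chainSum]
    exact continuous_seg hQ
  | cons n L ih =>
    simp only [chainSum]
    have h1 := (continuous_seg hQ).comp
      (continuous_fst.prodMk continuous_const : Continuous fun p : ℍ × ℍ => (p.1, densePt n))
    have h2 := ih.comp
      (continuous_const.prodMk continuous_snd : Continuous fun p : ℍ × ℍ => (densePt n, p.2))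
    exact h1.add h2

theorem chainSum_append (Q : ℍ → ℂ) (x : ℍ) (L : List ℕ) (n : ℕ) (y : ℍ) :
    chainSum Q x (L ++ [n]) y = chainSum Q x L (densePt n) + seg Q (densePt n) y := by
  induction L generalizing x with
  | nil => rfl
  | cons k L ih => simp only [List.cons_append, chainSum, ih, add_assoc]

/-- The infimum of the transverse measures of polygons from `x` to `y`. -/
def polyDist (Q : ℍ → ℂ) (x y : ℍ) : ℝ := ⨅ L : List ℕ, chainSum Q x L y

theorem polyDist_le (Q : ℍ → ℂ) (x : ℍ) (L : List ℕ) (y : ℍ) :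
    polyDist Q x y ≤ chainSum Q x L y :=
  ciInf_le ⟨0, forall_mem_range.mpr fun L => chainSum_nonneg Q x L y⟩ L

theorem polyDist_nonneg (Q : ℍ → ℂ) (x y : ℍ) : 0 ≤ polyDist Q x y :=
  le_ciInf fun L => chainSum_nonneg Q x L y

theorem polyDist_self (Q : ℍ → ℂ) (x : ℍ) : polyDist Q x x = 0 :=
  le_antisymm ((polyDist_le Q x [] x).trans (seg_self Q x).le) (polyDist_nonneg Q x x)

/-- The point `y` need not be one of the countably many allowed vertices; a dense point close to it
replaces it with an arbitrarily small error. -/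
theorem polyDist_le_add (hQ : Continuous Q) (x y z : ℍ) :
    polyDist Q x z ≤ polyDist Q x y + seg Q y z := by
  rw [← sub_le_iff_le_add]
  refine le_ciInf fun L => sub_le_iff_le_add.mpr (le_of_forall_pos_le_add fun ε hε => ?_)
  have hc : Continuous fun w => chainSum Q x L w + seg Q w z :=
    ((continuous_chainSum hQ L).comp (continuous_const.prodMk continuous_id)).add
      ((continuous_seg hQ).comp (continuous_id.prodMk continuous_const))
  obtain ⟨n, hn⟩ := exists_densePt (hc.continuousAt.eventually (gt_mem_nhds
    (lt_add_of_pos_right (chainSum Q x L y + seg Q y z) hε)))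
  rw [← chainSum_append] at hn
  exact (polyDist_le Q x _ z).trans hn.le

theorem continuous_polyDist (hQ : Continuous Q) (x : ℍ) : Continuous (polyDist Q x) := by
  refine continuous_iff_continuousAt.mpr fun y => tendsto_iff_dist_tendsto_zero.mpr ?_
  have hc : Continuous fun z => seg Q y z + seg Q z y :=
    ((continuous_seg hQ).comp (continuous_const.prodMk continuous_id)).add
      ((continuous_seg hQ).comp (continuous_id.prodMk continuous_const))
  have h0 := hc.tendsto y
  rw [seg_self, add_zero] at h0
  refine squeeze_zero (fun _ => dist_nonneg) (fun z => ?_) h0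
  rw [Real.dist_eq, abs_le]
  have h1 := polyDist_le_add hQ x y z
  have h2 := polyDist_le_add hQ x z y
  have h3 := seg_nonneg Q y z
  have h4 := seg_nonneg Q z y
  constructor <;> linarith

/-- The transverse measure of a curve is at least that of inscribed polygons. -/
theorem polyDist_le_lintegral (hQ : Continuous Q) {c : ℝ → ℍ} (hc : ContinuousOn c (Icc 0 1))
    {E : Set ℍ} (hE : IsLocFinite E)
    (hcd : ∀ t ∈ Ioo (0 : ℝ) 1, c t ∉ E → ContDiffAt ℝ 1 (fun s => (c s : ℂ)) t) :
    ENNReal.ofReal (polyDist Q (c 0) (c 1)) ≤ ∫⁻ t in {t | t ∈ Ioo (0 : ℝ) 1 ∧ c t ∉ E},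
      ENNReal.ofReal (transverse (Q (c t)) (deriv (fun s => (c s : ℂ)) t)) := by
  set U := {t | t ∈ Ioo (0 : ℝ) 1 ∧ c t ∉ E} with hU
  -- By the intermediate value theorem `f` takes all values between `0` and the polygonal distance,
  -- while its local Lipschitz constant is the transverse speed of `c`.
  set f : ℝ → ℝ := fun t => polyDist Q (c 0) (c t) with hf
  have hUo : IsOpen U := isOpen_regularTimes hc hE
  have hfc : ContinuousOn f (Icc 0 1) := (continuous_polyDist hQ (c 0)).comp_continuousOn hc
  have hf0 : f 0 = 0 := polyDist_self Q _
  have hIVT := intermediate_value_Icc zero_le_one hfc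
  rw [hf0] at hIVT
  -- The curve may spend a large set of times in `E`, but it meets only finitely many points of `E`,
  -- so `f` takes finitely many values there.
  set F := polyDist Q (c 0) '' (E ∩ c '' Icc 0 1) ∪ {f 0, f 1} with hF
  have hFfin : F.Finite := ((hE _ (isCompact_Icc.image_of_continuousOn hc)).image _).union
    (by simp)
  have hsub : Icc 0 (f 1) ⊆ f '' U ∪ F := by
    refine hIVT.trans ?_
    rintro _ ⟨t, ht, rfl⟩
    by_cases hct : c t ∈ E
    · exact Or.inr (Or.inl ⟨c t, ⟨hct, t, ht, rfl⟩, rfl⟩)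
    rcases ht.1.eq_or_lt with h | h
    · exact Or.inr (Or.inr (by simp [← h]))
    rcases ht.2.eq_or_lt with h' | h'
    · exact Or.inr (Or.inr (by simp [h']))
    · exact Or.inl ⟨t, ⟨⟨h, h'⟩, hct⟩, rfl⟩
  have hfinU : volume U < ⊤ :=
    (measure_mono fun t ht => ht.1 : volume U ≤ volume (Ioo (0 : ℝ) 1)).trans_lt (by simp)
  calc ENNReal.ofReal (f 1) = volume (Icc 0 (f 1)) := by rw [Real.volume_Icc, sub_zero]
    _ ≤ volume (f '' U) + volume F := (measure_mono hsub).trans (measure_union_le _ _)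
    _ = volume (f '' U) := by rw [hFfin.measure_zero, add_zero]
    _ ≤ _ := by
      refine volume_image_le_lintegral hUo hfinU (fun _ _ => transverse_nonneg _ _) ?_ ?_
      · intro t ht
        have h1 := hcd t ht.1 ht.2
        have h2 : ContinuousAt (deriv fun s => (c s : ℂ)) t := by
          have := (h1.continuousAt_fderiv (by simp)).clm_apply (continuousAt_const (y := (1 : ℝ)))
          simpa using this
        have h3 : ContinuousAt c t := isOpenEmbedding_coe.isEmbedding.continuousAt_iff.mpr
          h1.continuousAt
        exact continuous_transverse.continuousAt.comp (f := fun t => (Q (c t), _))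
          ((hQ.continuousAt.comp h3).prodMk h2)
      · intro t ht ε hε
        obtain ⟨V, hV, h⟩ := seg_le_of_hasStrictDerivAt hQ
          ((hcd t ht.1 ht.2).hasStrictDerivAt one_ne_zero) hε
        refine ⟨V, hV, fun s hs s' hs' => ?_⟩
        have h1 := h s hs s' hs'
        have h2 := h s' hs' s hs
        rw [abs_sub_comm s' s] at h2
        have h3 := polyDist_le_add hQ (c 0) (c s) (c s')
        have h4 := polyDist_le_add hQ (c 0) (c s') (c s)
        rw [abs_le]
        constructor <;> simp only [hf] <;> linarith

end ClosedSurface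

namespace ClosedSurface

/-! ### Polygonal paths -/

/-- A path, continuously differentiable away from a locally finite set `E`. -/
structure IsPath (c : ℝ → ℍ) (E : Set ℍ) : Prop where
  cont : ContinuousOn c (Icc 0 1)
  locFinite : IsLocFinite E
  diff : ∀ t ∈ Ioo (0 : ℝ) 1, c t ∉ E → ContDiffAt ℝ 1 (fun s => (c s : ℂ)) t

/-- The transverse measure of a path. -/
def pathCost (Q : ℍ → ℂ) (c : ℝ → ℍ) (E : Set ℍ) : ℝ≥0∞ :=
  ∫⁻ t in {t | t ∈ Ioo (0 : ℝ) 1 ∧ c t ∉ E},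
    ENNReal.ofReal (transverse (Q (c t)) (deriv (fun s => (c s : ℂ)) t))

/-- Transverse measures are homogeneous in the velocity, so they do not depend on the
parametrization. The values `b = 0` and `b = 1` give the two halves of a concatenation. -/
theorem lintegral_reparam (Q : ℍ → ℂ) (c : ℝ → ℍ) (b : ℝ) {U : Set ℝ} (hU : MeasurableSet U) :
    ∫⁻ t in (fun t => 2 * t - b) ⁻¹' U, ENNReal.ofReal
      (transverse (Q (c (2 * t - b))) (deriv (fun s => (c (2 * s - b) : ℂ)) t)) =
    ∫⁻ t in U, ENNReal.ofReal (transverse (Q (c t)) (deriv (fun s => (c s : ℂ)) t)) := by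
  have hm : Measurable fun t : ℝ => 2 * t - b := by fun_prop
  have hsurj : Function.Surjective fun t : ℝ => 2 * t - b := fun y => ⟨(y + b) / 2, by ring⟩
  have hd : ∀ t : ℝ, HasDerivAt (fun t : ℝ => 2 * t - b) 2 t := fun t => by
    simpa using ((hasDerivAt_id t).const_mul 2).sub_const b
  have h := lintegral_image_eq_lintegral_abs_deriv_mul (hm hU)
    (fun t _ => (hd t).hasDerivWithinAt)
    (fun s _ t _ hst => by simpa using hst)
    (fun t => ENNReal.ofReal (transverse (Q (c t)) (deriv (fun s => (c s : ℂ)) t)))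
  rw [image_preimage_eq _ hsurj] at h
  rw [h]
  refine lintegral_congr fun t => ?_
  have h1 : deriv (fun s => (c (2 * s - b) : ℂ)) t =
      ((2 : ℝ) : ℂ) * deriv (fun s => (c s : ℂ)) (2 * t - b) := by
    have e1 := deriv_comp_mul_left (2 : ℝ) (fun s => (c (s - b) : ℂ)) t
    have e2 := deriv_comp_sub_const (fun s => (c s : ℂ)) b (2 * t)
    rw [e1, e2, Complex.real_smul]
  rw [h1, transverse_real_smul, ENNReal.ofReal_mul (abs_nonneg _)]

theorem IsPath.concat {c₁ c₂ : ℝ → ℍ} {E₁ E₂ : Set ℍ} (h₁ : IsPath c₁ E₁) (h₂ : IsPath c₂ E₂)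
    (h : c₁ 1 = c₂ 0) (Q : ℍ → ℂ) : ∃ c E, IsPath c E ∧ c 0 = c₁ 0 ∧ c 1 = c₂ 1 ∧
      pathCost Q c E ≤ pathCost Q c₁ E₁ + pathCost Q c₂ E₂ := by
  set c : ℝ → ℍ := fun t => if t ≤ 1 / 2 then c₁ (2 * t - 0) else c₂ (2 * t - 1) with hc
  -- The junction, where the concatenated path may have a corner, joins the exceptional set.
  set E := (E₁ ∪ E₂) ∪ {c₂ 0} with hE
  have hl : ∀ t < 1 / 2, c =ᶠ[𝓝 t] fun s => c₁ (2 * s - 0) := fun t ht => by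
    filter_upwards [gt_mem_nhds ht] with s hs
    simp only [hc]
    rw [if_pos hs.le]
  have hr : ∀ t > 1 / 2, c =ᶠ[𝓝 t] fun s => c₂ (2 * s - 1) := fun t ht => by
    filter_upwards [lt_mem_nhds ht] with s hs
    simp only [hc]
    rw [if_neg (not_le.mpr hs)]
  have hmid : c (1 / 2) = c₂ 0 := by
    simp only [hc]
    rw [if_pos le_rfl, ← h]
    norm_num
  have hcov : ∀ t ∈ Ioo (0 : ℝ) 1, c t ∉ E →
      (t < 1 / 2 ∧ 2 * t - 0 ∈ Ioo (0 : ℝ) 1 ∧ c₁ (2 * t - 0) ∉ E₁) ∨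
      (1 / 2 < t ∧ 2 * t - 1 ∈ Ioo (0 : ℝ) 1 ∧ c₂ (2 * t - 1) ∉ E₂) := by
    intro t ht htE
    rcases lt_trichotomy t (1 / 2) with h | h | h
    · refine Or.inl ⟨h, ⟨by linarith [ht.1], by linarith⟩, fun hm => htE ?_⟩
      rw [(hl t h).eq_of_nhds]
      exact Or.inl (Or.inl hm)
    · exact absurd (Or.inr (by rw [h, hmid]; rfl)) htE
    · refine Or.inr ⟨h, ⟨by linarith, by linarith [ht.2]⟩, fun hm => htE ?_⟩
      rw [(hr t h).eq_of_nhds]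
      exact Or.inl (Or.inr hm)
  have hl' : ∀ t < 1 / 2, (fun s => (c s : ℂ)) =ᶠ[𝓝 t] fun s => (c₁ (2 * s - 0) : ℂ) :=
    fun t ht => (hl t ht).fun_comp UpperHalfPlane.coe
  have hr' : ∀ t > 1 / 2, (fun s => (c s : ℂ)) =ᶠ[𝓝 t] fun s => (c₂ (2 * s - 1) : ℂ) :=
    fun t ht => (hr t ht).fun_comp UpperHalfPlane.coe
  refine ⟨c, E, ⟨?_, (h₁.locFinite.union h₂.locFinite).union (isLocFinite_singleton _), ?_⟩,
    ?_, ?_, ?_⟩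
  · rw [← Icc_union_Icc_eq_Icc (b := (1 / 2 : ℝ)) (by norm_num) (by norm_num)]
    refine ContinuousOn.union_of_isClosed ?_ ?_ isClosed_Icc isClosed_Icc
    · refine ContinuousOn.congr (f := fun s => c₁ (2 * s - 0)) (h₁.cont.comp (by fun_prop) ?_) ?_
      · exact fun t ht => ⟨by linarith [ht.1], by linarith [ht.2]⟩
      · exact fun t ht => if_pos ht.2
    · refine ContinuousOn.congr (f := fun s => c₂ (2 * s - 1)) (h₂.cont.comp (by fun_prop) ?_) ?_
      · exact fun t ht => ⟨by linarith [ht.1], by linarith [ht.2]⟩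
      · intro t ht
        rcases ht.1.eq_or_lt with h' | h'
        · rw [← h', hmid]; norm_num
        · exact (hr t h').eq_of_nhds
  · intro t ht htE
    have hsub : ∀ b : ℝ, ContDiffAt ℝ 1 (fun s : ℝ => 2 * s - b) t := fun b =>
      (contDiffAt_const.mul contDiffAt_id).sub contDiffAt_const
    rcases hcov t ht htE with ⟨h3, h4, h5⟩ | ⟨h3, h4, h5⟩
    · exact (ContDiffAt.comp t (h₁.diff _ h4 h5) (hsub 0)).congr_of_eventuallyEq (hl' t h3)
    · exact (ContDiffAt.comp t (h₂.diff _ h4 h5) (hsub 1)).congr_of_eventuallyEq (hr' t h3)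
  · simp only [hc]
    rw [if_pos (by norm_num)]
    norm_num
  · simp only [hc]
    rw [if_neg (by norm_num)]
    norm_num
  · have m₁ := (isOpen_regularTimes h₁.cont h₁.locFinite).measurableSet
    have m₂ := (isOpen_regularTimes h₂.cont h₂.locFinite).measurableSet
    rw [pathCost, pathCost, pathCost, ← lintegral_reparam Q c₁ 0 m₁,
      ← lintegral_reparam Q c₂ 1 m₂]
    set U₁ := (fun t : ℝ => 2 * t - 0) ⁻¹' {t | t ∈ Ioo (0 : ℝ) 1 ∧ c₁ t ∉ E₁} with hU₁
    set U₂ := (fun t : ℝ => 2 * t - 1) ⁻¹' {t | t ∈ Ioo (0 : ℝ) 1 ∧ c₂ t ∉ E₂} with hU₂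
    have mU₁ : MeasurableSet U₁ := (by fun_prop : Measurable fun t : ℝ => 2 * t - 0) m₁
    have mU₂ : MeasurableSet U₂ := (by fun_prop : Measurable fun t : ℝ => 2 * t - 1) m₂
    have hsub : {t | t ∈ Ioo (0 : ℝ) 1 ∧ c t ∉ E} ⊆ U₁ ∪ U₂ := fun t ht => by
      rcases hcov t ht.1 ht.2 with ⟨-, h4⟩ | ⟨-, h4⟩
      · exact Or.inl h4
      · exact Or.inr h4
    refine (lintegral_mono_set hsub).trans ((lintegral_union_le _ _ _).trans (le_of_eq ?_))
    congr 1
    · refine setLIntegral_congr_fun mU₁ fun t ht => ?_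
      have ht2 : t < 1 / 2 := by
        have := ht.1.2
        simp only at this
        linarith
      simp only [(hl t ht2).eq_of_nhds, (hl' t ht2).deriv_eq]
    · refine setLIntegral_congr_fun mU₂ fun t ht => ?_
      have ht2 : 1 / 2 < t := by
        have := ht.1.1
        simp only at this
        linarith
      simp only [(hr t ht2).eq_of_nhds, (hr' t ht2).deriv_eq]

variable {Q : ℍ → ℂ}

theorem exists_path_seg (hQ : Continuous Q) (x y : ℍ) : ∃ c E, IsPath c E ∧ c 0 = x ∧ c 1 = y ∧
    pathCost Q c E ≤ ENNReal.ofReal (seg Q x y) := by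
  have hev : ∀ t ∈ Ioo (0 : ℝ) 1, (fun s => (segPt x y s : ℂ)) =ᶠ[𝓝 t]
      fun s : ℝ => (x : ℂ) + s * ((y : ℂ) - x) := fun t ht => by
    filter_upwards [isOpen_Ioo.mem_nhds ht] with s hs
    exact coe_segPt x y (Ioo_subset_Icc_self hs)
  have hcs : Continuous (segPt x y) :=
    continuous_segPt.comp
      (continuous_const.prodMk continuous_id : Continuous fun t : ℝ => ((x, y), t))
  refine ⟨segPt x y, ∅, ⟨hcs.continuousOn, isLocFinite_empty, fun t ht _ => ?_⟩, ?_, ?_, ?_⟩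
  · refine ContDiffAt.congr_of_eventuallyEq ?_ (hev t ht)
    exact contDiffAt_const.add (Complex.ofRealCLM.contDiff.contDiffAt.mul contDiffAt_const)
  · refine UpperHalfPlane.ext ?_
    rw [coe_segPt x y (by simp)]; simp
  · refine UpperHalfPlane.ext ?_
    rw [coe_segPt x y (by simp)]; simp
  · have hco : Continuous fun t : ℝ => transverse (Q (segPt x y t)) ((y : ℂ) - x) :=
      continuous_transverse.comp ((hQ.comp hcs).prodMk continuous_const)
    rw [seg, segInt, intervalIntegral.integral_of_le zero_le_one,
      ofReal_integral_eq_lintegral_ofReal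
        (hco.integrableOn_Icc.mono_set Ioc_subset_Icc_self)
        (ae_of_all _ fun _ => transverse_nonneg _ _), setLIntegral_congr Ioo_ae_eq_Ioc.symm]
    refine (lintegral_mono_set (fun t ht => ht.1)).trans (le_of_eq ?_)
    refine setLIntegral_congr_fun measurableSet_Ioo fun t ht => ?_
    have hd : deriv (fun s => (segPt x y s : ℂ)) t = (y : ℂ) - x := by
      rw [(hev t ht).deriv_eq]
      have h1 : HasDerivAt (fun s : ℝ => (x : ℂ) + s * ((y : ℂ) - x)) (1 * ((y : ℂ) - x)) t :=
        ((Complex.ofRealCLM.hasDerivAt (x := t)).mul_const _).const_add _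
      rw [h1.deriv, one_mul]
    simp only [hd]

theorem exists_path_chainSum (hQ : Continuous Q) (x : ℍ) (L : List ℕ) (y : ℍ) :
    ∃ c E, IsPath c E ∧ c 0 = x ∧ c 1 = y ∧
      pathCost Q c E ≤ ENNReal.ofReal (chainSum Q x L y) := by
  induction L generalizing x with
  | nil => exact exists_path_seg hQ x y
  | cons n L ih =>
    obtain ⟨c₁, E₁, h₁, a₁, b₁, l₁⟩ := exists_path_seg hQ x (densePt n)
    obtain ⟨c₂, E₂, h₂, a₂, b₂, l₂⟩ := ih (densePt n)
    obtain ⟨c, E, h, a, b, l⟩ := h₁.concat h₂ (b₁.trans a₂.symm) Q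
    refine ⟨c, E, h, a.trans a₁, b.trans b₂, l.trans ?_⟩
    rw [chainSum, ENNReal.ofReal_add (seg_nonneg _ _ _) (chainSum_nonneg _ _ _ _)]
    gcongr

variable {S : ClosedSurface}

/-- Intersection numbers can be computed with countably many polygons. -/
theorem curveInf_eq_iInf_chainSum (hQ : Continuous Q) (α : S.Curve) :
    S.curveInf Q α = ⨅ (n : ℕ) (L : List ℕ),
      ENNReal.ofReal (chainSum Q (densePt n) L ((α.1 : SL(2, ℝ)) • densePt n)) := by
  refine le_antisymm (le_iInf₂ fun n L => ?_) ?_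
  · obtain ⟨c, E, h, h0, h1, hl⟩ := exists_path_chainSum hQ (densePt n) L
      ((α.1 : SL(2, ℝ)) • densePt n)
    exact (curveInf_le Q ⟨h.cont, by rw [h0, h1]⟩ h.locFinite h.diff).trans hl
  · refine le_iInf fun c => le_iInf fun E => le_iInf fun hc => le_iInf fun hE =>
      le_iInf fun hcd => ?_
    refine le_trans ?_ (polyDist_le_lintegral hQ hc.1 hE hcd)
    refine ENNReal.le_of_forall_pos_le_add fun ε hε _ => ?_
    have hε' : (0 : ℝ) < ε := by exact_mod_cast hε
    obtain ⟨L, hL⟩ := exists_lt_of_ciInf_lt (lt_add_of_pos_right (polyDist Q (c 0) (c 1)) hε')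
    -- The starting point can be moved to a dense point if the end point moves along with it under
    -- the deck transformation; intermediate vertices stay.
    have hcont : Continuous fun w : ℍ => chainSum Q w L ((α.1 : SL(2, ℝ)) • w) := by
      have h1 := (continuous_chainSum hQ L).comp (continuous_id.prodMk
        (continuous_smul_sl (α.1 : SL(2, ℝ))) : Continuous fun w : ℍ => (w, (α.1 : SL(2, ℝ)) • w))
      exact h1
    rw [hc.2] at hL
    obtain ⟨n, hn⟩ := exists_densePt (hcont.continuousAt.eventually (gt_mem_nhds hL))
    refine (iInf₂_le n L).trans ?_
    rw [← ENNReal.ofReal_coe_nnreal (p := ε), ← ENNReal.ofReal_add (polyDist_nonneg _ _ _) hε'.le]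
    refine ENNReal.ofReal_le_ofReal ?_
    rw [hc.2]
    exact hn.le

/-! ### Measurability of the vertical foliation -/

theorem measurable_eval (z : ℍ) : Measurable fun q : S.UnitQD => q.1 z :=
  (measurable_pi_apply z).comp measurable_subtype_coe

theorem measurable_seg (x y : ℍ) : Measurable fun q : S.UnitQD => seg q.1 x y := by
  have hcs : Continuous (segPt x y) :=
    continuous_segPt.comp
      (continuous_const.prodMk continuous_id : Continuous fun t : ℝ => ((x, y), t))
  have h1 : Measurable (Function.uncurry fun (t : ℝ) (q : S.UnitQD) =>
      transverse (q.1 (segPt x y t)) ((y : ℂ) - x)) := by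
    refine measurable_uncurry_of_continuous_of_measurable (fun q => ?_) fun t => ?_
    · exact continuous_transverse.comp ((q.continuous.comp hcs).prodMk continuous_const)
    · exact continuous_transverse.measurable.comp ((measurable_eval _).prodMk measurable_const)
  have h2 : Measurable (Function.uncurry fun (q : S.UnitQD) (t : ℝ) =>
      transverse (q.1 (segPt x y t)) ((y : ℂ) - x)) := h1.comp measurable_swap
  have h3 := (h2.stronglyMeasurable.integral_prod_right (ν := volume.restrict (Ioc (0 : ℝ) 1)))
  simp only [seg, segInt, intervalIntegral.integral_of_le zero_le_one]
  exact h3.measurable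

theorem measurable_chainSum (x : ℍ) (L : List ℕ) (y : ℍ) :
    Measurable fun q : S.UnitQD => chainSum q.1 x L y := by
  induction L generalizing x with
  | nil => exact measurable_seg x y
  | cons n L ih => exact (measurable_seg x _).add (ih _)

/-- The infimum over all curves becomes a countable infimum of polygon sums, each measurable in `q`;
this is the purpose of the polygons. -/
theorem measurable_height : Measurable fun q : S.UnitQD => S.height q.1 := by
  refine measurable_pi_iff.mpr fun α => ?_
  simp only [height_eq, fun q : S.UnitQD => curveInf_eq_iInf_chainSum q.continuous α]
  exact (Measurable.iInf fun n => Measurable.iInf fun L =>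
    (measurable_chainSum _ _ _).ennreal_ofReal).ennreal_toReal

theorem measurable_mkProj : Measurable S.mkProj := measurable_quot_mk

theorem measurable_vertical : Measurable S.vertical := measurable_mkProj.comp measurable_height

end ClosedSurface

namespace ClosedSurface

variable {S : ClosedSurface}

/-! ### The Thurston conformal density -/

theorem mkProj_smul {t : ℝ} (ht : 0 < t) (ξ : S.Curve → ℝ) : S.mkProj (t • ξ) = S.mkProj ξ :=
  (Quot.sound ⟨t, ht, rfl⟩).symm

/-- Measurable cones are the preimages of measurable sets of projective classes. -/
theorem exists_measurable_proj {A : Set (S.Curve → ℝ)} (hA : MeasurableSet A)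
    (hcone : ∀ t : ℝ, 0 < t → ∀ ξ, t • ξ ∈ A ↔ ξ ∈ A) :
    ∃ V : Set S.Proj, MeasurableSet V ∧ ∀ ξ, S.mkProj ξ ∈ V ↔ ξ ∈ A := by
  let V : Set S.Proj := {p | Quot.lift (· ∈ A)
    (fun ξ η ⟨t, ht, h⟩ => by rw [h]; exact propext (hcone t ht ξ).symm) p}
  have hV : ∀ ξ, S.mkProj ξ ∈ V ↔ ξ ∈ A := fun ξ => Iff.rfl
  refine ⟨V, ?_, hV⟩
  have h1 : S.mkProj ⁻¹' V = A := ext hV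
  change MeasurableSet (S.mkProj ⁻¹' V)
  rwa [h1]

theorem IsThurstonMeasure.isHomogeneousMeasure {ν : Measure (S.Curve → ℝ)}
    (h : S.IsThurstonMeasure ν) : IsHomogeneousMeasure S.dimT ν := by
  intro u A
  have h1 : (fun ξ : S.Curve → ℝ => Real.exp u • ξ) ⁻¹' A =
      (fun ξ => Real.exp (-u) • ξ) '' A := by
    ext ξ
    constructor
    · intro hξ
      exact ⟨Real.exp u • ξ, hξ, by simp [smul_smul, ← Real.exp_add]⟩
    · rintro ⟨η, hη, rfl⟩
      simpa [smul_smul, ← Real.exp_add] using hη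
  rw [h1, h.homogeneous _ (Real.exp_pos _), ← Real.exp_mul]
  congr 3
  ring

theorem extLength_exp_smul_le (x : S.Teich) (ξ : S.Curve → ℝ) (u : ℝ) :
    S.extLength x (Real.exp u • ξ) ≤ ENNReal.ofReal (Real.exp (2 * u)) * S.extLength x ξ := by
  obtain ⟨b, rfl⟩ : ∃ b, S.mkTeich b = x := Quot.exists_rep x
  rw [extLength_mkTeich, extLength_mkTeich]
  have h := extStr_smul_le b ξ (Real.exp_pos u)
  rwa [← Real.exp_nat_mul] at h

theorem extLength_exp_smul_le_one {x : S.Teich} {ξ : S.Curve → ℝ} {s u : ℝ}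
    (h : S.extLength x ξ ≤ ENNReal.ofReal (Real.exp s)) (hu : 2 * u + s ≤ 0) :
    S.extLength x (Real.exp u • ξ) ≤ 1 := by
  refine (extLength_exp_smul_le x ξ u).trans ?_
  calc _ ≤ ENNReal.ofReal (Real.exp (2 * u)) * ENNReal.ofReal (Real.exp s) := by gcongr
    _ = ENNReal.ofReal (Real.exp (2 * u + s)) := by
      rw [← ENNReal.ofReal_mul (Real.exp_nonneg _), Real.exp_add]
    _ ≤ 1 := by
      rw [ENNReal.ofReal_le_one]
      exact Real.exp_le_one_iff.mpr hu

theorem thurstonDensity_apply (ν : Measure (S.Curve → ℝ)) (x : S.Teich) {V : Set S.Proj}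
    (hV : MeasurableSet V) : S.thurstonDensity ν x V =
      (ν {ξ | S.extLength S.base ξ ≤ 1})⁻¹ * ν (S.mkProj ⁻¹' V ∩ {ξ | S.extLength x ξ ≤ 1}) := by
  rw [thurstonDensity, Measure.smul_apply, thurstonDensity₀, thurstonDensity₀,
    Measure.map_apply measurable_mkProj MeasurableSet.univ,
    Measure.map_apply measurable_mkProj hV, Measure.restrict_apply (measurable_mkProj hV),
    preimage_univ, Measure.restrict_apply_univ, smul_eq_mul]

/-- Points of Teichmüller space at finite distance have comparable densities. -/
theorem exists_thurstonDensity_le {ν : Measure (S.Curve → ℝ)}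
    (hν : IsHomogeneousMeasure S.dimT ν) (x y : S.Teich) :
    ∃ K : ℝ≥0, S.thurstonDensity ν x ≤ K • S.thurstonDensity ν y := by
  obtain ⟨b₁, rfl⟩ : ∃ b, S.mkTeich b = x := Quot.exists_rep x
  obtain ⟨b₂, rfl⟩ : ∃ b, S.mkTeich b = y := Quot.exists_rep y
  obtain ⟨K, hK, h⟩ := exists_qcRel b₁ b₂
  -- Extremal length is quadratic, so a dilation by `K^{-1/2}` compensates a factor `K` and maps one
  -- unit ball into the other.
  set u := -(Real.log K / 2) with hu
  refine ⟨Real.toNNReal (Real.exp (-(S.dimT * u))), Measure.le_iff.mpr fun V hV => ?_⟩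
  rw [Measure.smul_apply, thurstonDensity_apply ν _ hV, thurstonDensity_apply ν _ hV,
    ENNReal.smul_def, smul_eq_mul, mul_left_comm]
  refine mul_le_mul_right ?_ _
  change _ ≤ ENNReal.ofReal (Real.exp (-(S.dimT * u))) * _
  rw [← hν u]
  refine measure_mono fun ξ hξ => ⟨?_, ?_⟩
  · have := hξ.1
    rwa [mem_preimage, ← mkProj_smul (Real.exp_pos u)] at this
  · refine extLength_exp_smul_le_one (s := Real.log K) ?_ (by rw [hu]; linarith)
    rw [Real.exp_log (by linarith), extLength_mkTeich]
    refine (h.extStr_le hK ξ).trans ?_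
    have h1 : S.extStr b₁ ξ ≤ 1 := by rw [← extLength_mkTeich]; exact hξ.2
    calc _ ≤ ENNReal.ofReal K * 1 := by gcongr
      _ = _ := mul_one _

/-- A lower bound for the density at `y` with respect to the density at the base point. The set
`V` consists of classes of points whose extremal length at `y` is small, and on whose rays the unit
ball of the base point is not too large. -/
theorem measure_rnDeriv_lt_eq_zero {ν : Measure (S.Curve → ℝ)} (hd : 0 < S.dimT)
    {B : Set (S.Curve → ℝ)} (hB : MeasurableSet B)
    (hint : ∀ H, MeasurableSet H → ∫⁻ ξ in {ξ | S.extLength S.base ξ ≤ 1},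
      radialMass S.dimT H ξ / radialMass S.dimT B ξ ∂ν ≤ ν H)
    [IsFiniteMeasure (S.thurstonDensity ν S.base)] {y : S.Teich}
    [IsFiniteMeasure (S.thurstonDensity ν y)]
    (hac : S.thurstonDensity ν y ≪ S.thurstonDensity ν S.base) {s : ℝ} {j : ℝ≥0∞}
    {V : Set S.Proj} (hV : ∀ p ∈ V, ∃ ξ, S.mkProj ξ = p ∧
      S.extLength y ξ ≤ ENNReal.ofReal (Real.exp (-(2 * s))) ∧ radialMass S.dimT B ξ ≤ j) :
    S.thurstonDensity ν S.base (V ∩ {p | (S.thurstonDensity ν y).rnDeriv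
      (S.thurstonDensity ν S.base) p < ENNReal.ofReal (Real.exp (S.dimT * (s - 1))) / j}) = 0 := by
  set d := S.dimT with hdd
  set μ := S.thurstonDensity ν S.base with hμ
  set f := (S.thurstonDensity ν y).rnDeriv μ with hf
  set θ := ENNReal.ofReal (Real.exp (d * (s - 1))) / j with hθ
  set A := {ξ | S.extLength S.base ξ ≤ 1} with hA
  set a := (ν A)⁻¹ with ha
  set U₀ := V ∩ {p | f p < θ} with hU₀
  have hfm : Measurable f := Measure.measurable_rnDeriv _ _
  -- A measurable set with the outer measure of `U₀` on which the density is still below `θ`.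
  set U := toMeasurable μ U₀ ∩ {p | f p < θ} with hU
  have hUm : MeasurableSet U :=
    (measurableSet_toMeasurable _ _).inter (measurableSet_lt hfm measurable_const)
  have hU₀U : U₀ ⊆ U := fun p hp => ⟨subset_toMeasurable _ _ hp, hp.2⟩
  have hUU₀ : μ U = μ U₀ := le_antisymm
    ((measure_mono inter_subset_left).trans (measure_toMeasurable _).le) (measure_mono hU₀U)
  -- A measurable hull of the part of the unit ball at `y` over `U`. Its measure is exactly the mass
  -- of `U` for the density at `y`, up to normalization.
  set H := toMeasurable ν (S.mkProj ⁻¹' U ∩ {ξ | S.extLength y ξ ≤ 1}) with hH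
  have hHm : MeasurableSet H := measurableSet_toMeasurable _ _
  have hyU : S.thurstonDensity ν y U = a * ν H := by
    rw [thurstonDensity_apply ν y hUm, hH, measure_toMeasurable]
  -- the quotient of the radial masses is a function of the class
  set g : (S.Curve → ℝ) → ℝ≥0∞ := fun ξ => radialMass d H ξ / radialMass d B ξ with hg
  have hgm : Measurable g := (measurable_radialMass d hHm).div (measurable_radialMass d hB)
  have hginv : ∀ u : ℝ, ∀ ξ, g (Real.exp u • ξ) = g ξ := fun u ξ => by
    simp only [hg, radialMass_exp_smul]
    exact ENNReal.mul_div_mul_left _ _ (ENNReal.ofReal_pos.mpr (Real.exp_pos _)).ne'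
      ENNReal.ofReal_ne_top
  obtain ⟨W, hWm, hW⟩ := exists_measurable_proj (A := {ξ | θ ≤ g ξ})
    (measurableSet_le measurable_const hgm) fun t ht ξ => by
      rw [mem_ofPred_eq, mem_ofPred_eq, ← Real.exp_log ht, hginv]
  have hU₀W : U₀ ⊆ W := by
    intro p hp
    obtain ⟨ξ, rfl, hξy, hξj⟩ := hV p hp.1
    refine (hW ξ).mpr ?_
    -- As `Ext_y(ξ) ≤ e^{-2s}`, the ray of `ξ` stays in the unit ball at `y` up to the parameter
    -- `e^s`.
    have h1 : ENNReal.ofReal (Real.exp (d * (s - 1))) ≤ radialMass d H ξ := by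
      refine le_radialMass hd.le fun u hu => subset_toMeasurable _ _ ⟨?_, ?_⟩
      · rw [mem_preimage, mkProj_smul (Real.exp_pos u)]
        exact hU₀U hp
      · exact extLength_exp_smul_le_one hξy (by linarith)
    exact ENNReal.div_le_div h1 hξj
  have hUW : μ (U ∩ W) = μ U := le_antisymm (measure_mono inter_subset_left) <| by
    rw [hUU₀]; exact measure_mono (subset_inter hU₀U hU₀W)
  -- The quotient of radial masses is at least `θ` on `W`, which carries all of the mass of `U`;
  -- averaging it over the unit ball at the base point gives at most `ν H`.
  have hlow : θ * μ U ≤ S.thurstonDensity ν y U := by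
    rw [hyU, ← hUW, hμ, thurstonDensity_apply ν _ (hUm.inter hWm), mul_left_comm]
    refine mul_le_mul_right (le_trans ?_ (hint H hHm)) _
    have hm : MeasurableSet (S.mkProj ⁻¹' (U ∩ W)) := measurable_mkProj (hUm.inter hWm)
    calc θ * ν (S.mkProj ⁻¹' (U ∩ W) ∩ A)
        = ∫⁻ _ in S.mkProj ⁻¹' (U ∩ W), θ ∂(ν.restrict A) := by
          rw [setLIntegral_const, Measure.restrict_apply hm]
      _ ≤ ∫⁻ ξ in S.mkProj ⁻¹' (U ∩ W), g ξ ∂(ν.restrict A) :=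
          setLIntegral_mono' hm fun ξ hξ => (hW ξ).mp hξ.2
      _ ≤ ∫⁻ ξ in A, g ξ ∂ν := setLIntegral_le_lintegral _ _
  rw [← hUU₀]
  by_contra h0
  rw [← Measure.setLIntegral_rnDeriv hac] at hlow
  -- If `U` had positive mass, `f < θ` on `U` would contradict `hlow`.
  have hlt : ∫⁻ p in U, f p ∂μ < ∫⁻ _ in U, θ ∂μ := by
    refine setLIntegral_strict_mono hUm h0 measurable_const ?_ (ae_of_all _ fun p hp => hp.2)
    rw [Measure.setLIntegral_rnDeriv hac]
    exact measure_ne_top _ _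
  rw [setLIntegral_const] at hlt
  exact absurd hlow (not_le.mpr hlt)

/-- The total mass of the normalized density is `a⁻¹ a` with `a` the measure of the unit ball. In
`ℝ≥0∞` this is `0` if `a` is `0` or `∞`, which is impossible since a multiple of the density
dominates a probability measure. -/
theorem IsTeichAveraging.measure_ball_pos_lt_top {ν : Measure (S.Curve → ℝ)}
    {m : ℝ → Measure S.Teich} (hm : S.IsTeichAveraging (S.thurstonDensity ν S.base) m) :
    ν {ξ | S.extLength S.base ξ ≤ 1} ≠ 0 ∧ ν {ξ | S.extLength S.base ξ ≤ 1} ≠ ⊤ ∧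
      IsProbabilityMeasure (S.thurstonDensity ν S.base) := by
  obtain ⟨κ, hκ, -, C, -, hle, -⟩ := hm
  have h1 : IsProbabilityMeasure (κ.map S.vertical) :=
    Measure.isProbabilityMeasure_map measurable_vertical.aemeasurable
  have h2 := hle univ
  rw [measure_univ, Measure.smul_apply, thurstonDensity_apply ν _ MeasurableSet.univ,
    preimage_univ, univ_inter] at h2
  have h0 : ν {ξ | S.extLength S.base ξ ≤ 1} ≠ 0 := fun h => by
    rw [h] at h2
    simp at h2
  have ht : ν {ξ | S.extLength S.base ξ ≤ 1} ≠ ⊤ := fun h => by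
    rw [h] at h2
    simp at h2
  refine ⟨h0, ht, ⟨?_⟩⟩
  rw [thurstonDensity_apply ν _ MeasurableSet.univ, preimage_univ, univ_inter,
    ENNReal.inv_mul_cancel h0 ht]

/-- Points of the ray of `q` close to `y`. -/
theorem dist_and_extLength_of_near {r c : ℝ} (hr : 0 ≤ r) {q : S.UnitQD}
    {y : S.Teich} (h : S.teichDist (S.ray r q) y < c) :
    S.teichDist S.base y ≤ r + c ∧
      S.extLength y (S.height q.1) ≤ ENNReal.ofReal (Real.exp (-(2 * (r - c)))) := by
  obtain ⟨b, rfl⟩ : ∃ b, S.mkTeich b = y := Quot.exists_rep y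
  obtain ⟨K, hK, hKc, hq⟩ := exists_qcRel_of_teichDist_lt h
  constructor
  · have h1 : 1 ≤ Real.exp (2 * r) := Real.one_le_exp (by linarith)
    have h2 := (qcRel_rayStr hr q).trans hq (by linarith)
    refine (teichDist_mk_le (one_le_mul_of_one_le_of_one_le h1 hK) h2).trans ?_
    have h3 : Real.log K ≤ 2 * c := by
      rw [← Real.log_exp (2 * c)]
      exact Real.log_le_log (by linarith) hKc.le
    rw [Real.log_mul (by positivity) (by positivity), Real.log_exp]
    linarith
  · rw [extLength_mkTeich]
    calc _ ≤ ENNReal.ofReal K * S.extStr (S.rayStr r q) (S.height q.1) := hq.extStr_le hK _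
      _ ≤ ENNReal.ofReal (Real.exp (2 * c)) * ENNReal.ofReal (Real.exp (-2 * r)) := by
        gcongr
        exact extStr_rayStr_le r q
      _ = _ := by
        rw [← ENNReal.ofReal_mul (Real.exp_nonneg _), ← Real.exp_add]
        congr 2
        ring

theorem isOpen_near_orbit (c : ℝ) :
    IsOpen {x : S.Teich | ∃ y : S.mcgOrbit, S.teichDist x y.1 < c} := by
  have h : {x : S.Teich | ∃ y : S.mcgOrbit, S.teichDist x y.1 < c} =
      ⋃ y : S.mcgOrbit, {x | S.teichDist y.1 x < c} := by
    ext x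
    simp only [mem_iUnion, mem_ofPred_eq, teichDist_comm]
  rw [h]
  exact isOpen_iUnion fun y => TopologicalSpace.isOpen_generateFrom_of_mem ⟨y.1, c, rfl⟩

/-- If the spheres return, then so do many rays. -/
theorem le_measure_near_orbit {κ : Measure S.UnitQD} {r c α : ℝ} (hα : 0 < α)
    (h : ENNReal.ofReal α ≤ κ.map (S.ray r)
      {x | quotientDist S.teichDist (fun y : S.mcgOrbit => y.1) x ≤ c}) :
    ENNReal.ofReal α ≤ κ {q | ∃ y : S.mcgOrbit, S.teichDist (S.ray r q) y.1 < c + 1} := by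
  -- Otherwise the push-forward would be the zero measure, against the lower bound by `α > 0`.
  have hae : AEMeasurable (S.ray r) κ := by
    by_contra hn
    rw [Measure.map_of_not_aemeasurable hn] at h
    simp only [Measure.coe_zero, Pi.zero_apply, nonpos_iff_eq_zero, ENNReal.ofReal_eq_zero] at h
    linarith
  refine (h.trans (measure_mono fun x hx => ?_)).trans
    (Measure.map_apply_of_aemeasurable hae (isOpen_near_orbit (c + 1)).measurableSet).le
  exact exists_lt_of_ciInf_lt (hx.trans_lt (lt_add_one c))

/-- The base point alone contributes the derivative `1`, and `e^{dn} ≤ 1`. Thus the positivity of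
`6g - 6` need not be derived from the definition of the genus as a Betti number. -/
theorem nonVanishingECG_of_dimT_nonpos {ν : Measure (S.Curve → ℝ)}
    [IsProbabilityMeasure (S.thurstonDensity ν S.base)] (hd : S.dimT ≤ 0) :
    NonVanishingECG S.teichDist (fun y : S.mcgOrbit => y.1) (S.thurstonDensity ν) S.base
      S.dimT := by
  refine nonVanishingECG_of_le 1 one_pos (Eventually.of_forall fun n => ?_)
  have h1 : Real.exp (S.dimT * n) ≤ 1 :=
    Real.exp_le_one_iff.mpr (mul_nonpos_of_nonpos_of_nonneg hd (Nat.cast_nonneg n))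
  have h0 : S.teichDist S.base S.base ≤ n := by
    have := teichDist_mk_le le_rfl (qcRel_one_refl S.baseStr)
    rw [Real.log_one, mul_zero] at this
    exact this.trans (Nat.cast_nonneg n)
  calc 1 * ENNReal.ofReal (Real.exp (S.dimT * n)) ≤ 1 := by
        rw [one_mul]; exact ENNReal.ofReal_le_one.mpr h1
    _ = ∫⁻ _, 1 ∂(S.thurstonDensity ν S.base) := by simp
    _ ≤ _ := by
      refine lintegral_mono_ae ?_
      filter_upwards [(S.thurstonDensity ν S.base).rnDeriv_self] with p hp
      rw [← hp]
      exact le_iSup₂_of_le (f := fun (y : S.mcgOrbit) (_ : S.teichDist S.base y.1 ≤ n) =>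
        (S.thurstonDensity ν y.1).rnDeriv (S.thurstonDensity ν S.base) p)
        ⟨S.base, S.base_mem_mcgOrbit⟩ h0 le_rfl

/-- Teichmüller space: if the spheres return, the extremal cocycle growth does not vanish. -/
theorem IsTeichAveraging.nonVanishingECG {ν : Measure (S.Curve → ℝ)} {m : ℝ → Measure S.Teich}
    (hν : S.IsThurstonMeasure ν) (hm : S.IsTeichAveraging (S.thurstonDensity ν S.base) m)
    (hs : SpheresReturn S.teichDist (fun y : S.mcgOrbit => y.1) m) :
    NonVanishingECG S.teichDist (fun y : S.mcgOrbit => y.1) (S.thurstonDensity ν) S.base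
      S.dimT := by
  obtain ⟨h0, htop, hprob⟩ := hm.measure_ball_pos_lt_top
  rcases le_or_gt S.dimT 0 with hd | hd
  · exact nonVanishingECG_of_dimT_nonpos hd
  have hcc : Countable S.Curve := S.countable_curve
  obtain ⟨κ, hκ, hray, C, hC, hle, -⟩ := hm
  obtain ⟨c, R₀, α, hc, hR₀, hα, -, hret⟩ := hs
  have hhom := hν.isHomogeneousMeasure
  set μ := S.thurstonDensity ν S.base with hμ
  set A := {ξ | S.extLength S.base ξ ≤ 1} with hA
  have hstar : ∀ ξ ∈ A, ∀ u ≤ 0, Real.exp u • ξ ∈ A := fun ξ hξ u hu =>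
    extLength_exp_smul_le_one (s := 0) (by rw [Real.exp_zero, ENNReal.ofReal_one]; exact hξ)
      (by linarith)
  obtain ⟨B, hBm, -, hBfin, hBint⟩ := hhom.exists_radial_hull hd htop.lt_top hstar
  have hfinite : ∀ y, IsFiniteMeasure (S.thurstonDensity ν y) ∧ S.thurstonDensity ν y ≪ μ := by
    intro y
    obtain ⟨K, hK⟩ := exists_thurstonDensity_le hhom y S.base
    refine ⟨⟨(hK univ).trans_lt ?_⟩, Measure.absolutelyContinuous_of_le_smul (c := K) hK⟩
    rw [Measure.smul_apply, ENNReal.smul_def, smul_eq_mul]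
    exact ENNReal.mul_lt_top ENNReal.coe_lt_top (measure_lt_top _ _)
  -- The null sets below come from sets that need not be measurable, hence the passage to a
  -- measurable hull.
  have hnull : ∀ N : Set S.Proj, μ N = 0 → κ (S.vertical ⁻¹' N) = 0 := fun N hN => by
    have h1 : κ.map S.vertical ≪ μ := Measure.absolutelyContinuous_of_le_smul (c := C) hle
    exact measure_mono_null (preimage_mono (subset_toMeasurable _ N)) <| by
      rw [← Measure.map_apply measurable_vertical (measurableSet_toMeasurable _ _)]
      exact h1 (by rw [measure_toMeasurable, hN])
  -- the radial mass is bounded off a small set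
  obtain ⟨j, hj⟩ : ∃ j : ℕ, κ {q | (j : ℝ≥0∞) < radialMass S.dimT B (S.height q.1)} ≤
      ENNReal.ofReal (α / 2) := by
    have hΨm : Measurable fun q : S.UnitQD => radialMass S.dimT B (S.height q.1) :=
      (measurable_radialMass _ hBm).comp measurable_height
    -- Infinite radial mass is a property of the projective class, so the almost everywhere
    -- finiteness on the unit ball passes to `μ` and then to `κ`.
    have hzero : κ {q | radialMass S.dimT B (S.height q.1) = ⊤} = 0 := by
      obtain ⟨W, hWm, hW⟩ := exists_measurable_proj (A := {ξ | radialMass S.dimT B ξ = ⊤})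
        (measurable_radialMass _ hBm (measurableSet_singleton ⊤)) fun t ht ξ => by
          rw [mem_ofPred_eq, mem_ofPred_eq, ← Real.exp_log ht, radialMass_exp_smul,
            ENNReal.mul_eq_top]
          simp [Real.exp_pos]
      have h1 : μ W = 0 := by
        rw [hμ, thurstonDensity_apply ν _ hWm]
        have h2 : ν (S.mkProj ⁻¹' W ∩ A) = 0 := by
          rw [← Measure.restrict_apply (measurable_mkProj hWm)]
          refine measure_mono_null (fun ξ hξ => ?_) (ae_iff.mp hBfin)
          rw [mem_ofPred_eq, not_lt, top_le_iff]
          exact (hW ξ).mp hξ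
        rw [h2, mul_zero]
      exact measure_mono_null (fun q hq => (hW _).mpr hq) (hnull W h1)
    have hanti : Antitone fun j : ℕ =>
        {q : S.UnitQD | (j : ℝ≥0∞) < radialMass S.dimT B (S.height q.1)} := fun i k hik q hq =>
      lt_of_le_of_lt (Nat.cast_le.mpr hik : (i : ℝ≥0∞) ≤ k) hq
    have hlim := tendsto_measure_iInter_atTop (μ := κ)
      (fun j : ℕ => (measurableSet_lt (measurable_const (a := (j : ℝ≥0∞))) hΨm).nullMeasurableSet)
      hanti ⟨0, measure_ne_top _ _⟩
    have hint : ⋂ j : ℕ, {q : S.UnitQD | (j : ℝ≥0∞) < radialMass S.dimT B (S.height q.1)} =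
        {q | radialMass S.dimT B (S.height q.1) = ⊤} := by
      ext q
      simp only [mem_iInter, mem_ofPred_eq]
      constructor
      · intro h
        by_contra hne
        obtain ⟨k, hk⟩ := ENNReal.exists_nat_gt hne
        exact absurd (h k) (not_lt.mpr hk.le)
      · intro h k
        rw [h]
        exact ENNReal.natCast_lt_top k
    rw [hint, hzero] at hlim
    obtain ⟨k, hk⟩ := (hlim.eventually (gt_mem_nhds (ENNReal.ofReal_pos.mpr (half_pos hα)))).exists
    exact ⟨k, hk.le⟩
  have hC0 : (C : ℝ≥0∞) ≠ 0 := by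
    have : C ≠ 0 := (zero_lt_one.trans_le hC).ne'
    exact_mod_cast this
  -- The summand `1` makes the denominator nonzero.
  set J : ℝ≥0∞ := (j : ℝ≥0∞) + 1 with hJ
  have hJ0 : J ≠ 0 := by simp [hJ]
  have hJt : J ≠ ⊤ := by simp [hJ]
  -- Below, `s - 1 = n - 2 (c + 1) - 1 = n - (2 c + 3)`: one `c + 1` is lost in the radius, one in
  -- the extremal length, and `1` in the radial integral.
  set e₀ : ℝ≥0∞ := ENNReal.ofReal (Real.exp (-(S.dimT * (2 * c + 3)))) with he₀
  set δ : ℝ≥0∞ := ENNReal.ofReal (α / 2) / C with hδ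
  refine nonVanishingECG_of_le (e₀ / J * δ) ?_ ?_
  · refine ENNReal.mul_pos (ENNReal.div_pos ?_ hJt).ne' (ENNReal.div_pos ?_ ENNReal.coe_ne_top).ne'
    · exact (ENNReal.ofReal_pos.mpr (Real.exp_pos _)).ne'
    · exact (ENNReal.ofReal_pos.mpr (half_pos hα)).ne'
  filter_upwards [eventually_ge_atTop ⌈R₀ + c + 1⌉₊] with n hn
  have hn' : R₀ + c + 1 ≤ n := (Nat.le_ceil _).trans (by exact_mod_cast hn)
  -- Orbit points within `c + 1` of the sphere of radius `r` are within `n` of the base point, so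
  -- they enter the maximum `A_n`.
  set r : ℝ := n - (c + 1) with hr
  have hrR : R₀ ≤ r := by rw [hr]; linarith
  set s : ℝ := r - (c + 1) with hsr
  set θ : ℝ≥0∞ := ENNReal.ofReal (Real.exp (S.dimT * (s - 1))) / J with hθ
  set F : S.Proj → ℝ≥0∞ := extremalValue S.teichDist (fun y : S.mcgOrbit => y.1)
    (S.thurstonDensity ν) S.base n with hF
  have hFm : Measurable F := by
    refine Measurable.iSup fun y => Measurable.iSup fun _ => ?_
    exact Measure.measurable_rnDeriv _ _
  set T := {q : S.UnitQD | ∃ y : S.mcgOrbit, S.teichDist (S.ray r q) y.1 < c + 1} with hT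
  set Q' := {q : S.UnitQD | (j : ℝ≥0∞) < radialMass S.dimT B (S.height q.1)} with hQ'
  set V : S.mcgOrbit → Set S.Proj := fun y => {p | ∃ q : S.UnitQD, q ∉ Q' ∧
    S.teichDist (S.ray r q) y.1 < c + 1 ∧ S.vertical q = p} with hV
  -- The classes where the derivative bound fails for some orbit point; the orbit being countable,
  -- they form a null set.
  set N : Set S.Proj := ⋃ y : S.mcgOrbit, V y ∩ {p | (S.thurstonDensity ν y.1).rnDeriv μ p < θ}
    with hN
  have hN0 : μ N = 0 := by
    refine measure_iUnion_null fun y => ?_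
    have := (hfinite y.1).1
    refine measure_rnDeriv_lt_eq_zero hd hBm hBint (hfinite y.1).2 ?_
    rintro p ⟨q, hq, hqy, rfl⟩
    refine ⟨S.height q.1, rfl, (dist_and_extLength_of_near (by linarith) hqy).2, ?_⟩
    exact (not_lt.mp hq).trans le_self_add
  have hκT : ENNReal.ofReal α ≤ κ T := le_measure_near_orbit hα <| by
    rw [← hray r (by linarith)]
    exact hret r hrR
  have hsub : T ⊆ S.vertical ⁻¹' {p | θ ≤ F p} ∪ (Q' ∪ S.vertical ⁻¹' N) := by
    rintro q ⟨y, hy⟩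
    by_cases hq : q ∈ Q'
    · exact Or.inr (Or.inl hq)
    by_cases hqN : S.vertical q ∈ N
    · exact Or.inr (Or.inr hqN)
    refine Or.inl ?_
    have h1 : θ ≤ (S.thurstonDensity ν y.1).rnDeriv μ (S.vertical q) := by
      by_contra hlt
      exact hqN (mem_iUnion.mpr ⟨y, ⟨q, hq, hy, rfl⟩, not_le.mp hlt⟩)
    have h2 : S.teichDist S.base y.1 ≤ n := by
      have := (dist_and_extLength_of_near (by linarith) hy).1
      rw [hr] at this
      linarith
    exact le_iSup₂_of_le (f := fun (y : S.mcgOrbit) (_ : S.teichDist S.base y.1 ≤ n) =>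
        (S.thurstonDensity ν y.1).rnDeriv (S.thurstonDensity ν S.base) (S.vertical q)) y h2 h1
  have hFset : MeasurableSet {p | θ ≤ F p} := measurableSet_le measurable_const hFm
  have hκF : ENNReal.ofReal (α / 2) ≤ C * μ {p | θ ≤ F p} := by
    -- Of the returning mass `α`, at most half is lost to large radial mass and nothing to `N`.
    have h1 : ENNReal.ofReal (α / 2) + ENNReal.ofReal (α / 2) ≤
        κ (S.vertical ⁻¹' {p | θ ≤ F p}) + ENNReal.ofReal (α / 2) := by
      rw [← ENNReal.ofReal_add (by linarith) (by linarith), add_halves]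
      calc ENNReal.ofReal α ≤ κ T := hκT
        _ ≤ _ := (measure_mono hsub).trans (measure_union_le _ _)
        _ ≤ κ (S.vertical ⁻¹' {p | θ ≤ F p}) + (κ Q' + κ (S.vertical ⁻¹' N)) := by
          gcongr
          exact measure_union_le _ _
        _ ≤ _ := by
          rw [hnull N hN0, add_zero]
          gcongr
    have h2 := (ENNReal.add_le_add_iff_right ENNReal.ofReal_ne_top).mp h1
    rw [← Measure.map_apply measurable_vertical hFset] at h2
    exact h2.trans (hle _)
  have hμF : δ ≤ μ {p | θ ≤ F p} := ENNReal.div_le_of_le_mul (by rwa [mul_comm] at hκF)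
  have hθe : e₀ / J * ENNReal.ofReal (Real.exp (S.dimT * n)) = θ := by
    rw [hθ, he₀, mul_comm, ← mul_div_assoc, ← ENNReal.ofReal_mul (Real.exp_nonneg _),
      ← Real.exp_add]
    congr 3
    rw [hsr, hr]
    ring
  calc e₀ / J * δ * ENNReal.ofReal (Real.exp (S.dimT * n)) = θ * δ := by
        rw [← hθe]; ring
    _ ≤ θ * μ {p | θ ≤ F p} := by gcongr
    _ ≤ ∫⁻ p, F p ∂μ := mul_meas_ge_le_lintegral hFm θ

end ClosedSurface

end

/-! ### The three cases of the proposition -/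

theorem proposition4p9 :
    -- proper CAT(-1) spaces
    (∀ (X : Type*) [MetricSpace X] [ProperSpace X] [MeasurableSpace X] [BorelSpace X]
        (G : Type*) [Group G] [MulAction G X] [IsIsometricSMul G X]
        [ProperlyDiscontinuousSMul G X] (o : X) (v : ℝ)
        (μ : X → Measure (HoroCompactification o)) (m : ℝ → Measure X),
      IsCATNegOne X → (∀ (g : G) (x : X), g • x = x → g = 1) → (limitSet G o).Infinite →
      0 ≤ v → IsConformalDensity G o v (limitSet G o) μ → IsProbabilityMeasure (μ o) →
      IsAveraging o (limitSet G o) (μ o) m →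
      SpheresReturn dist (fun g : G => g • o) m →
      NonVanishingECG dist (fun g : G => g • o) μ o v) ∧
    -- Teichmüller space of a closed surface with its mapping class group
    (∀ (S : ClosedSurface) (ν : Measure (S.Curve → ℝ)) (m : ℝ → Measure S.Teich),
      S.IsThurstonMeasure ν →
      S.IsTeichAveraging (S.thurstonDensity ν S.base) m →
      SpheresReturn S.teichDist (fun y : S.mcgOrbit => y.1) m →
      NonVanishingECG S.teichDist (fun y : S.mcgOrbit => y.1) (S.thurstonDensity ν) S.base
        S.dimT) ∧
    -- lattices acting on symmetric spaces of noncompact type and higher rank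
    (∀ (E : Type*) [NormedAddCommGroup E] [NormedSpace ℝ E] [FiniteDimensional ℝ E]
        (X : Type*) [MetricSpace X] [ChartedSpace E X] [IsManifold 𝓘(ℝ, E) ∞ X]
        [Bundle.RiemannianBundle (fun x : X => TangentSpace 𝓘(ℝ, E) x)]
        [IsContMDiffRiemannianBundle 𝓘(ℝ, E) ∞ E (fun x : X => TangentSpace 𝓘(ℝ, E) x)]
        [IsRiemannianManifold 𝓘(ℝ, E) X]
        [ProperSpace X] [MeasurableSpace X] [BorelSpace X]
        (G : Type*) [Group G] [MulAction G X] [IsIsometricSMul G X]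
        [ProperlyDiscontinuousSMul G X] (o : X) (k : ℕ) (z : HoroCompactification o) (v : ℝ)
        (μ : X → Measure (HoroCompactification o)) (m : ℝ → Measure X),
      IsSymmetricNoncompactType X → HasRank X k → 2 ≤ k →
      (∃ D : Set X, MeasurableSet D ∧ (∀ x : X, ∃ g : G, g • x ∈ D) ∧
        Measure.hausdorffMeasure (Module.finrank ℝ E : ℝ) D < ⊤) →
      IsRegularAtInfinity k o z →
      0 ≤ v → IsConformalDensity G o v (furstenbergOrbit o z) μ → IsProbabilityMeasure (μ o) →
      IsAveraging o (furstenbergOrbit o z) (μ o) m →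
      SpheresReturn dist (fun g : G => g • o) m →
      NonVanishingECG dist (fun g : G => g • o) μ o v) := by
  refine ⟨?_, ?_, ?_⟩
  · intro X _ _ _ _ G _ _ _ _ o v μ m _ _ _ hv hμ _ hm hs
    exact hm.nonVanishingECG hv hμ hs
  · intro S ν m hν hm hs
    exact hm.nonVanishingECG hν hs
  · intro E _ _ _ X _ _ _ _ _ _ _ _ _ G _ _ _ _ o k z v μ m _ _ _ _ _ hv hμ _ hm hs
    exact hm.nonVanishingECG hv hμ hs
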